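/- **Setting.** Fix $N$ and complex parameters $\eta$, $\varsigma_\pm,\kappa_\pm,\tau_\pm,\alpha_\pm,\beta_\pm$ (boundary), $\alpha,\beta$ (gauge), $\xi_1,\dots,\xi_N$ (inhomogeneities), with $\kappa_\pm\neq0$, $\sinh\varsigma_\pm\ne0$, and $$\sinh\alpha_\pm\cosh\beta_\pm=\frac{\sinh\varsigma_\pm}{2\kappa_\pm},\qquad \cosh\alpha_\pm\sinh\beta_\pm=\frac{\cosh\varsigma_\pm}{2\kappa_\pm}.$$ Let $\mathcal H=(\mathbb C^2)^{\otimes N}$, let $\mathcal H_0=\mathbb C^2$ be an auxiliary space, and put $$R(\lambda)=\begin{pmatrix}\sinh(\lambda+\eta)&0&0&0\\0&\sinh\lambda&\sinh\eta&0\\0&\sinh\eta&\sinh\lambda&0\\0&0&0&\sinh(\lambda+\eta)\end{pmatrix},$$ $$K_-(\lambda)=\frac1{\sinh\varsigma_-}\begin{pmatrix}\sinh(\lambda-\frac\eta2+\varsigma_-)&\kappa_-e^{\tau_-}\sinh(2\lambda-\eta)\\ \kappa_-e^{-\tau_-}\sinh(2\lambda-\eta)&\sinh(\varsigma_--\lambda+\frac\eta2)\end{pmatrix},$$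 $$S(\lambda|b)=\begin{pmatrix}e^{\lambda-\eta(b+\alpha)}&e^{\lambda+\eta(b-\alpha)}\\1&1\end{pmatrix},$$ $$M(\lambda)=R_{0N}(\lambda-\xi_N-\tfrac\eta2)\cdots R_{01}(\lambda-\xi_1-\tfrac\eta2),\qquad \hat M(\lambda)=(-1)^N\sigma_0^yM^{t_0}(-\lambda)\sigma_0^y,$$ $\mathcal U_-(\lambda)=M(\lambda)K_-(\lambda)\hat M(\lambda)$. Define $$S_{1\dots N}(b)=\prod_{n=N\to1}S_n\Big(-\xi_n\Big|b+\sum_{j>n}\sigma^z_j\Big),$$ $$\mathcal U^{\rm SOS}_-(\lambda|b)=S_{1\dots N}^{-1}(b+\sigma_0^z)\,S_0^{-1}(\tfrac\eta2-\lambda|b)\,\mathcal U_-(\lambda)\,S_0(\lambda-\tfrac\eta2|b)\,S_{1\dots N}(b+\sigma_0^z),$$ and denote by $\mathcal A^{\rm SOS}_-(\lambda|b)$, $\mathcal D^{\rm SOS}_-(\lambda|b)$ its diagonal entries with respect to $\mathcal H_0$. Put $\xi_n^{(h)}=\xi_n+\frac\eta2-h\eta$ for $h\in\{0,1\}$, and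 $$a(\lambda)=\prod_{n}\sinh(\lambda-\xi_n+\tfrac\eta2),\quad d(\lambda)=\prod_{n}\sinh(\lambda-\xi_n-\tfrac\eta2),\quad \widehat V(x_1,\dots,x_N)=\det_{1\le i,j\le N}\big[\sinh^{2(j-1)}x_i\big].$$ **Assumptions.** 1. *Gauge.* A sign $\epsilon_+\in\{1,-1\}$ is fixed, and $\eta(\beta-\alpha)=\tau_++\epsilon_+(\alpha_+-\beta_+)+\frac{1+\epsilon_+}2i\pi \bmod 2i\pi$. Moreover $\sinh\eta\neq0$, and $\sinh(\eta(\beta+m))\ne0$ for all integers $m$ with $|m|\le N$. 2. *Generic inhomogeneities.* $\xi_j^{(h)}\pm\xi_k^{(h')}\notin i\pi\mathbb Z$ for all $j\ne k$ and $h,h'\in\{0,1\}$. Moreover, for all $n$, none of $\sinh(2\xi_n)$, $\sinh(2\xi_n\pm\eta)$, $\sinh(\xi_n\pm\alpha_+)$, $\sinh(\xi_n\pm\alpha_-)$, $\cosh(\xi_n\pm\beta_+)$, $\cosh(\xi_n\pm\beta_-)$ vanishes. 3. *Boundary condition.* For all $j\in\{1,\dots,N\}$ and $\epsilon\in\{1,-1\}$,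 $$\tau_+-\tau_-+\eta(N-2j+1)\neq\epsilon(\alpha_-+\beta_-)-\epsilon_+(\alpha_+-\beta_+)-\tfrac{\epsilon_++\epsilon}2i\pi\mod 2i\pi .$$ **States.** For $\boldsymbol\varepsilon=(\epsilon_{\alpha_+},\epsilon_{\alpha_-},\epsilon_{\beta_+},\epsilon_{\beta_-})\in\{1,-1\}^4$ with $\epsilon_{\alpha_+}\epsilon_{\alpha_-}\epsilon_{\beta_+}\epsilon_{\beta_-}=1$, and also for $-\boldsymbol\varepsilon$, put $$\mathbf a_{\boldsymbol\varepsilon}(\lambda)=\frac{\sinh(\lambda-\frac\eta2+\epsilon_{\alpha_+}\alpha_+)\cosh(\lambda-\frac\eta2-\epsilon_{\beta_+}\beta_+)}{\sinh(\epsilon_{\alpha_+}\alpha_+)\cosh(\epsilon_{\beta_+}\beta_+)}\cdot\frac{\sinh(\lambda-\frac\eta2+\epsilon_{\alpha_-}\alpha_-)\cosh(\lambda-\frac\eta2+\epsilon_{\beta_-}\beta_-)}{\sinh(\epsilon_{\alpha_-}\alpha_-)\cosh(\epsilon_{\beta_-}\beta_-)},$$ $$\mathsf g_{\boldsymbol\varepsilon}(\lambda+\tfrac\eta2)=\epsilon_+\epsilon_{\alpha_+}(-1)^N\frac{\sinh(\lambda+\epsilon_{\alpha_-}\alpha_-)\cosh(\lambda+\epsilon_{\beta_-}\beta_-)}{\sinh(\epsilon_{\alpha_-}\alpha_-)\cosh(\epsilon_{\beta_-}\beta_-)}\cdot\frac{\sinh(\lambda+\epsilon_{\alpha_+}\alpha_+)\cosh(\lambda-\epsilon_{\beta_+}\beta_+)}{\sinh(\lambda+\epsilon_+\alpha_+)\cosh(\lambda-\epsilon_+\beta_+)},$$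 $$\mathsf A_{\boldsymbol\varepsilon}(\lambda)=\mathsf g_{\boldsymbol\varepsilon}(\lambda)\,a(\lambda)\,d(-\lambda),\qquad k_j=\frac{\sinh(2\xi_j+\eta)}{\sinh(2\xi_j-\eta)}.$$ Let $\langle0|$ be the dual state with all spins up and $|\underline0\rangle$ the state with all spins down. For $\mathbf h\in\{0,1\}^N$, with products ordered from left to right by increasing $j$, put $$|\mathbf h,\beta+1\rangle_{\boldsymbol\varepsilon}=\prod_{j=1}^N\left(\frac{\mathcal D^{\rm SOS}_-(\xi_j+\frac\eta2|\beta+1)}{k_j\mathsf A_{\boldsymbol\varepsilon}(\frac\eta2-\xi_j)}\right)^{h_j}|\underline0\rangle,\qquad {}_{\boldsymbol\varepsilon}\langle\beta-1,\mathbf h|=\langle0|\prod_{j=1}^N\left(\frac{\mathcal A^{\rm SOS}_-(\frac\eta2-\xi_j|\beta-1)}{\mathsf A_{\boldsymbol\varepsilon}(\frac\eta2-\xi_j)}\right)^{1-h_j},$$ $$N_{\boldsymbol\varepsilon}(\{\xi\},\beta)=\widehat V(\xi_1^{(0)},\dots,\xi_N^{(0)})\,\langle0|\prod_{j=1}^N\frac{\mathcal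 A^{\rm SOS}_-(\frac\eta2-\xi_j|\beta-1)}{\mathsf A_{\boldsymbol\varepsilon}(\frac\eta2-\xi_j)}|\underline0\rangle .$$ For $P(\lambda)=\prod_{j=1}^{n_p}\frac{\cosh2\lambda-\cosh2p_j}2$ and $Q(\lambda)=\prod_{j=1}^{n_q}\frac{\cosh2\lambda-\cosh2q_j}2$, with arbitrary complex $p_j,q_j$, the separate states are $$|P\rangle_{\boldsymbol\varepsilon}=\frac1{N_{\boldsymbol\varepsilon}(\{\xi\},\beta)}\sum_{\mathbf h}\prod_nP(\xi_n^{(h_n)})\,e^{-\sum_jh_j\xi_j}\,\widehat V(\xi_1^{(h_1)},\dots,\xi_N^{(h_N)})\,S_{1\dots N}(\beta)\,|\mathbf h,\beta+1\rangle_{\boldsymbol\varepsilon},$$ $${}_{\boldsymbol\varepsilon}\langle Q|=\frac1{N_{\boldsymbol\varepsilon}(\{\xi\},\beta)}\sum_{\mathbf h}\prod_n\Big[(\mathsf u_n\mathsf v_{n,\boldsymbol\varepsilon})^{h_n}Q(\xi_n^{(h_n)})\Big]e^{-\sum_jh_j\xi_j}\,\widehat V(\xi_1^{(h_1)},\dots,\xi_N^{(h_N)})\;{}_{\boldsymbol\varepsilon}\langle\beta-1,\mathbf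 h|\,S_{1\dots N}^{-1}(\beta),$$ where $$\mathsf u_n=\frac{\sinh(2\xi_n-\eta)}{\sinh(2\xi_n+\eta)}\,\frac{a(\xi_n+\frac\eta2)\,d(-\xi_n-\frac\eta2)}{a(-\xi_n+\frac\eta2)\,d(\xi_n-\frac\eta2)},\qquad \mathsf v_{n,\boldsymbol\varepsilon}=\frac{\mathbf a_{\boldsymbol\varepsilon}(\xi_n+\frac\eta2)}{\mathbf a_{\boldsymbol\varepsilon}(-\xi_n+\frac\eta2)}.$$ **Proposition 5.1.** Under these assumptions, let $\boldsymbol\varepsilon,\boldsymbol\varepsilon'\in\{1,-1\}^4$ each have product of entries $1$. Then $N_{\boldsymbol\varepsilon}(\{\xi\},\beta)$ and $N_{\boldsymbol\varepsilon'}(\{\xi\},\beta)$ are non-zero, the left state can also be written as $${}_{\boldsymbol\varepsilon}\langle Q|=\frac1{N_{\boldsymbol\varepsilon}(\{\xi\},\beta)}\frac{\widehat V(\xi_1^{(0)},\dots,\xi_N^{(0)})}{\widehat V(\xi_1^{(1)},\dots,\xi_N^{(1)})}\sum_{\mathbf h}\prod_n\Big[(-\mathsf v_{n,\boldsymbol\varepsilon})^{h_n}Q(\xi_n^{(h_n)})\Big]e^{-\sum_jh_j\xi_j}\,\widehat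 V(\xi_1^{(1-h_1)},\dots,\xi_N^{(1-h_N)})\;{}_{\boldsymbol\varepsilon}\langle\beta-1,\mathbf h|\,S_{1\dots N}^{-1}(\beta),$$ and, for all $P$ and $Q$ as above, the scalar product is $${}_{\boldsymbol\varepsilon}\langle Q|P\rangle_{\boldsymbol\varepsilon'}=\frac1{N_{\boldsymbol\varepsilon'}(\{\xi\},\beta)}\,\frac{\widehat V(\xi_1^{(0)},\dots,\xi_N^{(0)})}{\widehat V(\xi_1^{(1)},\dots,\xi_N^{(1)})}\,\det_{1\le i,j\le N}\left[\sum_{h=0}^1\left(-\frac{\mathbf a_{\boldsymbol\varepsilon'}(\xi_i+\frac\eta2)}{\mathbf a_{-\boldsymbol\varepsilon}(\xi_i+\frac\eta2)}\right)^{h}P(\xi_i^{(h)})\,Q(\xi_i^{(h)})\left(\frac{\cosh(2\xi_i^{(1-h)})}2\right)^{j-1}\right].$$ -/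

import Mathlib

open scoped Matrix

noncomputable section

namespace OpenXXZ

/-- Parameters of the open inhomogeneous XXZ chain with `N` sites: the crossing parameter `η`, the
boundary parameters `ς±, κ±, τ±` with their alternative parametrization `α±, β±` (`αp` is `α₊`, `αm`
is `α₋`, and so on), the parameters `α, β` of the gauge (Vertex-IRF) transformation, and the
inhomogeneities `ξ`. -/
structure Params (N : ℕ) where
  η : ℂ
  ςp : ℂ
  κp : ℂ
  τp : ℂ
  αp : ℂ
  βp : ℂ
  ςm : ℂ
  κm : ℂ
  τm : ℂ
  αm : ℂ
  βm : ℂ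
  α : ℂ
  β : ℂ
  ξ : Fin N → ℂ

/-- A quadruple of signs `(ε_{α₊}, ε_{α₋}, ε_{β₊}, ε_{β₋})`. -/
structure Signs where
  αp : ℤˣ
  αm : ℤˣ
  βp : ℤˣ
  βm : ℤˣ

/-- The quadruple `-ε`. -/
instance : Neg Signs := ⟨fun e => ⟨-e.αp, -e.αm, -e.βp, -e.βm⟩⟩

/-- The product of the four signs is `1`. -/
def Signs.IsAdmissible (e : Signs) : Prop := e.αp * e.αm * e.βp * e.βm = 1

/-- A sign as a complex number. -/
def sgn (u : ℤˣ) : ℂ := ((u : ℤ) : ℂ)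

/-- Spin configurations; `0` is spin up and `1` is spin down. They index the canonical basis of
the space of states `(ℂ²)^{⊗ N}`. -/
abbrev Spins (N : ℕ) : Type := Fin N → Fin 2

/-- Operators on the space of states. -/
abbrev Op (N : ℕ) : Type := Matrix (Spins N) (Spins N) ℂ

/-- Operators on the tensor product of the auxiliary space `ℂ²` and the space of states, as `2 × 2`
matrices of operators. -/
abbrev AuxOp (N : ℕ) : Type := Matrix (Fin 2) (Fin 2) (Op N)

/-- The eigenvalue of `σᶻ`: `1` on spin up, `-1` on spin down. -/
def spinSign (s : Fin 2) : ℂ := if s = 0 then 1 else -1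

/-- The operator acting at site `n` by the `2 × 2` matrix `m s`, which may depend on the spins of
the configuration `s` at the sites other than `n` (a dynamical parameter). -/
def siteOp {N : ℕ} (n : Fin N) (m : Spins N → Matrix (Fin 2) (Fin 2) ℂ) : Op N :=
  Matrix.of fun s t => if ∀ j, j ≠ n → s j = t j then m s (s n) (t n) else 0

/-- A scalar `2 × 2` matrix acting on the auxiliary space only. -/
def auxScalar (N : ℕ) (m : Matrix (Fin 2) (Fin 2) ℂ) : AuxOp N := m.map (algebraMap ℂ (Op N))

/-- The ordered product `f 1 * f 2 * ⋯ * f N`. -/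
def prodUp {N : ℕ} {A : Type} [Monoid A] (f : Fin N → A) : A := (List.ofFn f).prod

/-- The ordered product `f N * ⋯ * f 2 * f 1`. -/
def prodDown {N : ℕ} {A : Type} [Monoid A] (f : Fin N → A) : A := (List.ofFn f).reverse.prod

/-- The quantity `V̂(x₁, …, x_N) = det [sinh^{2(j-1)} x_i]`. -/
def vdm {N : ℕ} (x : Fin N → ℂ) : ℂ :=
  (Matrix.of fun i j : Fin N => Complex.sinh (x i) ^ (2 * (j : ℕ))).det

/-- The function `λ ↦ ∏_j (cosh 2λ - cosh 2r_j) / 2`. -/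
def trigPoly {m : ℕ} (r : Fin m → ℂ) (l : ℂ) : ℂ :=
  ∏ j, (Complex.cosh (2 * l) - Complex.cosh (2 * r j)) / 2

/-- The six-vertex `R`-matrix on `ℂ² ⊗ ℂ²`, with entries `sinh (λ + η)` at `(00, 00)` and `(11, 11)`,
`sinh λ` at `(01, 01)` and `(10, 10)`, `sinh η` at `(01, 10)` and `(10, 01)`. -/
def rMatrix (η l : ℂ) : Matrix (Fin 2 × Fin 2) (Fin 2 × Fin 2) ℂ :=
  Matrix.of fun x y =>
    if x = y then (if x.1 = x.2 then Complex.sinh (l + η) else Complex.sinh l)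
    else if x = y.swap then Complex.sinh η else 0

/-- The boundary matrix `K(λ; ς, κ, τ)`. -/
def kMatrix (η l ς κ τ : ℂ) : Matrix (Fin 2) (Fin 2) ℂ :=
  (Complex.sinh ς)⁻¹ •
    !![Complex.sinh (l - η / 2 + ς), κ * Complex.exp τ * Complex.sinh (2 * l - η);
       κ * Complex.exp (-τ) * Complex.sinh (2 * l - η), Complex.sinh (ς - l + η / 2)]

/-- The Pauli matrix `σʸ`. -/
def sigmaY : Matrix (Fin 2) (Fin 2) ℂ := !![0, -Complex.I; Complex.I, 0]

namespace Params

variable {N : ℕ} (p : Params N)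

/-- The shifted inhomogeneity `ξ_n^{(h)} = ξ_n + η/2 - hη`. -/
def xiS (n : Fin N) (h : Fin 2) : ℂ := p.ξ n + p.η / 2 - ((h : ℕ) : ℂ) * p.η

/-- `a(λ) = ∏_n sinh (λ - ξ_n + η/2)`. -/
def a (l : ℂ) : ℂ := ∏ n, Complex.sinh (l - p.ξ n + p.η / 2)

/-- `d(λ) = ∏_n sinh (λ - ξ_n - η/2)`. -/
def d (l : ℂ) : ℂ := ∏ n, Complex.sinh (l - p.ξ n - p.η / 2)

/-- The operator `R_{0n}(λ)`. -/
def rSite (n : Fin N) (l : ℂ) : AuxOp N :=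
  Matrix.of fun x y => siteOp n fun _ => Matrix.of fun s t => rMatrix p.η l (x, s) (y, t)

/-- The bulk monodromy matrix `M(λ) = R_{0N}(λ - ξ_N - η/2) ⋯ R_{01}(λ - ξ_1 - η/2)`. -/
def bulkM (l : ℂ) : AuxOp N := prodDown fun n => p.rSite n (l - p.ξ n - p.η / 2)

/-- `M̂(λ) = (-1)^N σ₀ʸ M^{t₀}(-λ) σ₀ʸ`; the transposition exchanges the entries of the `2 × 2` matrix
without transposing the operators. -/
def bulkMHat (l : ℂ) : AuxOp N :=
  ((-1 : ℂ) ^ N) • (auxScalar N sigmaY * (p.bulkM (-l))ᵀ * auxScalar N sigmaY)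

/-- The boundary monodromy matrix `𝒰₋(λ) = M(λ) K₋(λ) M̂(λ)`. -/
def boundaryU (l : ℂ) : AuxOp N :=
  p.bulkM l * auxScalar N (kMatrix p.η l p.ςm p.κm p.τm) * p.bulkMHat l

/-- The Vertex-IRF matrix `S(λ|b)`, where `b` is the dynamical parameter. -/
def gaugeS (l b : ℂ) : Matrix (Fin 2) (Fin 2) ℂ :=
  !![Complex.exp (l - p.η * (b + p.α)), Complex.exp (l + p.η * (b - p.α)); 1, 1]

/-- The operator `S_{1…N}({ξ}|b) = ∏_{n=N→1} S_n(-ξ_n | b + ∑_{j>n} σ_jᶻ)`. -/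
def gaugeSq (b : ℂ) : Op N :=
  prodDown fun n => siteOp n fun s => p.gaugeS (-p.ξ n) (b + ∑ j ∈ Finset.Ioi n, spinSign (s j))

/-- The gauged boundary monodromy matrix `S₀⁻¹(η/2 - λ|b) 𝒰₋(λ) S₀(λ - η/2|b)`. -/
def gaugedU (l b : ℂ) : AuxOp N :=
  auxScalar N (p.gaugeS (-l + p.η / 2) b)⁻¹ * p.boundaryU l * auxScalar N (p.gaugeS (l - p.η / 2) b)

/-- The SOS boundary monodromy matrix: the matrix `gaugedU` conjugated by `S_{1…N}({ξ}|b + σ₀ᶻ)`. -/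
def sosU (l b : ℂ) : AuxOp N :=
  Matrix.of fun x y =>
    (p.gaugeSq (b + spinSign x))⁻¹ * p.gaugedU l b x y * p.gaugeSq (b + spinSign y)

/-- The diagonal entry `𝒜₋^{SOS}(λ|b)`. -/
def sosA (l b : ℂ) : Op N := p.sosU l b 0 0

/-- The diagonal entry `𝒟₋^{SOS}(λ|b)`. -/
def sosD (l b : ℂ) : Op N := p.sosU l b 1 1

/-- The function `𝐚_ε(λ)`. -/
def aEps (e : Signs) (l : ℂ) : ℂ :=
  (Complex.sinh (l - p.η / 2 + sgn e.αp * p.αp) * Complex.cosh (l - p.η / 2 - sgn e.βp * p.βp)) /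
      (Complex.sinh (sgn e.αp * p.αp) * Complex.cosh (sgn e.βp * p.βp)) *
    ((Complex.sinh (l - p.η / 2 + sgn e.αm * p.αm) * Complex.cosh (l - p.η / 2 + sgn e.βm * p.βm)) /
      (Complex.sinh (sgn e.αm * p.αm) * Complex.cosh (sgn e.βm * p.βm)))

/-- The normalization function `g₋` attached to the sign `ε₊` and to the quadruple `e`, as a function
of `x` where the argument of `g₋` is `x + η/2`. -/
def gEpsShifted (ep : ℤˣ) (e : Signs) (x : ℂ) : ℂ :=
  sgn ep * sgn e.αp * (-1) ^ N *
    ((Complex.sinh (x + sgn e.αm * p.αm) * Complex.cosh (x + sgn e.βm * p.βm)) /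
      (Complex.sinh (sgn e.αm * p.αm) * Complex.cosh (sgn e.βm * p.βm))) *
    ((Complex.sinh (x + sgn e.αp * p.αp) * Complex.cosh (x - sgn e.βp * p.βp)) /
      (Complex.sinh (x + sgn ep * p.αp) * Complex.cosh (x - sgn ep * p.βp)))

/-- The function `g₋(λ)`. -/
def gEps (ep : ℤˣ) (e : Signs) (l : ℂ) : ℂ := p.gEpsShifted ep e (l - p.η / 2)

/-- `A₋(λ) = g₋(λ) a(λ) d(-λ)`. -/
def aMinus (ep : ℤˣ) (e : Signs) (l : ℂ) : ℂ := p.gEps ep e l * p.a l * p.d (-l)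

/-- `k_j = sinh (2ξ_j + η) / sinh (2ξ_j - η)`. -/
def kCoef (j : Fin N) : ℂ :=
  Complex.sinh (2 * p.ξ j + p.η) / Complex.sinh (2 * p.ξ j - p.η)

/-- The dual reference state with all spins up. -/
def refBra (N : ℕ) : Spins N → ℂ := Pi.single (fun _ => 0) 1

/-- The reference state with all spins down. -/
def refKet (N : ℕ) : Spins N → ℂ := Pi.single (fun _ => 1) 1

/-- The right SoV state `|h, β+1⟩_ε`. -/
def sovKet (ep : ℤˣ) (e : Signs) (h : Fin N → Fin 2) : Spins N → ℂ :=
  (prodUp fun j =>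
    ((p.kCoef j * p.aMinus ep e (p.η / 2 - p.ξ j))⁻¹ •
      p.sosD (p.ξ j + p.η / 2) (p.β + 1)) ^ (h j : ℕ)) *ᵥ refKet N

/-- The left SoV state `_ε⟨β-1, h|`. -/
def sovBra (ep : ℤˣ) (e : Signs) (h : Fin N → Fin 2) : Spins N → ℂ :=
  refBra N ᵥ* (prodUp fun j =>
    ((p.aMinus ep e (p.η / 2 - p.ξ j))⁻¹ •
      p.sosA (p.η / 2 - p.ξ j) (p.β - 1)) ^ (1 - (h j : ℕ)))

/-- The normalization constant `N({ξ}, β)`; it depends on `ε` through `g₋`. -/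
def normConst (ep : ℤˣ) (e : Signs) : ℂ :=
  vdm (fun n => p.xiS n 0) *
    (refBra N ⬝ᵥ ((prodUp fun j =>
      (p.aMinus ep e (p.η / 2 - p.ξ j))⁻¹ • p.sosA (p.η / 2 - p.ξ j) (p.β - 1)) *ᵥ refKet N))

/-- The coefficient `u_n`. -/
def uCoef (n : Fin N) : ℂ :=
  Complex.sinh (2 * p.ξ n - p.η) / Complex.sinh (2 * p.ξ n + p.η) *
    ((p.a (p.ξ n + p.η / 2) * p.d (-p.ξ n - p.η / 2)) /
      (p.a (-p.ξ n + p.η / 2) * p.d (p.ξ n - p.η / 2)))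

/-- The coefficient `v_{n,ε} = 𝐚_ε(ξ_n + η/2) / 𝐚_ε(-ξ_n + η/2)`. -/
def vCoef (e : Signs) (n : Fin N) : ℂ :=
  p.aEps e (p.ξ n + p.η / 2) / p.aEps e (-p.ξ n + p.η / 2)

/-- The right separate state `|P⟩_ε`. -/
def separateKet (ep : ℤˣ) (e : Signs) (P : ℂ → ℂ) : Spins N → ℂ :=
  (1 / p.normConst ep e) • ∑ h : Fin N → Fin 2,
    ((∏ n, P (p.xiS n (h n))) * Complex.exp (-∑ j, ((h j : ℕ) : ℂ) * p.ξ j) *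
      vdm (fun n => p.xiS n (h n))) • (p.gaugeSq p.β *ᵥ p.sovKet ep e h)

/-- The left separate state `_ε⟨Q|`. -/
def separateBra (ep : ℤˣ) (e : Signs) (Q : ℂ → ℂ) : Spins N → ℂ :=
  (1 / p.normConst ep e) • ∑ h : Fin N → Fin 2,
    ((∏ n, (p.uCoef n * p.vCoef e n) ^ (h n : ℕ) * Q (p.xiS n (h n))) *
      Complex.exp (-∑ j, ((h j : ℕ) : ℂ) * p.ξ j) *
      vdm (fun n => p.xiS n (h n))) • (p.sovBra ep e h ᵥ* (p.gaugeSq p.β)⁻¹)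

/-- The second form of the left separate state `_ε⟨Q|`. -/
def separateBraBis (ep : ℤˣ) (e : Signs) (Q : ℂ → ℂ) : Spins N → ℂ :=
  (1 / p.normConst ep e * (vdm (fun n => p.xiS n 0) / vdm (fun n => p.xiS n 1))) •
    ∑ h : Fin N → Fin 2,
      ((∏ n, (-p.vCoef e n) ^ (h n : ℕ) * Q (p.xiS n (h n))) *
        Complex.exp (-∑ j, ((h j : ℕ) : ℂ) * p.ξ j) *
        vdm (fun n => p.xiS n (1 - h n))) • (p.sovBra ep e h ᵥ* (p.gaugeSq p.β)⁻¹)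

/-- The boundary parameters are non-degenerate and `α±, β±` reparametrize `ς±, κ±`. -/
structure BoundaryReparam : Prop where
  κp_ne : p.κp ≠ 0
  κm_ne : p.κm ≠ 0
  ςp_ne : Complex.sinh p.ςp ≠ 0
  ςm_ne : Complex.sinh p.ςm ≠ 0
  sinh_cosh_p : Complex.sinh p.αp * Complex.cosh p.βp = Complex.sinh p.ςp / (2 * p.κp)
  cosh_sinh_p : Complex.cosh p.αp * Complex.sinh p.βp = Complex.cosh p.ςp / (2 * p.κp)
  sinh_cosh_m : Complex.sinh p.αm * Complex.cosh p.βm = Complex.sinh p.ςm / (2 * p.κm)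
  cosh_sinh_m : Complex.cosh p.αm * Complex.sinh p.βm = Complex.cosh p.ςm / (2 * p.κm)

/-- The gauge condition `η(β - α) = τ₊ + ε₊(α₊ - β₊) + (1 + ε₊)/2 iπ mod 2iπ` for the sign `ε₊`. -/
def GaugeCondition (ep : ℤˣ) : Prop :=
  ∃ m : ℤ, p.η * (p.β - p.α) = p.τp + sgn ep * (p.αp - p.βp) +
    (1 + sgn ep) / 2 * (Complex.I * Real.pi) + 2 * Complex.I * Real.pi * m

/-- The anisotropy is non-degenerate, and the gauge matrices that occur are invertible
(`β` avoids the integers between `-N` and `N`, up to multiples of `iπ/η`). -/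
structure GaugeNondegenerate : Prop where
  sinh_eta_ne : Complex.sinh p.η ≠ 0
  sinh_beta_ne : ∀ m : ℤ, |m| ≤ (N : ℤ) → Complex.sinh (p.η * (p.β + m)) ≠ 0

/-- Generic inhomogeneities: the non-intersecting conditions, and the non-vanishing of the
quantities `sinh (2ξ_n)`, `sinh (2ξ_n ± η)`, `sinh (ξ_n ± α±)`, `cosh (ξ_n ± β±)`. -/
structure GenericInhom : Prop where
  add_ne : ∀ j k, j ≠ k → ∀ h h' : Fin 2, ∀ m : ℤ,
    p.xiS j h + p.xiS k h' ≠ Complex.I * Real.pi * m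
  sub_ne : ∀ j k, j ≠ k → ∀ h h' : Fin 2, ∀ m : ℤ,
    p.xiS j h - p.xiS k h' ≠ Complex.I * Real.pi * m
  sinh_ne : ∀ n, Complex.sinh (2 * p.ξ n) ≠ 0
  sinh_add_eta_ne : ∀ n, Complex.sinh (2 * p.ξ n + p.η) ≠ 0
  sinh_sub_eta_ne : ∀ n, Complex.sinh (2 * p.ξ n - p.η) ≠ 0
  alpha_p_ne : ∀ n, Complex.sinh (p.ξ n + p.αp) ≠ 0 ∧ Complex.sinh (p.ξ n - p.αp) ≠ 0
  alpha_m_ne : ∀ n, Complex.sinh (p.ξ n + p.αm) ≠ 0 ∧ Complex.sinh (p.ξ n - p.αm) ≠ 0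
  beta_p_ne : ∀ n, Complex.cosh (p.ξ n + p.βp) ≠ 0 ∧ Complex.cosh (p.ξ n - p.βp) ≠ 0
  beta_m_ne : ∀ n, Complex.cosh (p.ξ n + p.βm) ≠ 0 ∧ Complex.cosh (p.ξ n - p.βm) ≠ 0

/-- The condition on the boundary parameters: for `1 ≤ j ≤ N` and both signs `ε`,
`τ₊ - τ₋ + η(N - 2j + 1) ≠ ε(α₋ + β₋) - ε₊(α₊ - β₊) - (ε₊ + ε)/2 iπ mod 2iπ`.
The index `j` runs over `Fin N`, so the usual index is `j + 1`. -/
def BoundaryCondition (ep : ℤˣ) : Prop :=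
  ∀ (j : Fin N) (e : ℤˣ) (m : ℤ),
    p.τp - p.τm + p.η * ((N : ℂ) - 2 * ((j : ℕ) + 1 : ℂ) + 1) ≠
      sgn e * (p.αm + p.βm) - sgn ep * (p.αp - p.βp) -
        (sgn ep + sgn e) / 2 * (Complex.I * Real.pi) + 2 * Complex.I * Real.pi * m

end Params

end OpenXXZ

end

/-! The separate states are expanded on two families of vectors indexed by `h ∈ {0,1}^N`. Three
facts suffice: the families are biorthogonal, the norm of index `h` is `normConst / V̂(ξ^(h))` up to
explicit factors, and `normConst` is non-zero (`sovStates_orthogonality`). The double sum then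
collapses to a single sum over `h`. The factor `V̂(ξ^(h))` of the right state cancels against the
norm, while the factor `V̂(ξ^(1-h))` from the second form of the left state is a Vandermonde
determinant in `cosh(2ξ)/2`. Multilinearity of the determinant then resums everything row by row
(`det_sum_rows`).

The SOS operators that occur are all conjugated by the same matrix `gaugeSq β`. Undoing the
conjugation turns the left states into the rows `braList`, obtained from a product row by gauged
diagonal operators at the points `-ξ_n`. The right states become the same rows for the transposed
chain (`exists_sovStates`). The main tool is the gauged off-diagonal operator `offDiag`: it maps
`braList T L` to a multiple of `braList (T - 2η) L` (`offDiag_braList`), and the multiplier has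
zeros at `±ξ_n` that detect whether `n ∈ L`. Moving this operator from the row to the column gives
orthogonality (`pairing_eq_zero`). Applying it `N` times at chosen points isolates one row of the
family, which gives linear independence (`linearIndependent_braList`); the boundary condition says
exactly that the boundary factors met along the way do not vanish. The `2^N` rows therefore span, so
the reference column, orthogonal to all of them but one, pairs non-trivially with that one. This is
the non-vanishing of `normConst` (`pairing_univ_ne_zero`).

For the norms, the operator `mixed` adds the site `n` to the row when evaluated at `-ξ_n` and to the
column when evaluated at `ξ_n`. The reflection equation determines its matrix element up to a
constant as a function of the spectral parameter, so the two values give the ratio of neighbouring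
norms (`normRatio`). This ratio is the inverse of a ratio of Vandermonde determinants up to explicit
factors, and induction on the set of flipped sites concludes (`pairing_onSet`). Accidental zeros of
auxiliary factors are avoided by continuity, since they occupy countable sets only. -/

open scoped Matrix
noncomputable section
namespace OpenXXZ

/-! ### The reflection equation as an identity of right actions on row tensors. -/

section RowActions

variable {ι : Type} [Fintype ι]

/-- Row tensors with two auxiliary indices. -/
abbrev Row2 (ι : Type) : Type := Fin 2 → Fin 2 → ι → ℂ

/-- Right action of a matrix of operators on the first auxiliary index of a row tensor. -/
def act1 (X : Matrix (Fin 2) (Fin 2) (Matrix ι ι ℂ)) (v : Row2 ι) : Row2 ι :=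
  fun c b => ∑ a, v a b ᵥ* X a c

/-- Right action of a matrix of operators on the second auxiliary index of a row tensor. -/
def act2 (X : Matrix (Fin 2) (Fin 2) (Matrix ι ι ℂ)) (v : Row2 ι) : Row2 ι :=
  fun a d => ∑ b, v a b ᵥ* X b d

/-- Right action of a scalar matrix on both auxiliary indices of a row tensor. -/
def actR (R : Matrix (Fin 2 × Fin 2) (Fin 2 × Fin 2) ℂ) (v : Row2 ι) : Row2 ι :=
  fun c d => ∑ a, ∑ b, R (a, b) (c, d) • v a b

theorem act1_mul (X Y : Matrix (Fin 2) (Fin 2) (Matrix ι ι ℂ)) (v : Row2 ι) :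
    act1 (X * Y) v = act1 Y (act1 X v) := by
  funext c b
  simp only [act1, Matrix.mul_apply, Matrix.vecMul_sum, Matrix.sum_vecMul, Matrix.vecMul_vecMul]
  exact Finset.sum_comm

theorem act2_mul (X Y : Matrix (Fin 2) (Fin 2) (Matrix ι ι ℂ)) (v : Row2 ι) :
    act2 (X * Y) v = act2 Y (act2 X v) := by
  funext c b
  simp only [act2, Matrix.mul_apply, Matrix.vecMul_sum, Matrix.sum_vecMul, Matrix.vecMul_vecMul]
  exact Finset.sum_comm

theorem act_comm {X Y : Matrix (Fin 2) (Fin 2) (Matrix ι ι ℂ)}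
    (h : ∀ i j k l, Commute (X i j) (Y k l)) (v : Row2 ι) :
    act2 Y (act1 X v) = act1 X (act2 Y v) := by
  funext c b
  simp only [act1, act2, Matrix.sum_vecMul, Matrix.vecMul_vecMul]
  rw [Finset.sum_comm]
  simp only [(h _ _ _ _).eq]

/-- The reflection equation in the symmetrized spectral parameter, as an identity of right actions
on row tensors. -/
def ReflectionEq (η : ℂ) (X : ℂ → Matrix (Fin 2) (Fin 2) (Matrix ι ι ℂ)) : Prop :=
  ∀ (l m : ℂ) (v : Row2 ι),
    act2 (X m) (actR (rMatrix η (l + m)) (act1 (X l) (actR (rMatrix η (l - m)) v))) =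
      actR (rMatrix η (l - m)) (act1 (X l) (actR (rMatrix η (l + m)) (act2 (X m) v)))

/-- Dressing a solution of the reflection equation gives a solution. -/
theorem ReflectionEq.dress {η : ℂ} {X L L' : ℂ → Matrix (Fin 2) (Fin 2) (Matrix ι ι ℂ)}
    (hX : ReflectionEq η X)
    (hL : ∀ l m v, act2 (L m) (act1 (L l) (actR (rMatrix η (l - m)) v)) =
      actR (rMatrix η (l - m)) (act1 (L l) (act2 (L m) v)))
    (hL' : ∀ l m v, act2 (L' m) (act1 (L' l) (actR (rMatrix η (l - m)) v)) =
      actR (rMatrix η (l - m)) (act1 (L' l) (act2 (L' m) v)))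
    (hc : ∀ l m v, act2 (L m) (actR (rMatrix η (l + m)) (act1 (L' l) v)) =
      act1 (L' l) (actR (rMatrix η (l + m)) (act2 (L m) v)))
    (hc' : ∀ l m v, act2 (L' m) (actR (rMatrix η (l + m)) (act1 (L l) v)) =
      act1 (L l) (actR (rMatrix η (l + m)) (act2 (L' m) v)))
    (h : ∀ l m i j k k', Commute (X l i j) (L m k k'))
    (h' : ∀ l m i j k k', Commute (X l i j) (L' m k k')) :
    ReflectionEq η fun l => L l * X l * L' l := by
  intro l m v
  have e1 : ∀ l m v, act2 (X m) (act1 (L l) v) = act1 (L l) (act2 (X m) v) := fun l m v =>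
    act_comm (fun i j k k' => (h m l k k' i j).symm) v
  have e2 : ∀ l m v, act2 (X m) (act1 (L' l) v) = act1 (L' l) (act2 (X m) v) := fun l m v =>
    act_comm (fun i j k k' => (h' m l k k' i j).symm) v
  have e3 : ∀ l m v, act2 (L m) (act1 (X l) v) = act1 (X l) (act2 (L m) v) := fun l m v =>
    act_comm (fun i j k k' => (h l m i j k k')) v
  have e4 : ∀ l m v, act2 (L' m) (act1 (X l) v) = act1 (X l) (act2 (L' m) v) := fun l m v =>
    act_comm (fun i j k k' => (h' l m i j k k')) v
  -- Sklyanin's argument: the outer factors `L` and `L'` are moved through by the exchange relations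
  -- until the equation for `X` can be applied in the middle.
  simp only [act1_mul, act2_mul]
  rw [hc, e3, hL, e2, hX l m, hL', e4, e1, hc']

end RowActions

theorem sinh_exp_form (z : ℂ) : Complex.sinh z = (Complex.exp z - (Complex.exp z)⁻¹) / 2 := by
  rw [Complex.sinh, Complex.exp_neg]

/-! ### Operators at one site and the Yang-Baxter equation. -/

section Site

variable {N : ℕ}

theorem vecMul_siteOp (n : Fin N) (m : Spins N → Matrix (Fin 2) (Fin 2) ℂ) (v : Spins N → ℂ)
    (t : Spins N) :
    (v ᵥ* siteOp n m) t =
      ∑ k, v (Function.update t n k) * m (Function.update t n k) k (t n) := by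
  simp only [Matrix.vecMul, dotProduct, siteOp, Matrix.of_apply, mul_ite, mul_zero]
  rw [← Finset.sum_filter]
  symm
  refine Finset.sum_bij (fun k _ => Function.update t n k) ?_ ?_ ?_ ?_
  · intro k _
    simp only [Finset.mem_filter, Finset.mem_univ, true_and]
    intro j hj
    simp [hj]
  · intro a _ b _ hab
    simpa using congrFun hab n
  · intro s hs
    simp only [Finset.mem_filter, Finset.mem_univ, true_and] at hs
    refine ⟨s n, Finset.mem_univ _, ?_⟩
    funext j
    by_cases hj : j = n
    · subst hj; simp
    · simp [hj, hs j hj]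
  · intro k _
    simp

theorem siteOp_mulVec (n : Fin N) (m : Spins N → Matrix (Fin 2) (Fin 2) ℂ) (v : Spins N → ℂ)
    (s : Spins N) :
    (siteOp n m *ᵥ v) s = ∑ k, m s (s n) k * v (Function.update s n k) := by
  simp only [Matrix.mulVec, dotProduct, siteOp, Matrix.of_apply, ite_mul, zero_mul]
  rw [← Finset.sum_filter]
  symm
  refine Finset.sum_bij (fun k _ => Function.update s n k) ?_ ?_ ?_ ?_
  · intro k _
    simp only [Finset.mem_filter, Finset.mem_univ, true_and]
    intro j hj
    simp [hj]
  · intro a _ b _ hab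
    simpa using congrFun hab n
  · intro t hs
    simp only [Finset.mem_filter, Finset.mem_univ, true_and] at hs
    refine ⟨t n, Finset.mem_univ _, ?_⟩
    funext j
    by_cases hj : j = n
    · subst hj; simp
    · simp [hj, hs j hj]
  · intro k _
    simp

/-- Operator identities are tested on arbitrary rows, where a product of site operators becomes an
explicit sum over a few spins. -/
theorem ext_vecMul {ι : Type} [Fintype ι] {A B : Matrix ι ι ℂ}
    (h : ∀ v : ι → ℂ, v ᵥ* A = v ᵥ* B) : A = B := by
  classical
  ext i j
  simpa using congrFun (h (Pi.single i 1)) j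

theorem siteOp_commute {n k : Fin N} (h : n ≠ k) (m m' : Matrix (Fin 2) (Fin 2) ℂ) :
    Commute (siteOp n fun _ => m) (siteOp k fun _ => m') := by
  refine ext_vecMul fun v => ?_
  funext t
  simp only [← Matrix.vecMul_vecMul, vecMul_siteOp, Fin.sum_univ_two, Function.update_of_ne h,
    Function.update_of_ne h.symm, Function.update_comm h]
  ring

end Site

/-- The Yang-Baxter equation on scalar tensors, with the pairs of spaces `(a, b)`, `(a, n)`, `(b, n)`. -/
theorem yang_baxter (η u v : ℂ) (f : Fin 2 → Fin 2 → Fin 2 → ℂ) (c d k : Fin 2) :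
    (∑ b, ∑ n, (∑ a, ∑ n', (∑ a', ∑ b', rMatrix η (u - v) (a', b') (a, b) * f a' b' n') *
        rMatrix η u (a, n') (c, n)) * rMatrix η v (b, n) (d, k)) =
      ∑ a, ∑ b, rMatrix η (u - v) (a, b) (c, d) * ∑ a', ∑ n,
        (∑ b', ∑ n', f a' b' n' * rMatrix η v (b', n') (b, n)) * rMatrix η u (a', n) (a, k) := by
  have hx : Complex.exp u ≠ 0 := Complex.exp_ne_zero _
  have hy : Complex.exp v ≠ 0 := Complex.exp_ne_zero _
  have hz : Complex.exp η ≠ 0 := Complex.exp_ne_zero _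
  fin_cases c <;> fin_cases d <;> fin_cases k <;>
  · simp [rMatrix, Fin.sum_univ_two, Prod.swap]
    simp only [sinh_exp_form, Complex.exp_add, Complex.exp_sub]
    field_simp <;> ring

/-- The Yang-Baxter equation on scalar tensors, with the middle factor acting on the pair `(a, b)`. -/
theorem yang_baxter_middle (η u v : ℂ) (f : Fin 2 → Fin 2 → Fin 2 → ℂ) (c d k : Fin 2) :
    (∑ b, ∑ n, (∑ a, ∑ b', rMatrix η (u + v) (a, b') (c, b) *
        ∑ a', ∑ n', f a' b' n' * rMatrix η u (a', n') (a, n)) * rMatrix η v (b, n) (d, k)) =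
      ∑ a, ∑ n, (∑ a', ∑ b, rMatrix η (u + v) (a', b) (a, d) *
        ∑ b', ∑ n', f a' b' n' * rMatrix η v (b', n') (b, n)) * rMatrix η u (a, n) (c, k) := by
  have hx : Complex.exp u ≠ 0 := Complex.exp_ne_zero _
  have hy : Complex.exp v ≠ 0 := Complex.exp_ne_zero _
  have hz : Complex.exp η ≠ 0 := Complex.exp_ne_zero _
  fin_cases c <;> fin_cases d <;> fin_cases k <;>
  · simp [rMatrix, Fin.sum_univ_two, Prod.swap]
    simp only [sinh_exp_form, Complex.exp_add]
    field_simp <;> ring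

/-! ### The boundary monodromy matrix, built site by site, solves the reflection equation. -/

namespace Params

variable {N : ℕ} (p : Params N)

theorem act1_rSite (n : Fin N) (l : ℂ) (v : Row2 (Spins N)) (c b : Fin 2) (t : Spins N) :
    act1 (p.rSite n l) v c b t =
      ∑ a, ∑ k, v a b (Function.update t n k) * rMatrix p.η l (a, k) (c, t n) := by
  simp [act1, rSite, vecMul_siteOp, -Fin.sum_univ_two]

theorem act2_rSite (n : Fin N) (l : ℂ) (v : Row2 (Spins N)) (c b : Fin 2) (t : Spins N) :
    act2 (p.rSite n l) v c b t =
      ∑ a, ∑ k, v c a (Function.update t n k) * rMatrix p.η l (a, k) (b, t n) := by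
  simp [act2, rSite, vecMul_siteOp, -Fin.sum_univ_two]

theorem rSite_yang_baxter (n : Fin N) (u w : ℂ) (v : Row2 (Spins N)) :
    act2 (p.rSite n w) (act1 (p.rSite n u) (actR (rMatrix p.η (u - w)) v)) =
      actR (rMatrix p.η (u - w)) (act1 (p.rSite n u) (act2 (p.rSite n w) v)) := by
  funext c d t
  have := yang_baxter p.η u w (fun a b k => v a b (Function.update t n k)) c d (t n)
  simpa [act1_rSite, act2_rSite, actR, -Fin.sum_univ_two] using this

theorem rSite_yang_baxter_middle (n : Fin N) (u w : ℂ) (v : Row2 (Spins N)) :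
    act2 (p.rSite n w) (actR (rMatrix p.η (u + w)) (act1 (p.rSite n u) v)) =
      act1 (p.rSite n u) (actR (rMatrix p.η (u + w)) (act2 (p.rSite n w) v)) := by
  funext c d t
  have := yang_baxter_middle p.η u w (fun a b k => v a b (Function.update t n k)) c d (t n)
  simpa [act1_rSite, act2_rSite, actR, -Fin.sum_univ_two] using this

/-- The boundary monodromy matrix of the chain restricted to the sites of a list, the head of the
list being the outermost site; the spectral parameter is shifted by `η / 2`. -/
def dress (L : List (Fin N)) (l : ℂ) : AuxOp N :=
  L.foldr (fun n X => p.rSite n (l - p.ξ n) * X * p.rSite n (l + p.ξ n))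
    (auxScalar N (kMatrix p.η (l + p.η / 2) p.ςm p.κm p.τm))

theorem dress_nil (l : ℂ) :
    p.dress [] l = auxScalar N (kMatrix p.η (l + p.η / 2) p.ςm p.κm p.τm) := rfl

theorem dress_cons (n : Fin N) (L : List (Fin N)) (l : ℂ) :
    p.dress (n :: L) l = p.rSite n (l - p.ξ n) * p.dress L l * p.rSite n (l + p.ξ n) := rfl

theorem rSite_commute_siteOp {n k : Fin N} (h : n ≠ k) (l : ℂ) (m : Matrix (Fin 2) (Fin 2) ℂ)
    (i j : Fin 2) : Commute (p.rSite k l i j) (siteOp n fun _ => m) := by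
  simp only [rSite, Matrix.of_apply]
  exact siteOp_commute h.symm _ _

/-- Distinct sites act on distinct tensor factors; this locality supplies the commutation hypotheses
of `ReflectionEq.dress`. -/
theorem dress_commute_siteOp {n : Fin N} {L : List (Fin N)} (h : n ∉ L) (l : ℂ)
    (m : Matrix (Fin 2) (Fin 2) ℂ) (i j : Fin 2) :
    Commute (p.dress L l i j) (siteOp n fun _ => m) := by
  induction L generalizing i j with
  | nil =>
    simp only [dress_nil, auxScalar, Matrix.map_apply]
    exact Algebra.commute_algebraMap_left _ _
  | cons k L ih =>
    simp only [List.mem_cons, not_or] at h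
    simp only [dress_cons, Matrix.mul_apply]
    refine Commute.sum_left _ _ _ fun a _ => Commute.mul_left ?_ (p.rSite_commute_siteOp h.1 _ _ _ _)
    exact Commute.sum_left _ _ _ fun b _ =>
      Commute.mul_left (p.rSite_commute_siteOp h.1 _ _ _ _) (ih h.2 _ _)

theorem kMatrix_shift (η l ς κ τ : ℂ) : kMatrix η (l + η / 2) ς κ τ = (Complex.sinh ς)⁻¹ •
    !![Complex.sinh (l + ς), κ * Complex.exp τ * Complex.sinh (2 * l);
       κ * Complex.exp (-τ) * Complex.sinh (2 * l), Complex.sinh (ς - l)] := by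
  rw [kMatrix]
  have h1 : l + η / 2 - η / 2 + ς = l + ς := by ring
  have h2 : 2 * (l + η / 2) - η = 2 * l := by ring
  have h3 : ς - (l + η / 2) + η / 2 = ς - l := by ring
  rw [h1, h2, h3]

theorem vecMul_algebraMap {ι : Type} [Fintype ι] [DecidableEq ι] (v : ι → ℂ) (c : ℂ) :
    v ᵥ* (algebraMap ℂ (Matrix ι ι ℂ) c) = c • v := by
  rw [Algebra.algebraMap_eq_smul_one, Matrix.vecMul_smul, Matrix.vecMul_one]

/-- Without sites only the scalar matrix `K₋` remains, and its reflection equation is a rational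
identity in exponentials, checked component by component. -/
theorem reflectionEq_dress_nil : ReflectionEq p.η (p.dress []) := by
  intro l m v
  have hx : Complex.exp l ≠ 0 := Complex.exp_ne_zero _
  have hy : Complex.exp m ≠ 0 := Complex.exp_ne_zero _
  have hz : Complex.exp p.η ≠ 0 := Complex.exp_ne_zero _
  have ht : Complex.exp p.τm ≠ 0 := Complex.exp_ne_zero _
  have hs : Complex.exp p.ςm ≠ 0 := Complex.exp_ne_zero _
  funext c d t
  generalize hk : (Complex.sinh p.ςm)⁻¹ = k
  fin_cases c <;> fin_cases d <;>
  · simp [act1, act2, actR, dress_nil, auxScalar, vecMul_algebraMap, kMatrix_shift, rMatrix,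
      Prod.swap, Fin.sum_univ_two, hk]
    simp only [sinh_exp_form, Complex.exp_add, Complex.exp_sub, Complex.exp_neg, two_mul]
    field_simp
    ring

theorem reflectionEq_dress {L : List (Fin N)} (hL : L.Nodup) : ReflectionEq p.η (p.dress L) := by
  induction L with
  | nil => exact p.reflectionEq_dress_nil
  | cons n L ih =>
    rw [List.nodup_cons] at hL
    refine (ih hL.2).dress (L := fun l => p.rSite n (l - p.ξ n))
      (L' := fun l => p.rSite n (l + p.ξ n)) ?_ ?_ ?_ ?_ ?_ ?_
    · intro l m v
      have := p.rSite_yang_baxter n (l - p.ξ n) (m - p.ξ n) v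
      rwa [sub_sub_sub_cancel_right] at this
    · intro l m v
      have := p.rSite_yang_baxter n (l + p.ξ n) (m + p.ξ n) v
      rwa [add_sub_add_right_eq_sub] at this
    · intro l m v
      have := p.rSite_yang_baxter_middle n (l + p.ξ n) (m - p.ξ n) v
      rwa [show l + p.ξ n + (m - p.ξ n) = l + m by ring] at this
    · intro l m v
      have := p.rSite_yang_baxter_middle n (l - p.ξ n) (m + p.ξ n) v
      rwa [show l - p.ξ n + (m + p.ξ n) = l + m by ring] at this
    · intro l m i j k k'
      exact p.dress_commute_siteOp hL.1 _ _ _ _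
    · intro l m i j k k'
      exact p.dress_commute_siteOp hL.1 _ _ _ _

end Params

/-! ### Transposition, inversion and crossing of the monodromy matrix. -/

theorem auxScalar_mul {N : ℕ} (m m' : Matrix (Fin 2) (Fin 2) ℂ) :
    auxScalar N m * auxScalar N m' = auxScalar N (m * m') := by
  simp only [auxScalar]
  rw [Matrix.map_mul]

theorem auxScalar_smul_one {N : ℕ} (c : ℂ) :
    auxScalar N (c • (1 : Matrix (Fin 2) (Fin 2) ℂ)) = c • (1 : AuxOp N) := by
  ext1 i j
  simp only [auxScalar, Matrix.map_apply, Matrix.smul_apply, Matrix.one_apply, smul_ite, smul_zero,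
    smul_eq_mul]
  split_ifs
  · simp [Algebra.algebraMap_eq_smul_one]
  · simp

theorem sigmaY_mul_self : sigmaY * sigmaY = 1 := by
  ext i j
  fin_cases i <;> fin_cases j <;> simp [sigmaY, Matrix.mul_apply, Fin.sum_univ_two]

/-- Transposition in both the auxiliary and the quantum space. -/
def fullTranspose {ι : Type} (X : Matrix (Fin 2) (Fin 2) (Matrix ι ι ℂ)) :
    Matrix (Fin 2) (Fin 2) (Matrix ι ι ℂ) := Matrix.of fun i j => (X j i)ᵀ

theorem fullTranspose_mul {ι : Type} [Fintype ι] (X Y : Matrix (Fin 2) (Fin 2) (Matrix ι ι ℂ)) :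
    fullTranspose (X * Y) = fullTranspose Y * fullTranspose X := by
  ext1 i j
  simp only [fullTranspose, Matrix.of_apply, Matrix.mul_apply, Matrix.transpose_sum,
    Matrix.transpose_mul]

namespace Params

variable {N : ℕ} (p : Params N)

theorem fullTranspose_rSite (n : Fin N) (l : ℂ) : fullTranspose (p.rSite n l) = p.rSite n l := by
  ext i j s t
  simp only [fullTranspose, rSite, Matrix.of_apply, Matrix.transpose_apply, siteOp]
  have h1 : (∀ k, k ≠ n → t k = s k) ↔ (∀ k, k ≠ n → s k = t k) := by
    constructor <;> intro h k hk <;> exact (h k hk).symm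
  have h2 : rMatrix p.η l (j, t n) (i, s n) = rMatrix p.η l (i, s n) (j, t n) := by
    generalize s n = a
    generalize t n = b
    fin_cases i <;> fin_cases j <;> fin_cases a <;> fin_cases b <;> simp [rMatrix, Prod.swap]
  simp only [h1, h2]

/-- The parameters of the chain whose boundary monodromy matrix is the full transpose. -/
def transposed : Params N := { p with ξ := fun n => -p.ξ n, τm := -p.τm }

theorem transposed_rSite (n : Fin N) (l : ℂ) : p.transposed.rSite n l = p.rSite n l := rfl

/-- The `R`-matrix is symmetric, and transposing `K₋` changes the sign of `τ₋`. Reversing the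
product exchanges `l - ξ_n` with `l + ξ_n`, hence the sign change of `ξ`. Columns of the chain thus
become rows of a chain of the same type, and every result on rows serves twice. -/
theorem transposed_dress (L : List (Fin N)) (l : ℂ) :
    p.transposed.dress L l = fullTranspose (p.dress L l) := by
  induction L with
  | nil =>
    ext i j
    simp only [dress_nil, fullTranspose, auxScalar, kMatrix, transposed, Matrix.of_apply,
      Matrix.map_apply, Matrix.transpose_apply, Matrix.algebraMap_matrix_apply, eq_comm]
    congr 1
    fin_cases i <;> fin_cases j <;> simp
  | cons n L ih =>
    rw [dress_cons, dress_cons, fullTranspose_mul, fullTranspose_mul, fullTranspose_rSite,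
      fullTranspose_rSite, ← ih, transposed_rSite, transposed_rSite, mul_assoc,
      show l - p.transposed.ξ n = l + p.ξ n from sub_neg_eq_add _ _,
      show l + p.transposed.ξ n = l - p.ξ n from (sub_eq_add_neg _ _).symm]

theorem rSite_mul_rSite_neg (n : Fin N) (u : ℂ) :
    p.rSite n u * p.rSite n (-u) =
      (Complex.sinh (u + p.η) * Complex.sinh (p.η - u)) • (1 : AuxOp N) := by
  have hx : Complex.exp u ≠ 0 := Complex.exp_ne_zero _
  have hz : Complex.exp p.η ≠ 0 := Complex.exp_ne_zero _
  ext1 i j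
  refine ext_vecMul fun v => ?_
  funext t
  simp only [Matrix.mul_apply, rSite, Matrix.of_apply, Matrix.vecMul_sum, ← Matrix.vecMul_vecMul,
    Finset.sum_apply, vecMul_siteOp, Matrix.smul_apply]
  have ht : v t = v (Function.update t n (t n)) := by simp
  generalize hb : t n = b at ht
  simp only [Function.update_idem, Function.update_self]
  fin_cases i <;> fin_cases j <;> fin_cases b <;>
  · simp [rMatrix, Fin.sum_univ_two, Prod.swap, Matrix.vecMul_smul, ht]
    try
      simp only [sinh_exp_form, Complex.exp_add, Complex.exp_sub, Complex.exp_neg]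
      field_simp <;> ring

/-- The scalar `K(l) K(-l)`. -/
def kNorm (l : ℂ) : ℂ := (Complex.sinh p.ςm)⁻¹ ^ 2 *
  (Complex.sinh (p.ςm + l) * Complex.sinh (p.ςm - l) - (p.κm * Complex.sinh (2 * l)) ^ 2)

theorem kMatrix_mul_neg (l : ℂ) :
    kMatrix p.η (l + p.η / 2) p.ςm p.κm p.τm * kMatrix p.η (-l + p.η / 2) p.ςm p.κm p.τm =
      p.kNorm l • 1 := by
  have ht : Complex.exp p.τm ≠ 0 := Complex.exp_ne_zero _
  rw [kMatrix_shift, kMatrix_shift]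
  have h1 : p.ςm - -l = p.ςm + l := by ring
  have h2 : -l + p.ςm = p.ςm - l := by ring
  have h3 : l + p.ςm = p.ςm + l := by ring
  rw [h1, h2, h3]
  ext i j
  fin_cases i <;> fin_cases j <;>
  · simp [Matrix.mul_apply, Fin.sum_univ_two, kNorm, Complex.exp_neg]
    field_simp
    try ring

/-- The product telescopes from the middle by unitarity of `R`, with the scalar `K(l) K(-l)` at the
centre. It makes the monodromy matrix invertible at `-ξ_n`, which `braList_ne_zero` needs. -/
theorem dress_mul_neg (L : List (Fin N)) (l : ℂ) :
    p.dress L l * p.dress L (-l) =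
      (p.kNorm l * (L.map fun n => (Complex.sinh (l + p.ξ n + p.η) * Complex.sinh (p.η - (l + p.ξ n))) *
        (Complex.sinh (l - p.ξ n + p.η) * Complex.sinh (p.η - (l - p.ξ n)))).prod) •
        (1 : AuxOp N) := by
  induction L with
  | nil =>
    rw [dress_nil, dress_nil, auxScalar_mul, kMatrix_mul_neg, auxScalar_smul_one]
    simp
  | cons n L ih =>
    have h1 : -l - p.ξ n = -(l + p.ξ n) := by ring
    have h2 : -l + p.ξ n = -(l - p.ξ n) := by ring
    rw [dress_cons, dress_cons, h1, h2]
    have : ∀ a b c d e f : AuxOp N, a * b * c * (d * e * f) = a * (b * (c * d) * e) * f := by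
      intros; simp only [mul_assoc]
    rw [this, rSite_mul_rSite_neg, Matrix.mul_smul, mul_one, Matrix.smul_mul, ih, smul_smul,
      Matrix.mul_smul, mul_one, Matrix.smul_mul, rSite_mul_rSite_neg, smul_smul]
    congr 1
    simp only [List.map_cons, List.prod_cons]
    ring

/-- Crossing symmetry of the six-vertex `R`-matrix. The sign, collected over the sites, cancels the
`(-1)^N` in `bulkMHat`. -/
theorem sigmaY_rSite (n : Fin N) (u : ℂ) :
    auxScalar N sigmaY * (p.rSite n u)ᵀ * auxScalar N sigmaY = (-1 : ℂ) • p.rSite n (-u - p.η) := by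
  have hx : Complex.exp u ≠ 0 := Complex.exp_ne_zero _
  have hz : Complex.exp p.η ≠ 0 := Complex.exp_ne_zero _
  have h0 : -(Complex.exp p.η * Complex.exp u)⁻¹ + Complex.exp p.η * Complex.exp u =
    Complex.exp p.η * Complex.exp u - (Complex.exp p.η * Complex.exp u)⁻¹ := by ring
  ext1 i j
  refine ext_vecMul fun v => ?_
  funext t
  simp only [Matrix.mul_apply, rSite, Matrix.of_apply, Matrix.transpose_apply, auxScalar,
    Matrix.map_apply, Matrix.vecMul_sum, ← Matrix.vecMul_vecMul, vecMul_algebraMap,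
    Matrix.vecMul_smul, Matrix.smul_vecMul, Matrix.sum_vecMul,
    Finset.sum_apply, vecMul_siteOp, Matrix.smul_apply, Pi.smul_apply]
  generalize hb : t n = b
  fin_cases i <;> fin_cases j <;> fin_cases b <;>
  · simp [rMatrix, Fin.sum_univ_two, Prod.swap, sigmaY]
    try
      simp only [sinh_exp_form, Complex.exp_add, Complex.exp_sub, Complex.exp_neg]
      field_simp
    try
      simp only [Complex.I_sq]
      ring

theorem rSite_prod_commute {n : Fin N} {L : List (Fin N)} (h : n ∉ L) (f : Fin N → ℂ)
    (m : Matrix (Fin 2) (Fin 2) ℂ) (i j : Fin 2) :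
    Commute ((L.map fun k => p.rSite k (f k)).prod i j) (siteOp n fun _ => m) := by
  induction L generalizing i j with
  | nil =>
    simp only [List.map_nil, List.prod_nil, Matrix.one_apply]
    split_ifs
    · exact Commute.one_left _
    · exact Commute.zero_left _
  | cons k L ih =>
    simp only [List.mem_cons, not_or] at h
    simp only [List.map_cons, List.prod_cons, Matrix.mul_apply]
    exact Commute.sum_left _ _ _ fun a _ =>
      Commute.mul_left (p.rSite_commute_siteOp h.1 _ _ _ _) (ih h.2 _ _)

theorem sigmaY_prod {L : List (Fin N)} (hL : L.Nodup) (f : Fin N → ℂ) :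
    (-1 : ℂ) ^ L.length • (auxScalar N sigmaY *
        ((L.reverse.map fun k => p.rSite k (f k)).prod)ᵀ * auxScalar N sigmaY) =
      (L.map fun k => p.rSite k (-f k - p.η)).prod := by
  induction L with
  | nil =>
    simp [auxScalar_mul, sigmaY_mul_self]
    simp [auxScalar]
  | cons n L ih =>
    rw [List.nodup_cons] at hL
    have hn : n ∉ L.reverse := by simpa using hL.1
    -- Transposition in the auxiliary space alone reverses a product only because the quantum
    -- entries of the two factors commute, being supported on different sites.
    have ht : ((L.reverse.map fun k => p.rSite k (f k)).prod * p.rSite n (f n))ᵀ =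
        (p.rSite n (f n))ᵀ * ((L.reverse.map fun k => p.rSite k (f k)).prod)ᵀ := by
      ext1 i j
      simp only [Matrix.transpose_apply, Matrix.mul_apply]
      refine Finset.sum_congr rfl fun a _ => ?_
      exact (p.rSite_prod_commute hn f _ _ _).eq
    have hs : auxScalar N sigmaY * auxScalar N sigmaY = 1 := by
      rw [auxScalar_mul, sigmaY_mul_self]
      simp [auxScalar]
    have : ∀ σ a b : AuxOp N, σ * σ = 1 → σ * (a * b) * σ = σ * a * σ * (σ * b * σ) := by
      intro σ a b h
      calc σ * (a * b) * σ = σ * a * 1 * b * σ := by simp only [mul_assoc, mul_one]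
        _ = _ := by rw [← h]; simp only [mul_assoc]
    simp only [List.reverse_cons, List.map_append, List.map_cons, List.map_nil, List.prod_append,
      List.prod_cons, List.prod_nil, mul_one, List.length_cons]
    rw [ht, this _ _ _ hs, sigmaY_rSite, ← ih hL.2, pow_succ, Matrix.smul_mul, Matrix.mul_smul,
      smul_smul, mul_neg_one, neg_mul_eq_neg_mul]
    simp

theorem boundaryU_eq_dress (l : ℂ) :
    p.boundaryU (l + p.η / 2) = p.dress (List.finRange N).reverse l := by
  have h2 : p.bulkMHat (l + p.η / 2) =
      ((List.finRange N).map fun k => p.rSite k (l + p.ξ k)).prod := by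
    have := p.sigmaY_prod (List.nodup_finRange N) (fun n => -(l + p.η / 2) - p.ξ n - p.η / 2)
    rw [bulkMHat, bulkM, prodDown, List.ofFn_eq_map, ← List.map_reverse]
    rw [List.length_finRange] at this
    rw [this]
    congr 2
    funext k
    congr 1
    ring
  have h3 : ∀ L : List (Fin N), p.dress L l = (L.map fun k => p.rSite k (l - p.ξ k)).prod *
      auxScalar N (kMatrix p.η (l + p.η / 2) p.ςm p.κm p.τm) *
      (L.reverse.map fun k => p.rSite k (l + p.ξ k)).prod := by
    intro L
    induction L with
    | nil => simp [dress_nil]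
    | cons n L ih =>
      rw [dress_cons, ih]
      simp [mul_assoc]
  rw [boundaryU, h2, h3, List.reverse_reverse, bulkM, prodDown, List.ofFn_eq_map, ← List.map_reverse]
  congr 4
  funext k
  congr 1
  ring

end Params

/-! ### Exchange relations for the gauged operators. -/

section Reflection

variable {ι : Type} [Fintype ι]

/-- The row `y X(l)` obtained from a row `ψ` and the gauge covector `y = (1, -exp (t - l))`. -/
def covec (X : ℂ → Matrix (Fin 2) (Fin 2) (Matrix ι ι ℂ)) (l t : ℂ) (ψ : ι → ℂ) (j : Fin 2) : ι → ℂ :=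
  ψ ᵥ* X l 0 j - Complex.exp (t - l) • (ψ ᵥ* X l 1 j)

/-- The gauged off-diagonal operator acting on a row. -/
def offDiag (X : ℂ → Matrix (Fin 2) (Fin 2) (Matrix ι ι ℂ)) (l t : ℂ) (ψ : ι → ℂ) : ι → ℂ :=
  Complex.exp (l + t) • covec X l t ψ 0 + covec X l t ψ 1

/-- The row `y X(l) x` with gauge vectors of parameters `t` and `t + 2η`. -/
def mixed (η : ℂ) (X : ℂ → Matrix (Fin 2) (Fin 2) (Matrix ι ι ℂ)) (l t : ℂ) (ψ : ι → ℂ) : ι → ℂ :=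
  Complex.exp (l + t + 2 * η) • covec X l t ψ 0 + covec X l t ψ 1

variable {X : ℂ → Matrix (Fin 2) (Fin 2) (Matrix ι ι ℂ)} {η : ℂ}

theorem covec_smul (l t c : ℂ) (ψ : ι → ℂ) (j : Fin 2) :
    covec X l t (c • ψ) j = c • covec X l t ψ j := by
  simp only [covec, Matrix.smul_vecMul]
  module

theorem covec_add (l t : ℂ) (ψ φ : ι → ℂ) (j : Fin 2) :
    covec X l t (ψ + φ) j = covec X l t ψ j + covec X l t φ j := by
  simp only [covec, Matrix.add_vecMul, smul_add]
  abel

theorem offDiag_smul (l t c : ℂ) (ψ : ι → ℂ) :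
    offDiag X l t (c • ψ) = c • offDiag X l t ψ := by
  simp only [offDiag, covec_smul]
  module

theorem offDiag_add (l t : ℂ) (ψ φ : ι → ℂ) :
    offDiag X l t (ψ + φ) = offDiag X l t ψ + offDiag X l t φ := by
  simp only [offDiag, covec_add, smul_add]
  abel

theorem covec_one_of_offDiag_eq_zero {l t : ℂ} {ψ : ι → ℂ} (h : offDiag X l t ψ = 0) :
    covec X l t ψ 1 = -(Complex.exp (l + t) • covec X l t ψ 0) :=
  eq_neg_of_add_eq_zero_right h

/-- The reflection equation contracted on the left with the gauge covectors of parameters `t - η`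
and `t`. -/
theorem ReflectionEq.contract (hX : ReflectionEq η X) (l m t : ℂ) (ψ : ι → ℂ) (c d : Fin 2) :
    Complex.sinh (l - m + η) • act2 (X m) (actR (rMatrix η (l + m))
        (fun a b => (![1, -Complex.exp (t - η - m)] b) • covec X l t ψ a)) c d =
      actR (rMatrix η (l - m)) (act1 (X l) (actR (rMatrix η (l + m))
        (fun a b => (![1, -Complex.exp (t - η - l)] a) • covec X m t ψ b))) c d := by
  have key := hX l m fun a b => ((![1, -Complex.exp (t - η - l)] a) *
    (![1, -Complex.exp (t - m)] b)) • ψ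
  -- Vertex-IRF intertwining: `R(l - m)` exchanges the parameters `t - η` and `t` of a pair of gauge
  -- covectors, at the cost of one scalar.
  have e1 : actR (rMatrix η (l - m)) (fun a b => ((![1, -Complex.exp (t - η - l)] a) *
      (![1, -Complex.exp (t - m)] b)) • ψ) = fun a b => (Complex.sinh (l - m + η) *
      ((![1, -Complex.exp (t - l)] a) * (![1, -Complex.exp (t - η - m)] b))) • ψ := by
    have hx : Complex.exp l ≠ 0 := Complex.exp_ne_zero _
    have hy : Complex.exp m ≠ 0 := Complex.exp_ne_zero _
    have hz : Complex.exp η ≠ 0 := Complex.exp_ne_zero _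
    funext a b s
    fin_cases a <;> fin_cases b <;>
    · simp [actR, rMatrix, Prod.swap]
      try
        simp only [sinh_exp_form, Complex.exp_add, Complex.exp_sub]
        field_simp <;> ring
  have e2 : act1 (X l) (fun a b => (Complex.sinh (l - m + η) *
      ((![1, -Complex.exp (t - l)] a) * (![1, -Complex.exp (t - η - m)] b))) • ψ) =
      fun a b => Complex.sinh (l - m + η) •
        ((![1, -Complex.exp (t - η - m)] b) • covec X l t ψ a) := by
    funext a b
    simp [act1, covec, Matrix.smul_vecMul, Fin.sum_univ_two]
    module
  have e3 : act2 (X m) (fun a b => ((![1, -Complex.exp (t - η - l)] a) *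
      (![1, -Complex.exp (t - m)] b)) • ψ) =
      fun a b => (![1, -Complex.exp (t - η - l)] a) • covec X m t ψ b := by
    funext a b
    simp [act2, covec, Matrix.smul_vecMul, Fin.sum_univ_two]
    module
  have e4 : ∀ (c : ℂ) (v : Row2 ι), act2 (X m) (actR (rMatrix η (l + m)) (fun a b => c • v a b)) =
      fun a b => c • act2 (X m) (actR (rMatrix η (l + m)) v) a b := by
    intro c v
    funext a b
    simp only [act2, actR, Finset.smul_sum, smul_comm c, ← Matrix.smul_vecMul]
  rw [e1, e2, e3, e4] at key
  exact congrFun (congrFun key c) d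

/-- The contracted reflection equation when the row is annihilated by the off-diagonal operator. -/
theorem ReflectionEq.contract_offDiag (hX : ReflectionEq η X) {l m t : ℂ} {ψ : ι → ℂ}
    (h : offDiag X m t ψ = 0) (c d : Fin 2) :
    Complex.sinh (l - m + η) • act2 (X m) (actR (rMatrix η (l + m))
        (fun a b => (![1, -Complex.exp (t - η - m)] b) • covec X l t ψ a)) c d =
      Complex.sinh (l + m + η) • actR (rMatrix η (l - m)) (fun a b =>
        (![1, -Complex.exp (m + t - η)] b) • covec X l t (covec X m t ψ 0) a) c d := by
  rw [hX.contract]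
  -- Since the off-diagonal operator vanishes on `ψ`, the row `y X(m)` is proportional to `(1, -exp
  -- (t + m))`, the gauge covector at `-m`. The same intertwining therefore applies with `l + m` in
  -- place of `l - m`.
  have e : actR (rMatrix η (l + m)) (fun a b => (![1, -Complex.exp (t - η - l)] a) •
      covec X m t ψ b) = fun a b => (Complex.sinh (l + m + η) * (![1, -Complex.exp (m + t - η)] b) *
        (![1, -Complex.exp (t - l)] a)) • covec X m t ψ 0 := by
    have hx : Complex.exp l ≠ 0 := Complex.exp_ne_zero _
    have hy : Complex.exp m ≠ 0 := Complex.exp_ne_zero _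
    have hz : Complex.exp η ≠ 0 := Complex.exp_ne_zero _
    funext a b s
    have h1 := congrFun (covec_one_of_offDiag_eq_zero h) s
    simp only [Pi.neg_apply, Pi.smul_apply, smul_eq_mul] at h1
    fin_cases a <;> fin_cases b <;>
    · simp [actR, rMatrix, Prod.swap, h1]
      try
        simp only [sinh_exp_form, Complex.exp_add, Complex.exp_sub]
        field_simp <;> ring
  rw [e]
  have e2 : act1 (X l) (fun a b => (Complex.sinh (l + m + η) * (![1, -Complex.exp (m + t - η)] b) *
        (![1, -Complex.exp (t - l)] a)) • covec X m t ψ 0) = fun a b => Complex.sinh (l + m + η) •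
        ((![1, -Complex.exp (m + t - η)] b) • covec X l t (covec X m t ψ 0) a) := by
    funext a b
    simp only [act1, Fin.sum_univ_two, Matrix.smul_vecMul]
    rw [covec.eq_def X l t (covec X m t ψ 0)]
    generalize (![1, -Complex.exp (m + t - η)] b) = y
    simp
    module
  rw [e2]
  simp only [actR, Finset.smul_sum, smul_comm (Complex.sinh (l + m + η))]

/-- Exchange of the diagonal and of the off-diagonal operator. -/
theorem ReflectionEq.offDiag_covec (hX : ReflectionEq η X) {l m t : ℂ} {ψ : ι → ℂ}
    (h : offDiag X m t ψ = 0) :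
    (Complex.sinh (l + m + η) * Complex.sinh (l - m)) • offDiag X l t (covec X m t ψ 0) =
      (Complex.sinh (l - m + η) * Complex.sinh (l + m)) •
        covec X m (t - 2 * η) (offDiag X l t ψ) 0 := by
  have hx : Complex.exp l ≠ 0 := Complex.exp_ne_zero _
  have hy : Complex.exp m ≠ 0 := Complex.exp_ne_zero _
  have hz : Complex.exp η ≠ 0 := Complex.exp_ne_zero _
  have ht : Complex.exp t ≠ 0 := Complex.exp_ne_zero _
  have k0 := hX.contract_offDiag (l := l) h 0 0
  have k1 := hX.contract_offDiag (l := l) h 1 0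
  -- The first index is contracted with the gauge vector of parameter `t - η`, which leaves only the
  -- off-diagonal operator on each side.
  have e1 : Complex.exp (l + t - η) • actR (rMatrix η (l - m)) (fun a b =>
        (![1, -Complex.exp (m + t - η)] b) • covec X l t (covec X m t ψ 0) a) 0 0 +
      actR (rMatrix η (l - m)) (fun a b =>
        (![1, -Complex.exp (m + t - η)] b) • covec X l t (covec X m t ψ 0) a) 1 0 =
      Complex.sinh (l - m) • offDiag X l t (covec X m t ψ 0) := by
    funext s
    simp [actR, rMatrix, Prod.swap, offDiag]
    simp only [sinh_exp_form, Complex.exp_add, Complex.exp_sub]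
    field_simp
    ring
  have e2 : Complex.exp (l + t - η) • act2 (X m) (actR (rMatrix η (l + m))
        (fun a b => (![1, -Complex.exp (t - η - m)] b) • covec X l t ψ a)) 0 0 +
      act2 (X m) (actR (rMatrix η (l + m))
        (fun a b => (![1, -Complex.exp (t - η - m)] b) • covec X l t ψ a)) 1 0 =
      Complex.sinh (l + m) • covec X m (t - 2 * η) (offDiag X l t ψ) 0 := by
    rw [covec]
    generalize hA : X m 0 0 = A
    generalize hB : X m 1 0 = B
    simp [actR, rMatrix, Prod.swap, offDiag, act2, Matrix.add_vecMul, Matrix.smul_vecMul,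
      Matrix.neg_vecMul, hA, hB]
    funext s
    simp
    simp only [sinh_exp_form, two_mul, Complex.exp_add, Complex.exp_sub]
    field_simp
    ring
  rw [mul_smul, mul_smul, ← e1, ← e2, smul_add, smul_add, smul_comm, ← k0, ← k1, smul_comm]

/-- Commutation of the diagonal operators on a row annihilated by the off-diagonal operators. -/
theorem ReflectionEq.covec_comm (hX : ReflectionEq η X) {l m t : ℂ} {ψ : ι → ℂ}
    (h : offDiag X m t ψ = 0) (h' : offDiag X l t ψ = 0) (hs : Complex.sinh (l - m + η) ≠ 0)
    (hs' : Complex.sinh (l + m + η) ≠ 0) :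
    covec X l t (covec X m t ψ 0) 0 = covec X m t (covec X l t ψ 0) 0 := by
  have hx : Complex.exp l ≠ 0 := Complex.exp_ne_zero _
  have hy : Complex.exp m ≠ 0 := Complex.exp_ne_zero _
  have hz : Complex.exp η ≠ 0 := Complex.exp_ne_zero _
  have k0 := hX.contract_offDiag (l := l) h 0 0
  have e1 : actR (rMatrix η (l - m)) (fun a b =>
        (![1, -Complex.exp (m + t - η)] b) • covec X l t (covec X m t ψ 0) a) 0 0 =
      Complex.sinh (l - m + η) • covec X l t (covec X m t ψ 0) 0 := by
    simp [actR, rMatrix, Prod.swap]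
  have e2 : act2 (X m) (actR (rMatrix η (l + m))
        (fun a b => (![1, -Complex.exp (t - η - m)] b) • covec X l t ψ a)) 0 0 =
      Complex.sinh (l + m + η) • covec X m t (covec X l t ψ 0) 0 := by
    rw [covec.eq_def X m t (covec X l t ψ 0)]
    have h1 := covec_one_of_offDiag_eq_zero h'
    generalize hA : X m 0 0 = A
    generalize hB : X m 1 0 = B
    simp [actR, rMatrix, Prod.swap, act2, Matrix.add_vecMul, Matrix.smul_vecMul,
      Matrix.neg_vecMul, hA, hB, h1]
    funext s
    simp
    simp only [sinh_exp_form, Complex.exp_add, Complex.exp_sub]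
    field_simp
    ring
  rw [e1, e2, smul_comm] at k0
  exact (smul_right_injective _ hs (smul_right_injective _ hs' k0)).symm

/-- The relation that determines the mixed operator on a row annihilated by `y X(l)`. -/
theorem ReflectionEq.offDiag_mixed (hX : ReflectionEq η X) {l m t : ℂ} {ψ : ι → ℂ}
    (h : ∀ j, covec X l t ψ j = 0) (h' : ∀ j, covec X l (t - 2 * η) (offDiag X m t ψ) j = 0)
    (hs : Complex.sinh (l - m + η) ≠ 0) :
    Complex.sinh (l + m + η) • offDiag X l t (mixed η X m t ψ) =
      (Complex.exp η * Complex.sinh (l + m + 2 * η)) • offDiag X l t (offDiag X m t ψ) := by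
  have hx : Complex.exp l ≠ 0 := Complex.exp_ne_zero _
  have hy : Complex.exp m ≠ 0 := Complex.exp_ne_zero _
  have hz : Complex.exp η ≠ 0 := Complex.exp_ne_zero _
  have ht : Complex.exp t ≠ 0 := Complex.exp_ne_zero _
  set H : Row2 ι := actR (rMatrix η (l + m))
    (fun a b => (![1, -Complex.exp (t - η - l)] a) • covec X m t ψ b) with hH
  set G : Row2 ι := act1 (X l) H with hG
  -- One side of the contracted reflection equation contains `y X(l)` acting on `ψ`, which vanishes
  -- by assumption.
  have k : ∀ c d, actR (rMatrix η (l - m)) G c d = 0 := by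
    intro c d
    rw [← hX.contract]
    simp [h, act2, actR]
  have e1 : Complex.sinh (l - m + η) • (Complex.exp (l + t) • (Complex.exp (m + t + η) • G 0 0 + G 0 1)
      + (Complex.exp (m + t + η) • G 1 0 + G 1 1)) = 0 := by
    -- The intertwining relation for gauge vectors on the right moves `R(l - m)` through the pair of
    -- parameters `t + η`, `t` and leaves the pair `t`, `t + η`.
    have : Complex.exp (l + t + η) • (Complex.exp (m + t) • actR (rMatrix η (l - m)) G 0 0 +
        actR (rMatrix η (l - m)) G 0 1) + (Complex.exp (m + t) • actR (rMatrix η (l - m)) G 1 0 +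
        actR (rMatrix η (l - m)) G 1 1) = 0 := by simp [k]
    rw [← this]
    funext s
    simp [actR, rMatrix, Prod.swap]
    simp only [sinh_exp_form, Complex.exp_add, Complex.exp_sub]
    field_simp
    ring
  have e2 := (smul_eq_zero.mp e1).resolve_left hs
  set δ : ℂ := Complex.sinh (l + m) - Complex.exp (-η) * Complex.sinh (l + m + η) +
    Complex.sinh (l + m + 2 * η) with hδ
  -- The auxiliary index is split along the covectors of parameters `t` and `t - 2η`. The second
  -- component carries only `offDiag X m t ψ` and is killed by `h'`; `δ` is its coefficient.
  have e3 : ∀ a, Complex.exp (m + t + η) • H a 0 + H a 1 = (![1, -Complex.exp (t - l)] a) •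
      ((Complex.exp (-η) * Complex.sinh (l + m + η)) • mixed η X m t ψ -
        Complex.sinh (l + m + 2 * η) • offDiag X m t ψ) +
      ((![1, -Complex.exp (t - 2 * η - l)] a) * δ) • offDiag X m t ψ := by
    intro a
    funext s
    fin_cases a <;>
    · simp [hH, actR, rMatrix, Prod.swap, mixed, offDiag, hδ]
      simp only [sinh_exp_form, two_mul, Complex.exp_add, Complex.exp_sub, Complex.exp_neg]
      field_simp
      ring
  have e4 : ∀ e, Complex.exp (m + t + η) • G e 0 + G e 1 =
      covec X l t ((Complex.exp (-η) * Complex.sinh (l + m + η)) • mixed η X m t ψ -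
        Complex.sinh (l + m + 2 * η) • offDiag X m t ψ) e := by
    intro e
    have : Complex.exp (m + t + η) • G e 0 + G e 1 =
        ∑ a, (Complex.exp (m + t + η) • H a 0 + H a 1) ᵥ* X l a e := by
      simp only [hG, act1, Finset.smul_sum, Matrix.add_vecMul, Matrix.smul_vecMul,
        Finset.sum_add_distrib]
    have h2 := h' e
    rw [covec] at h2 ⊢
    rw [this, Fin.sum_univ_two, e3, e3]
    generalize hA : X l 0 e = A at *
    generalize hB : X l 1 e = B at *
    simp only [Matrix.cons_val_zero, Matrix.cons_val_one, one_smul, one_mul, Matrix.add_vecMul,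
      Matrix.smul_vecMul]
    generalize offDiag X m t ψ ᵥ* A = u at *
    generalize offDiag X m t ψ ᵥ* B = w at *
    linear_combination (norm := module) δ • h2
  have e5 : offDiag X l t ((Complex.exp (-η) * Complex.sinh (l + m + η)) • mixed η X m t ψ -
        Complex.sinh (l + m + 2 * η) • offDiag X m t ψ) = 0 := by
    rw [offDiag, ← e4, ← e4]
    exact e2
  rw [sub_eq_add_neg, offDiag_add, ← neg_smul, offDiag_smul, offDiag_smul] at e5
  have e6 := congrArg (fun v => Complex.exp η • v) e5
  simp only [smul_add, smul_smul, smul_zero] at e6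
  rw [← mul_assoc, ← Complex.exp_add, add_neg_cancel, Complex.exp_zero, one_mul, mul_neg, neg_smul]
    at e6
  exact eq_of_sub_eq_zero (by rw [sub_eq_add_neg]; exact e6)

end Reflection

/-! ### Product reference rows. -/

/-- The gauge covector `(1, -exp (t - l))`. -/
def gaugeRow (l t : ℂ) : Fin 2 → ℂ := ![1, -Complex.exp (t - l)]

theorem prod_update_apply {N : ℕ} (f : Fin N → Fin 2 → ℂ) (n : Fin N) (s : Spins N) :
    ∏ j, f j (s j) = f n (s n) * ∏ j ∈ Finset.univ.erase n, f j (s j) :=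
  (Finset.mul_prod_erase _ _ (Finset.mem_univ n)).symm

namespace Params

variable {N : ℕ} (p : Params N)

/-- The product row with gauge parameter `θ n` at the site `n`. -/
def refRow (θ : Fin N → ℂ) : Spins N → ℂ := fun s => ∏ n, gaugeRow (p.ξ n) (θ n) (s n)

/-- The product of the factors of `refRow` at the sites other than `n`. -/
def refRest (θ : Fin N → ℂ) (n : Fin N) (s : Spins N) : ℂ :=
  ∏ j ∈ Finset.univ.erase n, gaugeRow (p.ξ j) (θ j) (s j)

theorem refRow_eq (θ : Fin N → ℂ) (n : Fin N) (s : Spins N) :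
    p.refRow θ s = gaugeRow (p.ξ n) (θ n) (s n) * p.refRest θ n s :=
  prod_update_apply (fun j => gaugeRow (p.ξ j) (θ j)) n s

theorem refRest_update_left (θ : Fin N → ℂ) (n : Fin N) (t : ℂ) (s : Spins N) :
    p.refRest (Function.update θ n t) n s = p.refRest θ n s := by
  refine Finset.prod_congr rfl fun j hj => ?_
  rw [Function.update_of_ne (Finset.ne_of_mem_erase hj)]

theorem refRest_update_right (θ : Fin N → ℂ) (n : Fin N) (s : Spins N) (k : Fin 2) :
    p.refRest θ n (Function.update s n k) = p.refRest θ n s := by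
  refine Finset.prod_congr rfl fun j hj => ?_
  rw [Function.update_of_ne (Finset.ne_of_mem_erase hj)]

theorem refRow_update_left (θ : Fin N → ℂ) (n : Fin N) (t : ℂ) (s : Spins N) :
    p.refRow (Function.update θ n t) s = gaugeRow (p.ξ n) t (s n) * p.refRest θ n s := by
  rw [refRow_eq (n := n), refRest_update_left, Function.update_self]

theorem refRow_update_right (θ : Fin N → ℂ) (n : Fin N) (s : Spins N) (k : Fin 2) :
    p.refRow θ (Function.update s n k) = gaugeRow (p.ξ n) (θ n) k * p.refRest θ n s := by
  rw [refRow_eq (n := n), refRest_update_right, Function.update_self]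

/-- The intertwining relation at one site: the auxiliary parameter rises by `η` while the site
parameter drops from `t + η` to `t`. The right factor of the dressing lowers it once more in
`refRow_rSite`, which explains the total shift `-2η`. -/
theorem covec_rSite (θ : Fin N → ℂ) {n : Fin N} {l t : ℂ} (h : θ n = t + p.η) (j : Fin 2) :
    covec (fun l => p.rSite n (l - p.ξ n)) l t (p.refRow θ) j =
      (Complex.sinh (l - p.ξ n + p.η) * gaugeRow l (t + p.η) j) •
        p.refRow (Function.update θ n t) := by
  have hx : Complex.exp l ≠ 0 := Complex.exp_ne_zero _
  have hy : Complex.exp (p.ξ n) ≠ 0 := Complex.exp_ne_zero _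
  have hz : Complex.exp p.η ≠ 0 := Complex.exp_ne_zero _
  funext s
  simp only [covec, rSite, Matrix.of_apply, Pi.sub_apply, Pi.smul_apply, vecMul_siteOp,
    refRow_update_left, refRow_update_right, smul_eq_mul, h]
  generalize p.refRest θ n s = r
  generalize s n = b
  fin_cases j <;> fin_cases b <;>
  · simp [rMatrix, Fin.sum_univ_two, Prod.swap, gaugeRow]
    try
      simp only [sinh_exp_form, Complex.exp_add, Complex.exp_sub]
      field_simp <;> ring

theorem refRow_rSite (θ : Fin N → ℂ) {n : Fin N} {l t : ℂ} (h : θ n = t) (i : Fin 2) :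
    p.refRow θ ᵥ* (Complex.exp (l + t) • p.rSite n (l + p.ξ n) i 0 + p.rSite n (l + p.ξ n) i 1) =
      (Complex.sinh (l + p.ξ n) * ![Complex.exp (l + t + p.η), 1] i) •
        p.refRow (Function.update θ n (t - p.η)) := by
  have hx : Complex.exp l ≠ 0 := Complex.exp_ne_zero _
  have hy : Complex.exp (p.ξ n) ≠ 0 := Complex.exp_ne_zero _
  have hz : Complex.exp p.η ≠ 0 := Complex.exp_ne_zero _
  funext s
  simp only [rSite, Matrix.of_apply, Matrix.vecMul_add, Matrix.vecMul_smul, Pi.add_apply,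
    Pi.smul_apply, vecMul_siteOp, refRow_update_left, refRow_update_right, smul_eq_mul, h]
  generalize p.refRest θ n s = r
  generalize s n = b
  fin_cases i <;> fin_cases b <;>
  · simp [rMatrix, Fin.sum_univ_two, Prod.swap, gaugeRow]
    try
      simp only [sinh_exp_form, Complex.exp_add, Complex.exp_sub]
      field_simp <;> ring

theorem covec_dress_cons (θ : Fin N → ℂ) {n : Fin N} {L : List (Fin N)} {l t : ℂ}
    (h : θ n = t + p.η) (j : Fin 2) :
    covec (p.dress (n :: L)) l t (p.refRow θ) j = Complex.sinh (l - p.ξ n + p.η) •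
      ∑ b, covec (p.dress L) l (t + p.η) (p.refRow (Function.update θ n t)) b ᵥ*
        p.rSite n (l + p.ξ n) b j := by
  have h0 := p.covec_rSite θ h (l := l) 0
  have h1 := p.covec_rSite θ h (l := l) 1
  simp only [covec, gaugeRow] at h0 h1
  have e : covec (p.dress (n :: L)) l t (p.refRow θ) j = ∑ b, ∑ a,
      ((p.refRow θ ᵥ* p.rSite n (l - p.ξ n) 0 a - Complex.exp (t - l) •
        (p.refRow θ ᵥ* p.rSite n (l - p.ξ n) 1 a)) ᵥ* p.dress L l a b) ᵥ*
        p.rSite n (l + p.ξ n) b j := by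
    simp only [covec, dress_cons, Matrix.mul_apply, Matrix.vecMul_sum, ← Matrix.vecMul_vecMul,
      Matrix.sum_vecMul, Matrix.sub_vecMul, Matrix.smul_vecMul, Finset.sum_sub_distrib,
      Finset.smul_sum]
  rw [e, Fin.sum_univ_two, Fin.sum_univ_two, Fin.sum_univ_two, h0, h1]
  simp only [covec, Fin.sum_univ_two, Matrix.sub_vecMul, Matrix.smul_vecMul,
    Matrix.cons_val_zero, Matrix.cons_val_one]
  module

/-- The boundary factor of the eigenvalue of the off-diagonal operator. -/
def kFactor (t : ℂ) : ℂ := (Complex.sinh p.ςm)⁻¹ *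
  (p.κm * Complex.exp p.τm + Complex.exp (t + p.ςm) - p.κm * Complex.exp (2 * t - p.τm))

/-- The dependence on `l` separates from the one on `t`, so non-vanishing of the boundary
contribution is a condition on the gauge parameter alone whenever `sinh (2l) ≠ 0`. -/
theorem offDiag_dress_nil (l t : ℂ) (ψ : Spins N → ℂ) :
    offDiag (p.dress []) l t ψ = (Complex.sinh (2 * l) * p.kFactor t) • ψ := by
  have hx : Complex.exp l ≠ 0 := Complex.exp_ne_zero _
  have ht : Complex.exp p.τm ≠ 0 := Complex.exp_ne_zero _
  have hs : Complex.exp p.ςm ≠ 0 := Complex.exp_ne_zero _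
  funext s
  generalize hk : (Complex.sinh p.ςm)⁻¹ = k
  simp only [offDiag, covec, dress_nil, auxScalar, Matrix.map_apply, vecMul_algebraMap]
  simp [kMatrix_shift, kFactor, hk]
  simp only [sinh_exp_form, Complex.exp_add, Complex.exp_sub, Complex.exp_neg, two_mul]
  field_simp
  ring

/-- The off-diagonal operator acts on product rows by a shift of the gauge parameter. -/
theorem offDiag_dress_refRow {L : List (Fin N)} (hL : L.Nodup) {t : ℂ} {θ : Fin N → ℂ}
    (hθ : ∀ (i : ℕ) (h : i < L.length), θ L[i] = t + (i + 1) * p.η) (l : ℂ) :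
    offDiag (p.dress L) l t (p.refRow θ) =
      (Complex.sinh (2 * l) * p.kFactor (t + L.length * p.η) * (L.map fun n =>
        Complex.sinh (l - p.ξ n + p.η) * Complex.sinh (l + p.ξ n)).prod) •
        p.refRow fun n => if n ∈ L then θ n - 2 * p.η else θ n := by
  induction L generalizing t θ with
  | nil =>
    rw [offDiag_dress_nil]
    simp
  | cons n L ih =>
    rw [List.nodup_cons] at hL
    have hn : θ n = t + p.η := (hθ 0 (by simp)).trans (by push_cast; ring)
    have e : offDiag (p.dress (n :: L)) l t (p.refRow θ) =
        (Complex.sinh (l - p.ξ n + p.η) * Complex.sinh (l + p.ξ n)) •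
        offDiag (p.dress L) l (t + p.η) (p.refRow (Function.update θ n (t - p.η))) := by
      have h2 : ∀ b, covec (p.dress L) l (t + p.η) (p.refRow (Function.update θ n t)) b ᵥ*
          (Complex.exp (l + t) • p.rSite n (l + p.ξ n) b 0 + p.rSite n (l + p.ξ n) b 1) =
          (Complex.sinh (l + p.ξ n) * ![Complex.exp (l + t + p.η), 1] b) •
          covec (p.dress L) l (t + p.η) (p.refRow (Function.update θ n (t - p.η))) b := by
        intro b
        have h3 := p.refRow_rSite (Function.update θ n t) (n := n) (l := l) (t := t) (by simp) b
        have hc : ∀ i, Commute (p.dress L l i b)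
            (Complex.exp (l + t) • p.rSite n (l + p.ξ n) b 0 + p.rSite n (l + p.ξ n) b 1) := by
          intro i
          refine Commute.add_right (Commute.smul_right ?_ _) ?_
          · exact p.dress_commute_siteOp hL.1 _ _ _ _
          · exact p.dress_commute_siteOp hL.1 _ _ _ _
        rw [covec, Matrix.sub_vecMul, Matrix.smul_vecMul, Matrix.vecMul_vecMul,
          Matrix.vecMul_vecMul, (hc 0).eq, (hc 1).eq, ← Matrix.vecMul_vecMul,
          ← Matrix.vecMul_vecMul, h3, Function.update_idem, covec]
        simp only [Matrix.smul_vecMul]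
        module
      rw [offDiag, covec_dress_cons p θ hn, covec_dress_cons p θ hn]
      have h20 := h2 0
      have h21 := h2 1
      simp only [Matrix.vecMul_add, Matrix.vecMul_smul, Matrix.cons_val_zero,
        Matrix.cons_val_one] at h20 h21
      simp only [Fin.sum_univ_two, offDiag]
      rw [show l + (t + p.η) = l + t + p.η by ring]
      linear_combination (norm := module) Complex.sinh (l - p.ξ n + p.η) • h20 +
        Complex.sinh (l - p.ξ n + p.η) • h21
    rw [e, ih hL.2 (t := t + p.η), smul_smul]
    · congr 1
      · simp only [List.length_cons, List.map_cons, List.prod_cons, Nat.cast_add, Nat.cast_one]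
        rw [show t + p.η + (L.length : ℂ) * p.η = t + ((L.length : ℂ) + 1) * p.η by ring]
        ring
      · congr 1
        funext k
        by_cases hk : k = n
        · subst hk
          simp [hL.1, hn]
          ring
        · simp [hk]
    · intro i hi
      have h1 : L[i] ≠ n := fun h => hL.1 (h ▸ List.getElem_mem hi)
      rw [Function.update_of_ne h1]
      have := hθ (i + 1) (by simpa using hi)
      simp only [List.getElem_cons_succ, Nat.cast_add, Nat.cast_one] at this
      rw [this]
      ring

/-- Peeling off site `n` produces the factor `sinh (l - ξ_n + η)`, which vanishes at `l = ξ_n - η`.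
The full covector row is killed, not only the off-diagonal operator. -/
theorem covec_dress_refRow_eq_zero {L : List (Fin N)} (hL : L.Nodup) {t : ℂ} {θ : Fin N → ℂ}
    (hθ : ∀ (i : ℕ) (h : i < L.length), θ L[i] = t + (i + 1) * p.η) {n : Fin N} (hn : n ∈ L)
    (j : Fin 2) : covec (p.dress L) (p.ξ n - p.η) t (p.refRow θ) j = 0 := by
  induction L generalizing t θ j with
  | nil => simp at hn
  | cons k L ih =>
    rw [List.nodup_cons] at hL
    have hk : θ k = t + p.η := (hθ 0 (by simp)).trans (by push_cast; ring)
    rw [covec_dress_cons p θ hk]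
    rcases List.mem_cons.mp hn with rfl | hn
    · simp
    · have : ∀ b, covec (p.dress L) (p.ξ n - p.η) (t + p.η)
          (p.refRow (Function.update θ k t)) b = 0 := by
        refine fun b => ih hL.2 ?_ hn b
        intro i hi
        have h1 : L[i] ≠ k := fun h => hL.1 (h ▸ List.getElem_mem hi)
        rw [Function.update_of_ne h1]
        have := hθ (i + 1) (by simpa using hi)
        simp only [List.getElem_cons_succ, Nat.cast_add, Nat.cast_one] at this
        rw [this]
        ring
      simp [this]

/-- The boundary monodromy matrix with shifted spectral parameter. -/
def bdryX (l : ℂ) : AuxOp N := p.dress (List.finRange N).reverse l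

theorem boundaryU_eq_bdryX (l : ℂ) : p.boundaryU (l + p.η / 2) = p.bdryX l :=
  p.boundaryU_eq_dress l

theorem reflectionEq_bdryX : ReflectionEq p.η p.bdryX :=
  p.reflectionEq_dress (List.nodup_reverse.mpr (List.nodup_finRange N))

/-- The reference row of gauge parameter `T`. -/
def refBraRow (T : ℂ) : Spins N → ℂ := p.refRow fun n => T + ((N : ℂ) - 1 - (n : ℕ)) * p.η

/-- The outermost site is the last one and has parameter `T`; the auxiliary parameter is therefore
`T - η`, one step below. -/
theorem refBraRow_chain (T : ℂ) (i : ℕ) (h : i < (List.finRange N).reverse.length) :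
    (fun n : Fin N => T + ((N : ℂ) - 1 - (n : ℕ)) * p.η) (List.finRange N).reverse[i] =
      T - p.η + (i + 1) * p.η := by
  simp only [List.length_reverse, List.length_finRange] at h
  simp only [List.getElem_reverse, List.getElem_finRange, List.length_finRange, Fin.val_cast]
  rw [Nat.cast_sub (by omega), Nat.cast_sub (by omega)]
  push_cast
  ring

theorem offDiag_refBraRow (l T : ℂ) :
    offDiag p.bdryX l (T - p.η) (p.refBraRow T) =
      (Complex.sinh (2 * l) * p.kFactor (T + ((N : ℂ) - 1) * p.η) *
        ∏ n, Complex.sinh (l - p.ξ n + p.η) * Complex.sinh (l + p.ξ n)) •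
        p.refBraRow (T - 2 * p.η) := by
  have := p.offDiag_dress_refRow (t := T - p.η)
    (θ := fun n => T + ((N : ℂ) - 1 - (n : ℕ)) * p.η) (List.nodup_reverse.mpr (List.nodup_finRange N))
    (p.refBraRow_chain T) l
  unfold bdryX refBraRow
  rw [this]
  congr 1
  · rw [List.map_reverse, List.prod_reverse, ← List.ofFn_eq_map, List.prod_ofFn]
    simp only [List.length_reverse, List.length_finRange]
    congr 3
    ring
  · congr 1
    funext n
    simp
    ring

theorem covec_refBraRow_eq_zero (T : ℂ) (n : Fin N) (j : Fin 2) :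
    covec p.bdryX (p.ξ n - p.η) (T - p.η) (p.refBraRow T) j = 0 :=
  p.covec_dress_refRow_eq_zero (t := T - p.η)
    (θ := fun n => T + ((N : ℂ) - 1 - (n : ℕ)) * p.η) (List.nodup_reverse.mpr (List.nodup_finRange N))
    (p.refBraRow_chain T) (by simp) j

theorem refBraRow_ne_zero (T : ℂ) : p.refBraRow T ≠ 0 := by
  intro h
  have := congrFun h fun _ => 0
  simp [refBraRow, refRow, gaugeRow] at this

end Params

/-! ### Countable exceptional sets and continuity. -/

theorem countable_sinh_add_eq_zero (a : ℂ) : {z : ℂ | Complex.sinh (z + a) = 0}.Countable := by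
  refine (Set.countable_range fun n : ℤ => (n : ℂ) * (Real.pi * Complex.I) - a).mono ?_
  intro z hz
  have h : Complex.exp (z + a) = Complex.exp (-(z + a)) := by
    have : (Complex.exp (z + a) - Complex.exp (-(z + a))) / 2 = 0 := hz
    linear_combination 2 * this
  obtain ⟨n, hn⟩ := Complex.exp_eq_exp_iff_exists_int.mp h
  exact ⟨n, by linear_combination (-1 / 2) * hn⟩

theorem countable_sinh_sub_eq_zero (a : ℂ) : {z : ℂ | Complex.sinh (z - a) = 0}.Countable := by
  simpa only [sub_eq_add_neg] using countable_sinh_add_eq_zero (-a)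

theorem countable_exp_eq (c : ℂ) : {z : ℂ | Complex.exp z = c}.Countable := by
  rcases Set.eq_empty_or_nonempty {z : ℂ | Complex.exp z = c} with h | ⟨w, hw⟩
  · rw [h]; exact Set.countable_empty
  · refine (Set.countable_range fun n : ℤ => w + (n : ℂ) * (2 * Real.pi * Complex.I)).mono ?_
    intro z hz
    obtain ⟨n, hn⟩ := Complex.exp_eq_exp_iff_exists_int.mp (hz.trans hw.symm)
    exact ⟨n, hn.symm⟩

/-- The complement of a countable set is dense in `ℂ`, so continuity is enough to extend identities
obtained after dividing by factors with countably many zeros. -/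
theorem eq_of_eqOn_compl_countable {E : Type} [TopologicalSpace E] [T2Space E] {f g : ℂ → E}
    (hf : Continuous f) (hg : Continuous g) {s : Set ℂ} (hs : s.Countable)
    (h : ∀ z, z ∉ s → f z = g z) : f = g :=
  Continuous.ext_on (Set.Countable.dense_compl ℝ hs) hf hg h

theorem continuous_rMatrix (η : ℂ) (x y : Fin 2 × Fin 2) : Continuous fun l => rMatrix η l x y := by
  simp only [rMatrix, Matrix.of_apply]
  split_ifs <;> fun_prop

namespace Params

variable {N : ℕ} (p : Params N)

/-- The parameters with other inhomogeneities. -/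
def withXi (ζ : Fin N → ℂ) : Params N := { p with ξ := ζ }

theorem continuous_rSite (n : Fin N) (i j : Fin 2) : Continuous fun l => p.rSite n l i j := by
  refine continuous_matrix fun s t => ?_
  simp only [rSite, siteOp, Matrix.of_apply]
  split_ifs
  · exact continuous_rMatrix _ _ _
  · exact continuous_const

section Continuity

variable {Y : Type} [TopologicalSpace Y] {ζ : Y → Fin N → ℂ} {l t : Y → ℂ} {ψ : Y → Spins N → ℂ}

/-- The inhomogeneities are allowed to vary as well, because `normRatio` is reached by perturbing
one of them. -/
theorem continuous_dress (hζ : Continuous ζ) (hl : Continuous l) (L : List (Fin N)) (i j : Fin 2) :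
    Continuous fun y => (p.withXi (ζ y)).dress L (l y) i j := by
  induction L generalizing i j with
  | nil =>
    refine continuous_matrix fun s t => ?_
    simp only [dress_nil, auxScalar, Matrix.map_apply, Matrix.algebraMap_matrix_apply, kMatrix_shift]
    split_ifs
    · fin_cases i <;> fin_cases j <;> simp [withXi] <;> fun_prop
    · exact continuous_const
  | cons n L ih =>
    simp only [dress_cons, Matrix.mul_apply]
    refine continuous_finsetSum _ fun a _ => Continuous.matrix_mul
      (continuous_finsetSum _ fun b _ => Continuous.matrix_mul ?_ (ih _ _)) ?_
    · exact (p.continuous_rSite n i b).comp (by fun_prop : Continuous fun y => l y - ζ y n)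
    · exact (p.continuous_rSite n a j).comp (by fun_prop : Continuous fun y => l y + ζ y n)

theorem continuous_covec (hζ : Continuous ζ) (hl : Continuous l) (ht : Continuous t)
    (hψ : Continuous ψ) (j : Fin 2) :
    Continuous fun y => covec (p.withXi (ζ y)).bdryX (l y) (t y) (ψ y) j := by
  unfold covec
  have h0 : Continuous fun y => ψ y ᵥ* (p.withXi (ζ y)).bdryX (l y) 0 j :=
    Continuous.matrix_vecMul hψ (p.continuous_dress hζ hl _ 0 j)
  have h1 : Continuous fun y => ψ y ᵥ* (p.withXi (ζ y)).bdryX (l y) 1 j :=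
    Continuous.matrix_vecMul hψ (p.continuous_dress hζ hl _ 1 j)
  fun_prop

theorem continuous_offDiag (hζ : Continuous ζ) (hl : Continuous l) (ht : Continuous t)
    (hψ : Continuous ψ) :
    Continuous fun y => offDiag (p.withXi (ζ y)).bdryX (l y) (t y) (ψ y) := by
  unfold offDiag
  have h0 := p.continuous_covec hζ hl ht hψ 0
  have h1 := p.continuous_covec hζ hl ht hψ 1
  fun_prop

theorem continuous_mixed (hζ : Continuous ζ) (hl : Continuous l) (ht : Continuous t)
    (hψ : Continuous ψ) :
    Continuous fun y => mixed p.η (p.withXi (ζ y)).bdryX (l y) (t y) (ψ y) := by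
  unfold mixed
  have h0 := p.continuous_covec hζ hl ht hψ 0
  have h1 := p.continuous_covec hζ hl ht hψ 1
  fun_prop

end Continuity

/-! ### The rows `braList` and the off-diagonal operator. -/

/-- The rows obtained from the reference row by acting with the diagonal operators attached to the
sites of a list, the last element acting first. -/
def braList (T : ℂ) : List (Fin N) → Spins N → ℂ
  | [] => p.refBraRow T
  | n :: L => covec p.bdryX (-p.ξ n) (T - p.η) (braList T L) 0

theorem continuous_braList {Y : Type} [TopologicalSpace Y] {ζ : Y → Fin N → ℂ} {T : Y → ℂ}
    (hζ : Continuous ζ) (hT : Continuous T) (L : List (Fin N)) :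
    Continuous fun y => (p.withXi (ζ y)).braList (T y) L := by
  induction L with
  | nil =>
    simp only [braList, refBraRow]
    refine continuous_pi fun s => ?_
    simp only [refRow]
    refine continuous_finsetProd _ fun n _ => ?_
    generalize s n = b
    fin_cases b <;> simp [gaugeRow, withXi] <;> fun_prop
  | cons n L ih =>
    simp only [braList]
    exact p.continuous_covec hζ (by simp only [withXi]; fun_prop) (by simp only [withXi]; fun_prop)
      ih 0

/-- The factor of the site `n` in the eigenvalue of the off-diagonal operator. -/
def siteEv (l : ℂ) (n : Fin N) (b : Prop) [Decidable b] : ℂ :=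
  if b then Complex.sinh (l - p.ξ n) * Complex.sinh (l + p.ξ n + p.η)
  else Complex.sinh (l - p.ξ n + p.η) * Complex.sinh (l + p.ξ n)

/-- The eigenvalue of the off-diagonal operator. -/
def braEv (l T : ℂ) (L : List (Fin N)) : ℂ :=
  Complex.sinh (2 * l) * p.kFactor (T + ((N : ℂ) - 1) * p.η) * ∏ n, p.siteEv l n (n ∈ L)

theorem continuous_siteEv (n : Fin N) (b : Prop) [Decidable b] :
    Continuous fun l => p.siteEv l n b := by
  unfold siteEv
  split_ifs <;> fun_prop

theorem continuous_braEv (T : ℂ) (L : List (Fin N)) : Continuous fun l => p.braEv l T L := by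
  unfold braEv
  exact Continuous.mul (by fun_prop) (continuous_finsetProd _ fun n _ => p.continuous_siteEv n _)

/-- Separated inhomogeneities: the non-vanishing conditions in terms of hyperbolic sines. -/
structure SepInhom : Prop where
  sub_ne : ∀ j k, j ≠ k → Complex.sinh (p.ξ j - p.ξ k) ≠ 0
  add_ne : ∀ j k, j ≠ k → Complex.sinh (p.ξ j + p.ξ k) ≠ 0
  sub_eta_ne : ∀ j k, j ≠ k → Complex.sinh (p.ξ j - p.ξ k + p.η) ≠ 0
  add_eta_ne : ∀ j k, j ≠ k → Complex.sinh (p.ξ j + p.ξ k + p.η) ≠ 0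
  neg_eta_ne : ∀ j k, j ≠ k → Complex.sinh (-p.ξ j - p.ξ k + p.η) ≠ 0
  two_ne : ∀ n, Complex.sinh (2 * p.ξ n) ≠ 0
  two_add_ne : ∀ n, Complex.sinh (2 * p.ξ n + p.η) ≠ 0
  two_sub_ne : ∀ n, Complex.sinh (-(2 * p.ξ n) + p.η) ≠ 0
  eta_ne : Complex.sinh p.η ≠ 0

theorem SepInhom.transposed {p : Params N} (h : p.SepInhom) : p.transposed.SepInhom where
  sub_ne j k hjk := by
    have := h.sub_ne k j hjk.symm
    rwa [show p.transposed.ξ j - p.transposed.ξ k = p.ξ k - p.ξ j by simp [Params.transposed]; ring]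
  add_ne j k hjk := by
    have := h.add_ne k j hjk.symm
    rwa [show p.transposed.ξ j + p.transposed.ξ k = -(p.ξ k + p.ξ j) by simp [Params.transposed],
      Complex.sinh_neg, neg_ne_zero]
  sub_eta_ne j k hjk := by
    have := h.sub_eta_ne k j hjk.symm
    rwa [show p.transposed.ξ j - p.transposed.ξ k + p.transposed.η = p.ξ k - p.ξ j + p.η by
      simp [Params.transposed]; ring]
  add_eta_ne j k hjk := by
    have := h.neg_eta_ne j k hjk
    rwa [show p.transposed.ξ j + p.transposed.ξ k + p.transposed.η = -p.ξ j - p.ξ k + p.η by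
      simp [Params.transposed]; ring]
  neg_eta_ne j k hjk := by
    have := h.add_eta_ne j k hjk
    rwa [show -p.transposed.ξ j - p.transposed.ξ k + p.transposed.η = p.ξ j + p.ξ k + p.η by
      simp [Params.transposed]]
  two_ne n := by
    have := h.two_ne n
    rwa [show 2 * p.transposed.ξ n = -(2 * p.ξ n) by simp [Params.transposed],
      Complex.sinh_neg, neg_ne_zero]
  two_add_ne n := by
    have := h.two_sub_ne n
    rwa [show 2 * p.transposed.ξ n + p.transposed.η = -(2 * p.ξ n) + p.η by
      simp [Params.transposed]]
  two_sub_ne n := by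
    have := h.two_add_ne n
    rwa [show -(2 * p.transposed.ξ n) + p.transposed.η = 2 * p.ξ n + p.η by
      simp [Params.transposed]]
  eta_ne := h.eta_ne

variable {p}

theorem braEv_neg_of_notMem {n : Fin N} {L : List (Fin N)} (h : n ∉ L) (T : ℂ) :
    p.braEv (-p.ξ n) T L = 0 := by
  rw [braEv, Finset.prod_eq_zero (Finset.mem_univ n), mul_zero]
  simp [siteEv, h]

theorem braEv_sub_of_notMem {n : Fin N} {L : List (Fin N)} (h : n ∉ L) (T : ℂ) :
    p.braEv (p.ξ n - p.η) T L = 0 := by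
  rw [braEv, Finset.prod_eq_zero (Finset.mem_univ n), mul_zero]
  simp [siteEv, h]

theorem braEv_of_mem {n : Fin N} {L : List (Fin N)} (h : n ∈ L) (T : ℂ) :
    p.braEv (p.ξ n) T L = 0 := by
  rw [braEv, Finset.prod_eq_zero (Finset.mem_univ n), mul_zero]
  simp [siteEv, h]

/-- The off-diagonal operator acts on the rows `braList` by a shift of the gauge parameter. -/
theorem offDiag_braList {L : List (Fin N)} (hL : L.Nodup) (l T : ℂ) :
    offDiag p.bdryX l (T - p.η) (p.braList T L) = p.braEv l T L • p.braList (T - 2 * p.η) L := by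
  induction L generalizing l T with
  | nil =>
    simp only [braList, offDiag_refBraRow, braEv, siteEv, List.not_mem_nil, if_false]
  | cons n L ih =>
    rw [List.nodup_cons] at hL
    have h0 : offDiag p.bdryX (-p.ξ n) (T - p.η) (p.braList T L) = 0 := by
      rw [ih hL.2, braEv_neg_of_notMem hL.1, zero_smul]
    -- At `m = -ξ_n` the exchange coefficients are exactly the two cases of `siteEv` at the site
    -- `n`, so adding `n` to the list swaps one factor for the other. The zeros of the old factor
    -- are the points recovered by continuity.
    have key := fun l => p.reflectionEq_bdryX.offDiag_covec (l := l) h0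
    refine congrFun (eq_of_eqOn_compl_countable
      (f := fun l => offDiag p.bdryX l (T - p.η) (p.braList T (n :: L)))
      (g := fun l => p.braEv l T (n :: L) • p.braList (T - 2 * p.η) (n :: L)) ?_ ?_
      ((countable_sinh_sub_eq_zero (p.ξ n - p.η)).union (countable_sinh_add_eq_zero (p.ξ n))) ?_) l
    · exact p.continuous_offDiag (ζ := fun _ => p.ξ) continuous_const continuous_id continuous_const
        continuous_const
    · exact (p.continuous_braEv T _).smul continuous_const
    · intro l hl
      simp only [Set.mem_union, Set.mem_ofPred_eq, not_or] at hl
      have hk := key l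
      rw [show l + -p.ξ n + p.η = l - (p.ξ n - p.η) by ring, sub_neg_eq_add, ← sub_eq_add_neg,
        ih hL.2, covec_smul, show T - p.η - 2 * p.η = T - 2 * p.η - p.η by ring, smul_smul] at hk
      refine smul_right_injective _ (mul_ne_zero hl.1 hl.2) (hk.trans ?_)
      simp only [braList, smul_smul]
      congr 1
      have e1 : ∏ k ∈ Finset.univ.erase n, p.siteEv l k (k ∈ n :: L) =
          ∏ k ∈ Finset.univ.erase n, p.siteEv l k (k ∈ L) := by
        refine Finset.prod_congr rfl fun k hk => ?_
        simp [siteEv, Finset.ne_of_mem_erase hk]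
      rw [braEv, braEv, ← Finset.mul_prod_erase _ _ (Finset.mem_univ n),
        ← Finset.mul_prod_erase _ (fun k => p.siteEv l k (k ∈ n :: L)) (Finset.mem_univ n), e1]
      simp only [siteEv, hL.1, List.mem_cons, true_or, if_true, if_false]
      rw [show l - (p.ξ n - p.η) = l - p.ξ n + p.η by ring]
      ring

theorem offDiag_neg_braList {n : Fin N} {L : List (Fin N)} (hL : L.Nodup) (h : n ∉ L) (T : ℂ) :
    offDiag p.bdryX (-p.ξ n) (T - p.η) (p.braList T L) = 0 := by
  rw [offDiag_braList hL, braEv_neg_of_notMem h, zero_smul]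

/-- The rows `braList` do not depend on the order of the list. -/
theorem braList_perm (hp : p.SepInhom) {L L' : List (Fin N)} (h : L.Perm L') (hL : L.Nodup) (T : ℂ) :
    p.braList T L = p.braList T L' := by
  induction h with
  | nil => rfl
  | cons x _ ih =>
    rw [List.nodup_cons] at hL
    simp only [braList, ih hL.2]
  | swap x y L =>
    simp only [List.nodup_cons, List.mem_cons, not_or] at hL
    obtain ⟨⟨hyx, hy⟩, hx, hL⟩ := hL
    refine p.reflectionEq_bdryX.covec_comm (offDiag_neg_braList hL hx T)
      (offDiag_neg_braList hL hy T) ?_ ?_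
    · have := hp.sub_eta_ne x y (Ne.symm hyx)
      rwa [show -p.ξ y - -p.ξ x + p.η = p.ξ x - p.ξ y + p.η by ring]
    · have := hp.neg_eta_ne y x hyx
      rwa [← sub_eq_add_neg]
  | trans h1 _ ih1 ih2 => exact (ih1 hL).trans (ih2 (h1.nodup_iff.mp hL))

/-- The diagonal operator at `ξ_n - η` commutes past those at `-ξ_k` down to the reference row,
where it vanishes. The other component follows because the off-diagonal operator vanishes as well.
-/
theorem covec_braList_eq_zero (hp : p.SepInhom) {n : Fin N} {L : List (Fin N)} (hL : L.Nodup)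
    (h : n ∉ L) (T : ℂ) (j : Fin 2) :
    covec p.bdryX (p.ξ n - p.η) (T - p.η) (p.braList T L) j = 0 := by
  induction L generalizing j with
  | nil => exact p.covec_refBraRow_eq_zero T n j
  | cons k L ih =>
    have hB : offDiag p.bdryX (p.ξ n - p.η) (T - p.η) (p.braList T (k :: L)) = 0 := by
      rw [offDiag_braList hL, braEv_sub_of_notMem h, zero_smul]
    rw [List.nodup_cons] at hL
    simp only [List.mem_cons, not_or] at h
    have hA : covec p.bdryX (p.ξ n - p.η) (T - p.η) (p.braList T (k :: L)) 0 = 0 := by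
      have hl : offDiag p.bdryX (p.ξ n - p.η) (T - p.η) (p.braList T L) = 0 := by
        rw [offDiag_braList hL.2, braEv_sub_of_notMem h.2, zero_smul]
      have := p.reflectionEq_bdryX.covec_comm (offDiag_neg_braList hL.2 hL.1 T) hl ?_ ?_
      · rw [braList, this, ih hL.2 h.2]
        simp [covec]
      · have := hp.add_ne n k h.1
        rwa [show p.ξ n - p.η - -p.ξ k + p.η = p.ξ n + p.ξ k by ring]
      · have := hp.sub_ne n k h.1
        rwa [show p.ξ n - p.η + -p.ξ k + p.η = p.ξ n - p.ξ k by ring]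
    fin_cases j
    · exact hA
    · rw [show ((fun i => i) ⟨1, by norm_num⟩ : Fin 2) = 1 from rfl, covec_one_of_offDiag_eq_zero hB,
        hA, smul_zero, neg_zero]

end Params

/-! ### Pairing with the transposed chain: orthogonality and ratios of norms. -/

namespace Params

variable {N : ℕ} (p : Params N)

theorem transposed_bdryX (l : ℂ) (i j : Fin 2) :
    p.transposed.bdryX l i j = (p.bdryX l j i)ᵀ := by
  rw [bdryX, transposed_dress]
  rfl

theorem vecMul_transposed_bdryX (l : ℂ) (i j : Fin 2) (k : Spins N → ℂ) :
    k ᵥ* p.transposed.bdryX l i j = p.bdryX l j i *ᵥ k := by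
  rw [transposed_bdryX, Matrix.vecMul_transpose]

/-- The off-diagonal operators of a chain and of the transposed chain are transposes of each other,
up to a factor. -/
theorem offDiag_dotProduct (l t : ℂ) (ψ k : Spins N → ℂ) :
    offDiag p.bdryX l t ψ ⬝ᵥ k = -Complex.exp (2 * t) *
      (ψ ⬝ᵥ offDiag p.transposed.bdryX l (Real.pi * Complex.I - t) k) := by
  have hx : Complex.exp l ≠ 0 := Complex.exp_ne_zero _
  have ht : Complex.exp t ≠ 0 := Complex.exp_ne_zero _
  simp only [offDiag, covec, vecMul_transposed_bdryX, add_dotProduct, sub_dotProduct,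
    smul_dotProduct, dotProduct_add, dotProduct_sub, dotProduct_smul, Matrix.dotProduct_mulVec,
    smul_eq_mul]
  rw [show l + (Real.pi * Complex.I - t) = l - t + Real.pi * Complex.I by ring,
    show Real.pi * Complex.I - t - l = -(t + l) + Real.pi * Complex.I by ring,
    Complex.exp_add_pi_mul_I, Complex.exp_add_pi_mul_I]
  simp only [two_mul, Complex.exp_add, Complex.exp_sub, Complex.exp_neg]
  field_simp
  ring

/-- Together with `mixed_of_offDiag_eq_zero`, this shows that `mixed` reduces to a diagonal operator
on either side, provided that the off-diagonal operator vanishes there. -/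
theorem mixed_dotProduct (l t : ℂ) (ψ k : Spins N → ℂ)
    (h : offDiag p.transposed.bdryX l (Real.pi * Complex.I - (t + 2 * p.η)) k = 0) :
    mixed p.η p.bdryX l t ψ ⬝ᵥ k = Complex.exp (l + t + p.η) * (2 * Complex.sinh p.η) *
      (ψ ⬝ᵥ covec p.transposed.bdryX l (Real.pi * Complex.I - (t + 2 * p.η)) k 0) := by
  have hx : Complex.exp l ≠ 0 := Complex.exp_ne_zero _
  have ht : Complex.exp t ≠ 0 := Complex.exp_ne_zero _
  have hz : Complex.exp p.η ≠ 0 := Complex.exp_ne_zero _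
  have h1 := congrArg (fun v => ψ ⬝ᵥ v) (covec_one_of_offDiag_eq_zero h)
  simp only [mixed, covec, vecMul_transposed_bdryX, add_dotProduct, sub_dotProduct,
    smul_dotProduct, dotProduct_sub, dotProduct_smul, Matrix.dotProduct_mulVec,
    smul_eq_mul, dotProduct_neg] at h1 ⊢
  rw [show l + (Real.pi * Complex.I - (t + 2 * p.η)) = l - t - 2 * p.η + Real.pi * Complex.I by ring,
    show Real.pi * Complex.I - (t + 2 * p.η) - l = -(t + 2 * p.η + l) + Real.pi * Complex.I by ring,
    Complex.exp_add_pi_mul_I, Complex.exp_add_pi_mul_I] at h1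
  rw [show Real.pi * Complex.I - (t + 2 * p.η) - l = -(t + 2 * p.η + l) + Real.pi * Complex.I by ring,
    Complex.exp_add_pi_mul_I]
  simp only [sinh_exp_form, two_mul, Complex.exp_add, Complex.exp_sub, Complex.exp_neg] at h1 ⊢
  field_simp at h1 ⊢
  linear_combination (-2) * h1

theorem mixed_of_offDiag_eq_zero {l t : ℂ} {ψ : Spins N → ℂ} (h : offDiag p.bdryX l t ψ = 0) :
    mixed p.η p.bdryX l t ψ = (Complex.exp (l + t + p.η) * (2 * Complex.sinh p.η)) •
      covec p.bdryX l t ψ 0 := by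
  have hz : Complex.exp p.η ≠ 0 := Complex.exp_ne_zero _
  rw [mixed, covec_one_of_offDiag_eq_zero h, ← neg_smul, ← add_smul]
  congr 1
  simp only [sinh_exp_form, two_mul, Complex.exp_add]
  field_simp
  ring

variable {p}

theorem braEv_neg_ne_zero (hp : p.SepInhom) {n : Fin N} {L : List (Fin N)} (h : n ∈ L) {T : ℂ}
    (hk : p.kFactor (T + ((N : ℂ) - 1) * p.η) ≠ 0) : p.braEv (-p.ξ n) T L ≠ 0 := by
  have h2 : Complex.sinh (2 * -p.ξ n) ≠ 0 := by
    have := hp.two_ne n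
    rwa [show 2 * -p.ξ n = -(2 * p.ξ n) by ring, Complex.sinh_neg, neg_ne_zero]
  refine mul_ne_zero (mul_ne_zero h2 hk) (Finset.prod_ne_zero_iff.mpr fun k _ => ?_)
  rcases eq_or_ne n k with rfl | hnk
  · simp only [siteEv, h, if_true]
    refine mul_ne_zero ?_ ?_
    · rwa [show -p.ξ n - p.ξ n = 2 * -p.ξ n by ring]
    · rw [neg_add_cancel, zero_add]; exact hp.eta_ne
  · have h3 := hp.add_ne n k hnk
    have h4 := hp.sub_eta_ne k n hnk.symm
    have h5 := hp.neg_eta_ne n k hnk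
    have h6 := hp.sub_ne k n hnk.symm
    rw [siteEv]
    split_ifs
    · refine mul_ne_zero ?_ ?_
      · rwa [show -p.ξ n - p.ξ k = -(p.ξ n + p.ξ k) by ring, Complex.sinh_neg, neg_ne_zero]
      · rwa [show -p.ξ n + p.ξ k + p.η = p.ξ k - p.ξ n + p.η by ring]
    · refine mul_ne_zero h5 ?_
      rwa [show -p.ξ n + p.ξ k = p.ξ k - p.ξ n by ring]

theorem braEv_ne_zero (hp : p.SepInhom) {n : Fin N} {L : List (Fin N)} (h : n ∉ L) {T : ℂ}
    (hk : p.kFactor (T + ((N : ℂ) - 1) * p.η) ≠ 0) : p.braEv (p.ξ n) T L ≠ 0 := by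
  refine mul_ne_zero (mul_ne_zero (hp.two_ne n) hk) (Finset.prod_ne_zero_iff.mpr fun k _ => ?_)
  rcases eq_or_ne n k with rfl | hnk
  · simp only [siteEv, h, if_false]
    refine mul_ne_zero ?_ ?_
    · rw [sub_self, zero_add]; exact hp.eta_ne
    · rw [← two_mul]; exact hp.two_ne n
  · rw [siteEv]
    split_ifs
    · exact mul_ne_zero (hp.sub_ne n k hnk) (hp.add_eta_ne n k hnk)
    · exact mul_ne_zero (hp.sub_eta_ne n k hnk) (hp.add_ne n k hnk)

theorem braEv_sub_ne_zero (hp : p.SepInhom) {n : Fin N} {L : List (Fin N)} (h : n ∉ L) {T : ℂ}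
    (hk : p.kFactor (T + ((N : ℂ) - 1) * p.η) ≠ 0) (h2 : Complex.sinh (2 * (p.ξ n + p.η)) ≠ 0) :
    p.braEv (-p.ξ n - p.η) T L ≠ 0 := by
  refine mul_ne_zero (mul_ne_zero ?_ hk) (Finset.prod_ne_zero_iff.mpr fun k _ => ?_)
  · rwa [show 2 * (-p.ξ n - p.η) = -(2 * (p.ξ n + p.η)) by ring, Complex.sinh_neg, neg_ne_zero]
  rcases eq_or_ne n k with rfl | hnk
  · simp only [siteEv, h, if_false]
    refine mul_ne_zero ?_ ?_
    · rw [show -p.ξ n - p.η - p.ξ n + p.η = -(2 * p.ξ n) by ring, Complex.sinh_neg, neg_ne_zero]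
      exact hp.two_ne n
    · rw [show -p.ξ n - p.η + p.ξ n = -p.η by ring, Complex.sinh_neg, neg_ne_zero]
      exact hp.eta_ne
  · rw [siteEv]
    split_ifs
    · refine mul_ne_zero ?_ ?_
      · rw [show -p.ξ n - p.η - p.ξ k = -(p.ξ n + p.ξ k + p.η) by ring, Complex.sinh_neg, neg_ne_zero]
        exact hp.add_eta_ne n k hnk
      · rw [show -p.ξ n - p.η + p.ξ k + p.η = p.ξ k - p.ξ n by ring]
        exact hp.sub_ne k n hnk.symm
    · refine mul_ne_zero ?_ ?_
      · rw [show -p.ξ n - p.η - p.ξ k + p.η = -(p.ξ n + p.ξ k) by ring, Complex.sinh_neg, neg_ne_zero]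
        exact hp.add_ne n k hnk
      · rw [show -p.ξ n - p.η + p.ξ k = -(p.ξ n - p.ξ k + p.η) by ring, Complex.sinh_neg, neg_ne_zero]
        exact hp.sub_eta_ne n k hnk

/-- Up to a non-zero scalar the boundary factor is a polynomial in `exp t` with non-zero constant
term; each of its finitely many roots has countably many logarithms. -/
theorem countable_kFactor_eq_zero (hκ : p.κm ≠ 0) (hς : Complex.sinh p.ςm ≠ 0) :
    {t : ℂ | p.kFactor t = 0}.Countable := by
  open Polynomial in
  let P : Polynomial ℂ := C (p.κm * Complex.exp p.τm) + C (Complex.exp p.ςm) * X -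
    C (p.κm * Complex.exp (-p.τm)) * X ^ 2
  have hP : P ≠ 0 := by
    intro h
    have := congrArg (fun Q => Q.coeff 0) h
    simp [P, hκ] at this
  have hfin := Polynomial.finite_setOfPred_isRoot hP
  refine (hfin.countable.biUnion fun r _ => countable_exp_eq r).mono ?_
  intro t ht
  simp only [Set.mem_iUnion]
  refine ⟨Complex.exp t, ?_, rfl⟩
  have h1 : (Complex.sinh p.ςm)⁻¹ ≠ 0 := inv_ne_zero hς
  have h2 := (mul_eq_zero.mp (show p.kFactor t = 0 from ht)).resolve_left h1
  simp only [Polynomial.IsRoot, P]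
  show Polynomial.eval (Complex.exp t) P = 0
  simp only [P, Polynomial.eval_sub, Polynomial.eval_add, Polynomial.eval_mul, Polynomial.eval_C,
    Polynomial.eval_X, Polynomial.eval_pow]
  rw [← h2, Complex.exp_add, sub_eq_add_neg (2 * t), Complex.exp_add, two_mul, Complex.exp_add]
  ring

variable (p) in
/-- The pairing of the rows `braList` with the corresponding columns of the transposed chain. -/
def pairing (T : ℂ) (L K : List (Fin N)) : ℂ :=
  p.braList T L ⬝ᵥ p.transposed.braList (Real.pi * Complex.I - T) K

theorem continuous_dotProduct {Y : Type} [TopologicalSpace Y] {f g : Y → Spins N → ℂ}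
    (hf : Continuous f) (hg : Continuous g) : Continuous fun y => f y ⬝ᵥ g y := by
  simp only [dotProduct]
  fun_prop

variable (p) in
theorem continuous_pairing {Y : Type} [TopologicalSpace Y] {ζ : Y → Fin N → ℂ} {T : Y → ℂ}
    (hζ : Continuous ζ) (hT : Continuous T) (L K : List (Fin N)) :
    Continuous fun y => (p.withXi (ζ y)).pairing (T y) L K := by
  refine continuous_dotProduct (p.continuous_braList hζ hT L) ?_
  exact p.transposed.continuous_braList (ζ := fun y n => -ζ y n) (by fun_prop) (by fun_prop) K

/-- The column starts at parameter `πi - T + 2η` so that the shift by `-2η` lands on `πi - T`, the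
parameter used in `pairing`. -/
theorem offDiag_pair {K : List (Fin N)} (hK : K.Nodup) (l T : ℂ) (ψ : Spins N → ℂ) :
    offDiag p.bdryX l (T - p.η) ψ ⬝ᵥ
      p.transposed.braList (Real.pi * Complex.I - T + 2 * p.η) K =
      -Complex.exp (2 * (T - p.η)) *
        (p.transposed.braEv l (Real.pi * Complex.I - T + 2 * p.η) K *
          (ψ ⬝ᵥ p.transposed.braList (Real.pi * Complex.I - T) K)) := by
  have := offDiag_braList (p := p.transposed) hK l (Real.pi * Complex.I - T + 2 * p.η)
  rw [show Real.pi * Complex.I - T + 2 * p.η - p.transposed.η = Real.pi * Complex.I - (T - p.η) by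
    simp only [transposed]; ring, show Real.pi * Complex.I - T + 2 * p.η - 2 * p.transposed.η =
    Real.pi * Complex.I - T by simp only [transposed]; ring] at this
  rw [offDiag_dotProduct, this, dotProduct_smul, smul_eq_mul]

theorem countable_transposed_kFactor (hκ : p.κm ≠ 0) (hς : Complex.sinh p.ςm ≠ 0) (c : ℂ) :
    {T : ℂ | p.transposed.kFactor (Real.pi * Complex.I - T + 2 * p.η + c) = 0}.Countable := by
  have h := countable_kFactor_eq_zero (p := p.transposed) hκ hς
  refine h.preimage (f := fun T => Real.pi * Complex.I - T + 2 * p.η + c) ?_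
  intro a b hab
  simpa using hab

/-- Orthogonality. -/
theorem pairing_eq_zero (hp : p.SepInhom) (hκ : p.κm ≠ 0) (hς : Complex.sinh p.ςm ≠ 0)
    {L K : List (Fin N)} (hL : L.Nodup) (hK : K.Nodup) {n : Fin N} (h : n ∈ L ↔ n ∈ K) (T : ℂ) :
    p.pairing T L K = 0 := by
  refine congrFun (eq_of_eqOn_compl_countable (f := fun T => p.pairing T L K) (g := fun _ => 0)
    (p.continuous_pairing (ζ := fun _ => p.ξ) continuous_const continuous_id L K)
    continuous_const (countable_transposed_kFactor hκ hς (((N : ℂ) - 1) * p.η)) ?_) T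
  intro T hT
  -- The off-diagonal operator is inserted at `ξ_n` if `n` belongs to both lists and at `-ξ_n` if it
  -- belongs to neither. In both cases its multiplier vanishes on the row but not on the column.
  by_cases hn : n ∈ L
  · have h1 := offDiag_pair (p := p) hK (p.ξ n) T (p.braList T L)
    rw [offDiag_braList hL, braEv_of_mem hn, zero_smul, zero_dotProduct] at h1
    have h2 := braEv_neg_ne_zero hp.transposed (h.mp hn) hT
    rw [show -p.transposed.ξ n = p.ξ n from neg_neg _] at h2
    have h3 := (mul_eq_zero.mp h1.symm).resolve_left (neg_ne_zero.mpr (Complex.exp_ne_zero _))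
    exact (mul_eq_zero.mp h3).resolve_left h2
  · have h1 := offDiag_pair (p := p) hK (-p.ξ n) T (p.braList T L)
    rw [offDiag_braList hL, braEv_neg_of_notMem hn, zero_smul, zero_dotProduct] at h1
    have h2 := braEv_ne_zero hp.transposed (fun h' => hn (h.mpr h')) hT
    have h3 := (mul_eq_zero.mp h1.symm).resolve_left (neg_ne_zero.mpr (Complex.exp_ne_zero _))
    exact (mul_eq_zero.mp h3).resolve_left h2

variable (p) in
/-- The product of the factors `siteEv` over the sites other than `n`. -/
def restEv (n : Fin N) (L : List (Fin N)) (l : ℂ) : ℂ :=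
  ∏ k ∈ Finset.univ.erase n, p.siteEv l k (k ∈ L)

variable (p) in
/-- The relation between the norms of two rows that differ at the site `n`. -/
def NormRatio (n : Fin N) (L K : List (Fin N)) (T : ℂ) : Prop :=
  Complex.exp (p.ξ n) * Complex.sinh (2 * p.ξ n - p.η) * p.restEv n L (-p.ξ n) *
      p.pairing T L (n :: K) =
    Complex.exp (-p.ξ n) * Complex.sinh (2 * p.ξ n + p.η) * p.restEv n L (p.ξ n) *
      p.pairing T (n :: L) K

theorem normRatio_of_generic (hp : p.SepInhom) {n : Fin N} {L K : List (Fin N)} (hL : L.Nodup)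
    (hK : K.Nodup) (hnL : n ∉ L) (hnK : n ∉ K) {T : ℂ}
    (hT : p.transposed.kFactor (Real.pi * Complex.I - T + 2 * p.η + ((N : ℂ) - 1) * p.η) ≠ 0)
    (h2 : Complex.sinh (2 * (p.ξ n - p.η)) ≠ 0) : p.NormRatio n L K T := by
  set k := p.transposed.braList (Real.pi * Complex.I - T) K with hk
  set ψ := p.braList T L with hψ
  set G := p.braList (T - 2 * p.η) L ⬝ᵥ k with hG
  set κ := p.kFactor (T + ((N : ℂ) - 1) * p.η) with hκ
  have hev : p.transposed.braEv (p.ξ n - p.η) (Real.pi * Complex.I - T + 2 * p.η) K ≠ 0 := by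
    have := braEv_sub_ne_zero hp.transposed hnK hT (by
      rw [show 2 * (p.transposed.ξ n + p.transposed.η) = -(2 * (p.ξ n - p.η)) by
        simp only [transposed]; ring, Complex.sinh_neg, neg_ne_zero]
      exact h2)
    rwa [show -p.transposed.ξ n - p.transposed.η = p.ξ n - p.η by simp [transposed]] at this
  -- Paired with the shifted column, the off-diagonal operator at `ξ_n - η` acts as a non-zero
  -- scalar, so it can be stripped from the relation `ReflectionEq.offDiag_mixed`.
  have hcancel : ∀ χ χ' : Spins N → ℂ, offDiag p.bdryX (p.ξ n - p.η) (T - p.η) χ =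
      offDiag p.bdryX (p.ξ n - p.η) (T - p.η) χ' → χ ⬝ᵥ k = χ' ⬝ᵥ k := by
    intro χ χ' h
    have h3 := congrArg (fun v => v ⬝ᵥ
      p.transposed.braList (Real.pi * Complex.I - T + 2 * p.η) K) h
    simp only [offDiag_pair hK] at h3
    exact mul_left_cancel₀ hev (mul_left_cancel₀ (neg_ne_zero.mpr (Complex.exp_ne_zero _)) h3)
  have h0 : ∀ j, covec p.bdryX (p.ξ n - p.η) (T - p.η) ψ j = 0 :=
    covec_braList_eq_zero hp hL hnL T
  have hE1 : ∀ m, Complex.sinh (p.ξ n - m) ≠ 0 →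
      Complex.sinh (m + p.ξ n) * (mixed p.η p.bdryX m (T - p.η) ψ ⬝ᵥ k) =
        Complex.exp p.η * Complex.sinh (m + p.ξ n + p.η) * (p.braEv m T L * G) := by
    intro m hm
    have h1 := p.reflectionEq_bdryX.offDiag_mixed (m := m) h0 (by
      intro j
      rw [offDiag_braList hL, covec_smul,
        show T - p.η - 2 * p.η = T - 2 * p.η - p.η by ring, covec_braList_eq_zero hp hL hnL,
        smul_zero]) (by rwa [show p.ξ n - p.η - m + p.η = p.ξ n - m by ring])
    rw [← offDiag_smul, ← offDiag_smul] at h1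
    have h4 := hcancel _ _ h1
    rw [offDiag_braList hL, smul_dotProduct, smul_dotProduct, smul_dotProduct] at h4
    simp only [smul_eq_mul] at h4
    rw [show p.ξ n - p.η + m + p.η = m + p.ξ n by ring,
      show p.ξ n - p.η + m + 2 * p.η = m + p.ξ n + p.η by ring] at h4
    exact h4
  -- The factor `sinh (m + ξ_n)` cancels on both sides. Continuity is essential here: `m = ξ_n` and
  -- `m = -ξ_n`, the two values needed below, both lie in the excluded set.
  have hE : ∀ m, mixed p.η p.bdryX m (T - p.η) ψ ⬝ᵥ k = Complex.exp p.η *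
      Complex.sinh (m + p.ξ n + p.η) * (Complex.sinh (2 * m) * κ *
        (Complex.sinh (m - p.ξ n + p.η) * p.restEv n L m) * G) := by
    refine fun m => congrFun (eq_of_eqOn_compl_countable
      (f := fun m => mixed p.η p.bdryX m (T - p.η) ψ ⬝ᵥ k)
      (g := fun m => Complex.exp p.η *
        Complex.sinh (m + p.ξ n + p.η) * (Complex.sinh (2 * m) * κ *
        (Complex.sinh (m - p.ξ n + p.η) * p.restEv n L m) * G)) ?_ ?_
      ((countable_sinh_sub_eq_zero (p.ξ n)).union (countable_sinh_add_eq_zero (p.ξ n))) ?_) m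
    · exact continuous_dotProduct (p.continuous_mixed (ζ := fun _ => p.ξ) continuous_const
        continuous_id continuous_const continuous_const) continuous_const
    · have : Continuous fun m => p.restEv n L m :=
        continuous_finsetProd _ fun k _ => p.continuous_siteEv k _
      fun_prop
    · intro m hm
      simp only [Set.mem_union, Set.mem_ofPred_eq, not_or] at hm
      have h5 := hE1 m (by
        rw [show p.ξ n - m = -(m - p.ξ n) by ring, Complex.sinh_neg, neg_ne_zero]; exact hm.1)
      refine mul_left_cancel₀ hm.2 (h5.trans ?_)
      rw [braEv, ← Finset.mul_prod_erase _ _ (Finset.mem_univ n), ← restEv, ← hκ]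
      simp only [siteEv, hnL, if_false]
      ring
  have hF1 : mixed p.η p.bdryX (p.ξ n) (T - p.η) ψ ⬝ᵥ k =
      Complex.exp (p.ξ n + (T - p.η) + p.η) * (2 * Complex.sinh p.η) * p.pairing T L (n :: K) := by
    have e : Real.pi * Complex.I - (T - p.η + 2 * p.η) =
      Real.pi * Complex.I - T - p.transposed.η := by simp only [transposed]; ring
    have hz := offDiag_neg_braList (p := p.transposed) hK hnK (Real.pi * Complex.I - T)
    rw [show -p.transposed.ξ n = p.ξ n from neg_neg _] at hz
    rw [mixed_dotProduct, e]
    · rw [pairing, braList, show -p.transposed.ξ n = p.ξ n from neg_neg _]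
    · rw [e]; exact hz
  have hF0 : mixed p.η p.bdryX (-p.ξ n) (T - p.η) ψ ⬝ᵥ k =
      Complex.exp (-p.ξ n + (T - p.η) + p.η) * (2 * Complex.sinh p.η) * p.pairing T (n :: L) K := by
    rw [mixed_of_offDiag_eq_zero p (offDiag_neg_braList hL hnL T), smul_dotProduct, smul_eq_mul,
      pairing, braList]
  rw [hE] at hF1 hF0
  have hη := hp.eta_ne
  have hT0 : Complex.exp T ≠ 0 := Complex.exp_ne_zero _
  rw [show p.ξ n + (T - p.η) + p.η = T + p.ξ n by ring, Complex.exp_add] at hF1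
  rw [show -p.ξ n + (T - p.η) + p.η = T + -p.ξ n by ring, Complex.exp_add] at hF0
  rw [show p.ξ n + p.ξ n + p.η = 2 * p.ξ n + p.η by ring, sub_self, zero_add] at hF1
  rw [show -p.ξ n + p.ξ n + p.η = p.η by ring, show 2 * -p.ξ n = -(2 * p.ξ n) by ring,
    show -p.ξ n - p.ξ n + p.η = -(2 * p.ξ n - p.η) by ring, Complex.sinh_neg, Complex.sinh_neg] at hF0
  rw [NormRatio]
  have h2 : (2 * Complex.sinh p.η * Complex.exp T) ≠ 0 :=
    mul_ne_zero (mul_ne_zero two_ne_zero hη) hT0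
  refine mul_left_cancel₀ h2 ?_
  -- The unknown `G` and the boundary factor `κ` enter both evaluations in the same way and drop out
  -- of this combination.
  linear_combination (-Complex.sinh (2 * p.ξ n - p.η) * p.restEv n L (-p.ξ n)) * hF1 +
    (Complex.sinh (2 * p.ξ n + p.η) * p.restEv n L (p.ξ n)) * hF0

end Params

/-! ### Removal of the genericity conditions, and completeness of the rows. -/

namespace Params

variable {N : ℕ} {p : Params N}

theorem normRatio_of_sinh_ne (hp : p.SepInhom) (hκ : p.κm ≠ 0) (hς : Complex.sinh p.ςm ≠ 0)
    {n : Fin N} {L K : List (Fin N)} (hL : L.Nodup) (hK : K.Nodup) (hnL : n ∉ L) (hnK : n ∉ K)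
    (h2 : Complex.sinh (2 * (p.ξ n - p.η)) ≠ 0) (T : ℂ) : p.NormRatio n L K T := by
  refine congrFun (eq_of_eqOn_compl_countable
    (f := fun T => Complex.exp (p.ξ n) * Complex.sinh (2 * p.ξ n - p.η) * p.restEv n L (-p.ξ n) *
      p.pairing T L (n :: K))
    (g := fun T => Complex.exp (-p.ξ n) * Complex.sinh (2 * p.ξ n + p.η) * p.restEv n L (p.ξ n) *
      p.pairing T (n :: L) K) ?_ ?_
    (countable_transposed_kFactor hκ hς (((N : ℂ) - 1) * p.η)) ?_) T
  · exact continuous_const.mul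
      (p.continuous_pairing (ζ := fun _ => p.ξ) continuous_const continuous_id _ _)
  · exact continuous_const.mul
      (p.continuous_pairing (ζ := fun _ => p.ξ) continuous_const continuous_id _ _)
  · exact fun T hT => normRatio_of_generic hp hL hK hnL hnK hT h2

theorem SepInhom.eventually (hp : p.SepInhom) (n : Fin N) :
    ∀ᶠ z in nhds (p.ξ n), (p.withXi (Function.update p.ξ n z)).SepInhom := by
  have key : ∀ f : (Fin N → ℂ) → ℂ, Continuous f → f p.ξ ≠ 0 →
      ∀ᶠ z in nhds (p.ξ n), f (Function.update p.ξ n z) ≠ 0 := by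
    intro f hf h0
    have hc : Continuous fun z => f (Function.update p.ξ n z) :=
      hf.comp (continuous_const.update n continuous_id)
    refine hc.continuousAt.eventually_ne ?_
    rwa [Function.update_eq_self]
  have key2 : ∀ f : Fin N → Fin N → (Fin N → ℂ) → ℂ, (∀ j k, Continuous (f j k)) →
      (∀ j k, j ≠ k → f j k p.ξ ≠ 0) →
      ∀ᶠ z in nhds (p.ξ n), ∀ j k, j ≠ k → f j k (Function.update p.ξ n z) ≠ 0 := by
    intro f hf h0
    refine Filter.eventually_all.mpr fun j => Filter.eventually_all.mpr fun k => ?_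
    by_cases hjk : j = k
    · exact Filter.Eventually.of_forall fun z h => absurd hjk h
    · exact (key _ (hf j k) (h0 j k hjk)).mono fun z hz _ => hz
  have key1 : ∀ f : Fin N → (Fin N → ℂ) → ℂ, (∀ j, Continuous (f j)) → (∀ j, f j p.ξ ≠ 0) →
      ∀ᶠ z in nhds (p.ξ n), ∀ j, f j (Function.update p.ξ n z) ≠ 0 := fun f hf h0 =>
    Filter.eventually_all.mpr fun j => key _ (hf j) (h0 j)
  filter_upwards [
    key2 (fun j k x => Complex.sinh (x j - x k)) (by fun_prop) hp.sub_ne,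
    key2 (fun j k x => Complex.sinh (x j + x k)) (by fun_prop) hp.add_ne,
    key2 (fun j k x => Complex.sinh (x j - x k + p.η)) (by fun_prop) hp.sub_eta_ne,
    key2 (fun j k x => Complex.sinh (x j + x k + p.η)) (by fun_prop) hp.add_eta_ne,
    key2 (fun j k x => Complex.sinh (-x j - x k + p.η)) (by fun_prop) hp.neg_eta_ne,
    key1 (fun j x => Complex.sinh (2 * x j)) (by fun_prop) hp.two_ne,
    key1 (fun j x => Complex.sinh (2 * x j + p.η)) (by fun_prop) hp.two_add_ne,
    key1 (fun j x => Complex.sinh (-(2 * x j) + p.η)) (by fun_prop) hp.two_sub_ne]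
    with z h1 h2 h3 h4 h5 h6 h7 h8
  exact ⟨h1, h2, h3, h4, h5, h6, h7, h8, hp.eta_ne⟩

/-- The condition `sinh (2(ξ_n - η)) ≠ 0` is not among the assumptions. It is removed by moving
`ξ_n` alone: `SepInhom` is an open condition, the bad values are countable, and both sides are
continuous. -/
theorem normRatio (hp : p.SepInhom) (hκ : p.κm ≠ 0) (hς : Complex.sinh p.ςm ≠ 0)
    {n : Fin N} {L K : List (Fin N)} (hL : L.Nodup) (hK : K.Nodup) (hnL : n ∉ L) (hnK : n ∉ K)
    (T : ℂ) : p.NormRatio n L K T := by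
  let q : ℂ → Params N := fun z => p.withXi (Function.update p.ξ n z)
  have hu : Continuous fun z => Function.update p.ξ n z :=
    continuous_const.update n continuous_id
  have hq : q (p.ξ n) = p := by
    simp only [q, Function.update_eq_self]
    rfl
  have hcr : ∀ l : ℂ → ℂ, Continuous l → Continuous fun z => (q z).restEv n L (l z) := by
    intro l hl
    refine continuous_finsetProd _ fun k _ => ?_
    simp only [siteEv, q, withXi]
    split_ifs <;> fun_prop
  have hxi : ∀ z, (q z).ξ n = z := fun z => by simp [q, withXi]
  let f : ℂ → ℂ := fun z => Complex.exp z * Complex.sinh (2 * z - p.η) * (q z).restEv n L (-z) *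
      (q z).pairing T L (n :: K)
  let g : ℂ → ℂ := fun z => Complex.exp (-z) * Complex.sinh (2 * z + p.η) * (q z).restEv n L z *
      (q z).pairing T (n :: L) K
  have hf : Continuous f := by
    have h1 := hcr (fun z => -z) (by fun_prop)
    have h2 : Continuous fun z => (q z).pairing T L (n :: K) :=
      p.continuous_pairing hu continuous_const _ _
    fun_prop
  have hg : Continuous g := by
    have h1 := hcr (fun z => z) (by fun_prop)
    have h2 : Continuous fun z => (q z).pairing T (n :: L) K :=
      p.continuous_pairing hu continuous_const _ _
    fun_prop
  have hfg : ∀ᶠ z in nhds (p.ξ n), Complex.sinh (z - p.η + (z - p.η)) ≠ 0 → f z = g z := by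
    filter_upwards [hp.eventually n] with z hz h2
    have := normRatio_of_sinh_ne hz hκ hς hL hK hnL hnK (by
      rw [show (p.withXi (Function.update p.ξ n z)).ξ n = z from hxi z, two_mul]
      exact h2) T
    simp only [NormRatio] at this
    rw [show (p.withXi (Function.update p.ξ n z)).ξ n = z from hxi z] at this
    exact this
  have hc : {z : ℂ | Complex.sinh (z - p.η + (z - p.η)) = 0}.Countable := by
    have h := (countable_sinh_sub_eq_zero (2 * p.η)).preimage (f := fun z : ℂ => 2 * z)
      (mul_right_injective₀ two_ne_zero)
    refine h.mono fun z hz => ?_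
    simp only [Set.mem_preimage, Set.mem_ofPred_eq] at hz ⊢
    rw [← hz]
    congr 1
    ring
  have hfin : f (p.ξ n) = g (p.ξ n) := by
    by_contra hne
    have h1 : ∀ᶠ z in nhds (p.ξ n), f z ≠ g z :=
      (hf.continuousAt.sub hg.continuousAt).eventually_ne (sub_ne_zero.mpr hne) |>.mono
        fun z hz => sub_ne_zero.mp hz
    obtain ⟨z, hz1, hz2⟩ := (hc.dense_compl ℝ).inter_nhds_nonempty (hfg.and h1)
    exact hz2.2 (hz2.1 hz1)
  simp only [f, g, hq] at hfin
  exact hfin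

/-- If adding `n` gave zero, both components of the covector row at `-ξ_n` would vanish, since the
off-diagonal operator vanishes too. Multiplication by the monodromy matrix at `ξ_n`, an inverse up
to a non-zero scalar, would then annihilate the previous row. -/
theorem braList_ne_zero (hp : p.SepInhom) (hk : ∀ n, p.kNorm (-p.ξ n) ≠ 0) (T : ℂ)
    {L : List (Fin N)} (hL : L.Nodup) : p.braList T L ≠ 0 := by
  induction L with
  | nil => exact p.refBraRow_ne_zero T
  | cons n L ih =>
    rw [List.nodup_cons] at hL
    intro h0
    rw [braList] at h0
    have h1 : covec p.bdryX (-p.ξ n) (T - p.η) (p.braList T L) 1 = 0 := by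
      rw [covec_one_of_offDiag_eq_zero (offDiag_neg_braList hL.2 hL.1 T), h0, smul_zero, neg_zero]
    refine ih hL.2 ?_
    have hm := p.dress_mul_neg (List.finRange N).reverse (-p.ξ n)
    set c := p.kNorm (-p.ξ n) * _ with hc
    have hc0 : c ≠ 0 := by
      refine mul_ne_zero (hk n) (List.prod_ne_zero ?_)
      simp only [List.mem_map, List.mem_reverse, List.mem_finRange, true_and, not_exists]
      intro k
      rcases eq_or_ne n k with rfl | hnk
      · refine mul_ne_zero (mul_ne_zero ?_ ?_) (mul_ne_zero ?_ ?_)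
        · rw [neg_add_cancel, zero_add]; exact hp.eta_ne
        · rw [neg_add_cancel, sub_zero]; exact hp.eta_ne
        · rw [show -p.ξ n - p.ξ n + p.η = -(2 * p.ξ n) + p.η by ring]; exact hp.two_sub_ne n
        · rw [show p.η - (-p.ξ n - p.ξ n) = 2 * p.ξ n + p.η by ring]; exact hp.two_add_ne n
      · refine mul_ne_zero (mul_ne_zero ?_ ?_) (mul_ne_zero ?_ ?_)
        · rw [show -p.ξ n + p.ξ k + p.η = p.ξ k - p.ξ n + p.η by ring]
          exact hp.sub_eta_ne k n hnk.symm
        · rw [show p.η - (-p.ξ n + p.ξ k) = p.ξ n - p.ξ k + p.η by ring]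
          exact hp.sub_eta_ne n k hnk
        · exact hp.neg_eta_ne n k hnk
        · rw [show p.η - (-p.ξ n - p.ξ k) = p.ξ n + p.ξ k + p.η by ring]
          exact hp.add_eta_ne n k hnk
    rw [neg_neg] at hm
    have hm' : p.bdryX (-p.ξ n) * p.bdryX (p.ξ n) = c • (1 : AuxOp N) := hm
    have e : ∑ j, covec p.bdryX (-p.ξ n) (T - p.η) (p.braList T L) j ᵥ* p.bdryX (p.ξ n) j 0 =
        c • p.braList T L := by
      have h00 := congrFun (congrFun hm' 0) 0
      have h10 := congrFun (congrFun hm' 1) 0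
      simp only [Matrix.mul_apply, Matrix.smul_apply, Matrix.one_apply, if_true,
        one_ne_zero, if_false, smul_zero, Fin.sum_univ_two] at h00 h10
      have h00' := congrArg (fun A => p.braList T L ᵥ* A) h00
      have h10' := congrArg (fun A => p.braList T L ᵥ* A) h10
      simp only [Matrix.vecMul_add, Matrix.vecMul_smul, Matrix.vecMul_one, Matrix.vecMul_zero]
        at h00' h10'
      simp only [covec, Fin.sum_univ_two, Matrix.sub_vecMul, Matrix.smul_vecMul,
        Matrix.vecMul_vecMul]
      linear_combination (norm := module) h00' - Complex.exp (T - p.η - -p.ξ n) • h10'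
    rw [Fin.sum_univ_two, h0, h1, Matrix.zero_vecMul, Matrix.zero_vecMul, add_zero] at e
    exact (smul_eq_zero.mp e.symm).resolve_left hc0

variable (p) in
/-- The off-diagonal operator as a linear map on rows. -/
def offDiagLin (l t : ℂ) : (Spins N → ℂ) →ₗ[ℂ] (Spins N → ℂ) where
  toFun := offDiag p.bdryX l t
  map_add' := offDiag_add l t
  map_smul' c := offDiag_smul l t c

theorem exists_iterate_offDiag (T : ℂ) (z : ℕ → ℂ) (M : ℕ) :
    ∃ Φ : (Spins N → ℂ) →ₗ[ℂ] (Spins N → ℂ), ∀ L : List (Fin N), L.Nodup →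
      Φ (p.braList T L) = (∏ i ∈ Finset.range M, p.braEv (z i) (T - 2 * i * p.η) L) •
        p.braList (T - 2 * M * p.η) L := by
  induction M with
  | zero => exact ⟨LinearMap.id, fun L _ => by simp⟩
  | succ M ih =>
    obtain ⟨Φ, hΦ⟩ := ih
    refine ⟨(p.offDiagLin (z M) (T - 2 * M * p.η - p.η)).comp Φ, fun L hL => ?_⟩
    rw [LinearMap.comp_apply, hΦ L hL, map_smul, Finset.prod_range_succ, mul_smul]
    congr 1
    have := offDiag_braList (p := p) hL (z M) (T - 2 * M * p.η)
    rw [show T - 2 * ((M + 1 : ℕ) : ℂ) * p.η = T - 2 * M * p.η - 2 * p.η by push_cast; ring]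
    exact this

theorem linearIndependent_braList (hp : p.SepInhom) (hk : ∀ n, p.kNorm (-p.ξ n) ≠ 0) {T : ℂ}
    (hT : ∀ j : Fin N, p.kFactor (T + ((N : ℂ) - 1 - 2 * (j : ℕ)) * p.η) ≠ 0) :
    LinearIndependent ℂ fun s : Finset (Fin N) => p.braList T s.toList := by
  rw [linearIndependent_iff']
  intro S g hg s₀ hs₀
  -- The `i`-th point is chosen to kill exactly the rows that disagree with `s₀` at the site `i`:
  -- `-ξ_i` kills those without `i`, and `ξ_i` those with it. The value `0` outside the range is
  -- never used.
  let z : ℕ → ℂ := fun i => if h : i < N then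
    (if (⟨i, h⟩ : Fin N) ∈ s₀ then -p.ξ ⟨i, h⟩ else p.ξ ⟨i, h⟩) else 0
  obtain ⟨Φ, hΦ⟩ := exists_iterate_offDiag (p := p) T z N
  have h1 := congrArg Φ hg
  rw [map_sum, map_zero] at h1
  simp only [map_smul, hΦ _ (Finset.nodup_toList _)] at h1
  rw [Finset.sum_eq_single s₀] at h1
  · refine (smul_eq_zero.mp h1).resolve_right (smul_ne_zero ?_ ?_)
    · refine Finset.prod_ne_zero_iff.mpr fun i hi => ?_
      rw [Finset.mem_range] at hi
      have hki : p.kFactor (T - 2 * i * p.η + ((N : ℂ) - 1) * p.η) ≠ 0 := by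
        have := hT ⟨i, hi⟩
        rwa [show T - 2 * i * p.η + ((N : ℂ) - 1) * p.η =
          T + ((N : ℂ) - 1 - 2 * i) * p.η by ring]
      simp only [z, hi, dif_pos]
      split_ifs with hmem
      · exact braEv_neg_ne_zero hp (Finset.mem_toList.mpr hmem) hki
      · exact braEv_ne_zero hp (fun h => hmem (Finset.mem_toList.mp h)) hki
    · exact braList_ne_zero hp hk _ (Finset.nodup_toList _)
  · intro s _ hss
    obtain ⟨i, hi⟩ : ∃ i, ¬(i ∈ s ↔ i ∈ s₀) := by
      by_contra hcon
      push Not at hcon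
      exact hss (Finset.ext hcon)
    rw [Finset.prod_eq_zero (Finset.mem_range.mpr i.isLt), zero_smul, smul_zero]
    simp only [z, i.isLt, dif_pos, Fin.eta]
    split_ifs with hmem
    · exact braEv_neg_of_notMem (fun h => hi (iff_of_true (Finset.mem_toList.mp h) hmem)) _
    · refine braEv_of_mem (Finset.mem_toList.mpr ?_) _
      by_contra h
      exact hi (iff_of_false h hmem)
  · exact fun h => absurd hs₀ h

theorem pairing_univ_ne_zero (hp : p.SepInhom) (hκ : p.κm ≠ 0) (hς : Complex.sinh p.ςm ≠ 0)
    (hk : ∀ n, p.kNorm (-p.ξ n) ≠ 0) {T : ℂ}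
    (hT : ∀ j : Fin N, p.kFactor (T + ((N : ℂ) - 1 - 2 * (j : ℕ)) * p.η) ≠ 0) :
    p.pairing T (Finset.univ : Finset (Fin N)).toList [] ≠ 0 := by
  intro h0
  have hli := linearIndependent_braList hp hk hT
  -- There are `2^N` subsets of sites, and the space of states has dimension `2^N`.
  have hspan := hli.span_eq_top_of_card_eq_finrank' (by
    rw [Fintype.card_finset, Module.finrank_fintype_fun_eq_card]
    simp)
  set k := p.transposed.braList (Real.pi * Complex.I - T) [] with hkdef
  have hz : ∀ v : Spins N → ℂ, v ⬝ᵥ k = 0 := by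
    intro v
    have hv : v ∈ Submodule.span ℂ (Set.range fun s : Finset (Fin N) => p.braList T s.toList) := by
      rw [hspan]; exact Submodule.mem_top
    induction hv using Submodule.span_induction with
    | mem x hx =>
      obtain ⟨s, rfl⟩ := hx
      rcases eq_or_ne s Finset.univ with rfl | hs
      · exact h0
      · obtain ⟨n, hn⟩ : ∃ n, n ∉ s := by
          by_contra hcon
          push Not at hcon
          exact hs (Finset.eq_univ_iff_forall.mpr hcon)
        exact pairing_eq_zero hp hκ hς (Finset.nodup_toList s) List.nodup_nil (n := n)
          (iff_of_false (by simpa using hn) (by simp)) T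
    | zero => exact zero_dotProduct _
    | add x y _ _ hx hy => rw [add_dotProduct, hx, hy, add_zero]
    | smul c x _ hx => rw [smul_dotProduct, hx, smul_zero]
  exact p.transposed.refBraRow_ne_zero _ (dotProduct_eq_zero _ fun v => by
    rw [dotProduct_comm]; exact hz v)

end Params

/-! ### Product vectors and the gauge transformation of the reference states. -/

section SiteProducts

variable {N : ℕ}

theorem siteOp_mul_siteOp (n : Fin N) (m m' : Spins N → Matrix (Fin 2) (Fin 2) ℂ)
    (h : ∀ s k, m' (Function.update s n k) = m' s) :
    siteOp n m * siteOp n m' = siteOp n fun s => m s * m' s := by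
  refine ext_vecMul fun v => ?_
  funext t
  rw [← Matrix.vecMul_vecMul]
  simp only [vecMul_siteOp, Function.update_idem, Function.update_self, h, Matrix.mul_apply,
    Fin.sum_univ_two]
  ring

theorem siteOp_one (n : Fin N) : (siteOp n fun _ => 1 : Op N) = 1 := by
  refine ext_vecMul fun v => ?_
  funext t
  simp only [vecMul_siteOp, Matrix.one_apply, mul_ite, mul_one, mul_zero, Finset.sum_ite_eq',
    Finset.mem_univ, if_true, Function.update_eq_self, Matrix.vecMul_one]

theorem isUnit_siteOp (n : Fin N) {m : Spins N → Matrix (Fin 2) (Fin 2) ℂ}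
    (h : ∀ s k, m (Function.update s n k) = m s) (hd : ∀ s, (m s).det ≠ 0) :
    IsUnit (siteOp n m) := by
  have h1 : siteOp n m * siteOp n (fun s => (m s)⁻¹) = 1 := by
    rw [siteOp_mul_siteOp _ _ _ fun s k => by rw [h], ← siteOp_one n]
    congr 1
    funext s
    exact Matrix.mul_nonsing_inv _ (isUnit_iff_ne_zero.mpr (hd s))
  exact (Matrix.isUnit_iff_isUnit_det _).mpr (Matrix.isUnit_det_of_right_inverse h1)

/-- The product row (or column) with factors `f n`. -/
def prodVec (f : Fin N → Fin 2 → ℂ) : Spins N → ℂ := fun s => ∏ n, f n (s n)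

theorem prodVec_eq_mul (f : Fin N → Fin 2 → ℂ) (n : Fin N) (s : Spins N) :
    prodVec f s = f n (s n) * ∏ j ∈ Finset.univ.erase n, f j (s j) :=
  prod_update_apply f n s

theorem prodVec_update_right (f : Fin N → Fin 2 → ℂ) (n : Fin N) (s : Spins N) (k : Fin 2) :
    prodVec f (Function.update s n k) = f n k * ∏ j ∈ Finset.univ.erase n, f j (s j) := by
  rw [prodVec, prod_update_apply f n, Function.update_self]
  congr 1
  refine Finset.prod_congr rfl fun j hj => ?_
  rw [Function.update_of_ne (Finset.ne_of_mem_erase hj)]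

theorem prodVec_update_left (f : Fin N → Fin 2 → ℂ) (n : Fin N) (g : Fin 2 → ℂ) (s : Spins N) :
    prodVec (Function.update f n g) s = g (s n) * ∏ j ∈ Finset.univ.erase n, f j (s j) := by
  rw [prodVec, prod_update_apply _ n, Function.update_self]
  congr 1
  refine Finset.prod_congr rfl fun j hj => ?_
  rw [Function.update_of_ne (Finset.ne_of_mem_erase hj)]

/-- The hypothesis is required only for configurations in the support of the other factors. A
dynamical parameter read from sites with a fixed spin is then a constant. -/
theorem prodVec_vecMul_siteOp (f : Fin N → Fin 2 → ℂ) (n : Fin N) (g : Fin 2 → ℂ)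
    (m : Spins N → Matrix (Fin 2) (Fin 2) ℂ)
    (h : ∀ t : Spins N, (∀ j, j ≠ n → f j (t j) ≠ 0) →
      ∀ b, ∑ k, f n k * m (Function.update t n k) k b = g b) :
    prodVec f ᵥ* siteOp n m = prodVec (Function.update f n g) := by
  funext t
  rw [vecMul_siteOp, prodVec_update_left]
  simp only [prodVec_update_right]
  by_cases h0 : ∏ j ∈ Finset.univ.erase n, f j (t j) = 0
  · simp [h0]
  · replace h0 := Finset.prod_ne_zero_iff.mp h0
    rw [← h t (fun j hj => h0 j (by simp [hj])) (t n), Finset.sum_mul]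
    exact Finset.sum_congr rfl fun k _ => by ring

theorem siteOp_mulVec_prodVec (f : Fin N → Fin 2 → ℂ) (n : Fin N) (g : Fin 2 → ℂ)
    (m : Spins N → Matrix (Fin 2) (Fin 2) ℂ)
    (h : ∀ t : Spins N, (∀ j, j ≠ n → f j (t j) ≠ 0) →
      ∑ k, m t (t n) k * f n k = g (t n)) :
    siteOp n m *ᵥ prodVec f = prodVec (Function.update f n g) := by
  funext t
  rw [siteOp_mulVec, prodVec_update_left]
  simp only [prodVec_update_right]
  by_cases h0 : ∏ j ∈ Finset.univ.erase n, f j (t j) = 0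
  · simp [h0]
  · replace h0 := Finset.prod_ne_zero_iff.mp h0
    rw [← h t (fun j hj => h0 j (by simp [hj])), Finset.sum_mul]
    exact Finset.sum_congr rfl fun k _ => by ring

theorem prodVec_single (b : Fin 2) :
    prodVec (fun _ : Fin N => Pi.single b 1) = Pi.single (fun _ => b) (1 : ℂ) := by
  funext s
  by_cases h : s = fun _ => b
  · subst h; simp [prodVec]
  · rw [Pi.single_eq_of_ne h]
    obtain ⟨n, hn⟩ := Function.ne_iff.mp h
    exact Finset.prod_eq_zero (Finset.mem_univ n) (Pi.single_eq_of_ne hn _)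

end SiteProducts

namespace Params

variable {N : ℕ} (p : Params N)

/-- The gauge parameter that matters for the states. -/
def gaugeT : ℂ := p.η * (p.β - p.α)

theorem det_gaugeS (l b : ℂ) : (p.gaugeS l b).det =
    Complex.exp (l - p.η * (b + p.α)) - Complex.exp (l + p.η * (b - p.α)) := by
  rw [gaugeS, Matrix.det_fin_two_of, mul_one, mul_one]

theorem det_gaugeS_ne_zero {l b : ℂ} (h : Complex.sinh (p.η * b) ≠ 0) : (p.gaugeS l b).det ≠ 0 := by
  have : (p.gaugeS l b).det = -(2 * Complex.exp (l - p.η * p.α)) * Complex.sinh (p.η * b) := by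
    have hz : Complex.exp (p.η * b) ≠ 0 := Complex.exp_ne_zero _
    have ha : Complex.exp (p.η * p.α) ≠ 0 := Complex.exp_ne_zero _
    rw [det_gaugeS, mul_add, mul_sub, sinh_exp_form]
    simp only [Complex.exp_add, Complex.exp_sub]
    field_simp
    ring
  rw [this]
  exact mul_ne_zero (neg_ne_zero.mpr (mul_ne_zero two_ne_zero (Complex.exp_ne_zero _))) h

/-- The factor of `gaugeSq` at the site `n`. -/
def gaugeFactor (b : ℂ) (n : Fin N) : Op N :=
  siteOp n fun s => p.gaugeS (-p.ξ n) (b + ∑ j ∈ Finset.Ioi n, spinSign (s j))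

theorem gaugeSq_eq (b : ℂ) :
    p.gaugeSq b = ((List.finRange N).reverse.map (p.gaugeFactor b)).prod := by
  rw [gaugeSq, prodDown, List.ofFn_eq_map, List.map_reverse]
  rfl

/-- At each site the determinant is a non-zero multiple of `sinh (η(β + m))`, with `m` an integer
sum of at most `N` signs. -/
theorem isUnit_gaugeSq (h : p.GaugeNondegenerate) : IsUnit (p.gaugeSq p.β) := by
  rw [gaugeSq_eq]
  have hf : ∀ n, IsUnit (p.gaugeFactor p.β n) := by
    intro n
    refine isUnit_siteOp n ?_ ?_
    · intro s k
      congr 2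
      refine Finset.sum_congr rfl fun j hj => ?_
      rw [Function.update_of_ne (Finset.mem_Ioi.mp hj).ne']
    · intro s
      refine p.det_gaugeS_ne_zero ?_
      have e : ∑ j ∈ Finset.Ioi n, spinSign (s j) =
          ((∑ j ∈ Finset.Ioi n, if s j = 0 then (1 : ℤ) else -1 : ℤ) : ℂ) := by
        push_cast
        exact Finset.sum_congr rfl fun j _ => by simp [spinSign]
      rw [e]
      refine h.sinh_beta_ne _ ((Finset.abs_sum_le_sum_abs _ _).trans ?_)
      calc ∑ j ∈ Finset.Ioi n, |if s j = 0 then (1 : ℤ) else -1|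
          ≤ ∑ j ∈ Finset.Ioi n, (1 : ℤ) := Finset.sum_le_sum fun j _ => by split_ifs <;> simp
        _ = ((Finset.Ioi n).card : ℤ) := by simp
        _ ≤ N := by
          have := Finset.card_le_univ (Finset.Ioi n)
          rw [Fintype.card_fin] at this
          exact_mod_cast this
  induction (List.finRange N).reverse with
  | nil => simp
  | cons n L ih =>
    rw [List.map_cons, List.prod_cons]
    exact (hf n).mul ih

theorem card_Ioi_cast (n : Fin N) : ((Finset.Ioi n).card : ℂ) = (N : ℂ) - 1 - (n : ℕ) := by
  have h : (Finset.Ioi n).card + (1 + (n : ℕ)) = N := by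
    rw [Fin.card_Ioi]; have := n.isLt; omega
  rw [← congrArg (Nat.cast : ℕ → ℂ) h]
  push_cast
  ring

theorem prodVec_vecMul_gaugeFactor {L : List (Fin N)} (hL : L.Pairwise (· > ·)) : ∃ c : ℂ,
    prodVec (fun j => if j ∈ L then
        gaugeRow (p.ξ j) (p.gaugeT + ((N : ℂ) - 1 - (j : ℕ)) * p.η) else Pi.single 0 1) ᵥ*
      (L.map (p.gaugeFactor p.β)).prod = c • refBra N := by
  induction L with
  | nil =>
    refine ⟨1, ?_⟩
    simp only [List.not_mem_nil, if_false, List.map_nil, List.prod_nil, Matrix.vecMul_one, one_smul]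
    exact prodVec_single 0
  | cons n L ih =>
    rw [List.pairwise_cons] at hL
    obtain ⟨c, hc⟩ := ih hL.2
    have hn : n ∉ L := fun h => lt_irrefl _ (hL.1 n h)
    set d : ℂ := Complex.exp (-p.ξ n - p.η * (p.β + ((N : ℂ) - 1 - (n : ℕ)) + p.α)) -
      Complex.exp (p.gaugeT + ((N : ℂ) - 1 - (n : ℕ)) * p.η - p.ξ n) with hd
    have key : prodVec (fun j => if j ∈ n :: L then
        gaugeRow (p.ξ j) (p.gaugeT + ((N : ℂ) - 1 - (j : ℕ)) * p.η) else Pi.single 0 1) ᵥ*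
        p.gaugeFactor p.β n = d • prodVec (fun j => if j ∈ L then
        gaugeRow (p.ξ j) (p.gaugeT + ((N : ℂ) - 1 - (j : ℕ)) * p.η) else Pi.single 0 1) := by
      rw [gaugeFactor, prodVec_vecMul_siteOp _ n (d • Pi.single 0 1)]
      · funext s
        simp only [prodVec_update_left, Pi.smul_apply, smul_eq_mul]
        rw [prodVec_eq_mul _ n]
        simp only [hn, if_false, mul_assoc]
        congr 2
        refine Finset.prod_congr rfl fun j hj => ?_
        simp [Finset.ne_of_mem_erase hj]
      · intro t ht b
        -- The sites above `n` have already been turned into up spins, so the dynamical shift is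
        -- their number. The covector at `n` then annihilates the second column of the gauge matrix.
        have hsum : ∀ k, ∑ j ∈ Finset.Ioi n, spinSign (Function.update t n k j) =
            (N : ℂ) - 1 - (n : ℕ) := by
          intro k
          rw [← card_Ioi_cast, Finset.card_eq_sum_ones, Nat.cast_sum, Nat.cast_one]
          refine Finset.sum_congr rfl fun j hj => ?_
          have hj' := Finset.mem_Ioi.mp hj
          have hjL : j ∉ n :: L := by
            rw [List.mem_cons, not_or]
            exact ⟨hj'.ne', fun h => lt_asymm hj' (hL.1 j h)⟩
          have h1 := ht j hj'.ne'
          simp only [hjL, if_false] at h1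
          have h2 : t j = 0 := by
            by_contra h3
            exact h1 (Pi.single_eq_of_ne h3 _)
          rw [Function.update_of_ne hj'.ne', h2]
          simp [spinSign]
        simp only [hsum, List.mem_cons, true_or, if_true, Fin.sum_univ_two]
        have e : p.gaugeT + ((N : ℂ) - 1 - (n : ℕ)) * p.η - p.ξ n =
          -p.ξ n + p.η * (p.β + ((N : ℂ) - 1 - (n : ℕ)) - p.α) := by
          rw [gaugeT]; ring
        fin_cases b
        · simp [gaugeRow, gaugeS, hd, sub_eq_add_neg]
        · simp only [gaugeRow, gaugeS, e]
          simp
    refine ⟨d * c, ?_⟩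
    rw [List.map_cons, List.prod_cons, ← Matrix.vecMul_vecMul, key, Matrix.smul_vecMul, hc, smul_smul]

theorem refBraRow_vecMul_gaugeSq : ∃ c : ℂ,
    p.refBraRow p.gaugeT ᵥ* p.gaugeSq p.β = c • refBra N := by
  obtain ⟨c, hc⟩ := p.prodVec_vecMul_gaugeFactor (L := (List.finRange N).reverse)
    (by rw [List.pairwise_reverse]; exact List.pairwise_lt_finRange N)
  refine ⟨c, ?_⟩
  rw [gaugeSq_eq, ← hc]
  congr 1
  funext s
  simp [refBraRow, refRow, prodVec]

/-- The constant need not be computed: were it zero, the invertible gauge matrix would annihilate a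
non-zero row. -/
theorem refBra_vecMul_inv (h : p.GaugeNondegenerate) : ∃ c : ℂ, c ≠ 0 ∧
    refBra N ᵥ* (p.gaugeSq p.β)⁻¹ = c • p.refBraRow p.gaugeT := by
  obtain ⟨c, hc⟩ := p.refBraRow_vecMul_gaugeSq
  have hdet := (Matrix.isUnit_iff_isUnit_det _).mp (p.isUnit_gaugeSq h)
  have h1 := congrArg (fun v => v ᵥ* (p.gaugeSq p.β)⁻¹) hc
  simp only [Matrix.vecMul_vecMul, Matrix.mul_nonsing_inv _ hdet, Matrix.vecMul_one,
    Matrix.smul_vecMul] at h1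
  have hc0 : c ≠ 0 := by
    rintro rfl
    rw [zero_smul] at h1
    exact p.refBraRow_ne_zero _ h1
  exact ⟨c⁻¹, inv_ne_zero hc0, by rw [h1, smul_smul, inv_mul_cancel₀ hc0, one_smul]⟩

theorem gaugeFactor_mulVec_prodVec {L : List (Fin N)} (hL : L.Pairwise (· > ·)) :
    (L.map (p.gaugeFactor p.β)).prod *ᵥ refKet N = prodVec (fun j => if j ∈ L then
        ![Complex.exp (-p.ξ j + p.gaugeT - ((N : ℂ) - 1 - (j : ℕ)) * p.η), 1]
        else Pi.single 1 1) := by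
  induction L with
  | nil =>
    simp only [List.not_mem_nil, if_false, List.map_nil, List.prod_nil, Matrix.one_mulVec]
    exact (prodVec_single 1).symm
  | cons n L ih =>
    rw [List.pairwise_cons] at hL
    have hn : n ∉ L := fun h => lt_irrefl _ (hL.1 n h)
    rw [List.map_cons, List.prod_cons, ← Matrix.mulVec_mulVec, ih hL.2, gaugeFactor,
      siteOp_mulVec_prodVec _ n
        ![Complex.exp (-p.ξ n + p.gaugeT - ((N : ℂ) - 1 - (n : ℕ)) * p.η), 1]]
    · congr 1
      funext j
      by_cases hj : j = n
      · subst hj; simp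
      · simp [hj]
    · intro t ht
      -- On a column the factors act in increasing order of the sites, so those above `n` are still
      -- down.
      have hsum : ∑ j ∈ Finset.Ioi n, spinSign (t j) = -((N : ℂ) - 1 - (n : ℕ)) := by
        rw [← card_Ioi_cast, Finset.card_eq_sum_ones, Nat.cast_sum, Nat.cast_one,
          ← Finset.sum_neg_distrib]
        refine Finset.sum_congr rfl fun j hj => ?_
        have hj' := Finset.mem_Ioi.mp hj
        have hjL : j ∉ L := fun h => lt_asymm hj' (hL.1 j h)
        have h1 := ht j hj'.ne'
        simp only [hjL, if_false] at h1
        have h2 : t j = 1 := by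
          by_contra h3
          exact h1 (Pi.single_eq_of_ne h3 _)
        rw [h2]
        simp [spinSign]
      simp only [hsum, hn, if_false, Fin.sum_univ_two]
      have e : -p.ξ n + p.gaugeT - ((N : ℂ) - 1 - (n : ℕ)) * p.η =
        -p.ξ n + p.η * (p.β + -((N : ℂ) - 1 - (n : ℕ)) - p.α) := by
        rw [gaugeT]; ring
      rw [e]
      generalize t n = b
      fin_cases b <;> simp [gaugeS]

/-- Each local column `(exp u, 1)` is rescaled to `(1, exp (-u))`; the shift by `πi` supplies the
minus sign built into `gaugeRow`. -/
theorem gaugeSq_mulVec_refKet : ∃ c : ℂ, c ≠ 0 ∧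
    p.gaugeSq p.β *ᵥ refKet N = c • p.transposed.refBraRow (Real.pi * Complex.I - p.gaugeT) := by
  refine ⟨∏ j : Fin N, Complex.exp (-p.ξ j + p.gaugeT - ((N : ℂ) - 1 - (j : ℕ)) * p.η),
    Finset.prod_ne_zero_iff.mpr fun j _ => Complex.exp_ne_zero _, ?_⟩
  rw [gaugeSq_eq, gaugeFactor_mulVec_prodVec _
    (by rw [List.pairwise_reverse]; exact List.pairwise_lt_finRange N)]
  funext s
  simp only [List.mem_reverse, List.mem_finRange, if_true, prodVec, Pi.smul_apply, smul_eq_mul,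
    refBraRow, refRow]
  rw [← Finset.prod_mul_distrib]
  refine Finset.prod_congr rfl fun j _ => ?_
  have e : Real.pi * Complex.I - p.gaugeT + ((N : ℂ) - 1 - (j : ℕ)) * p.transposed.η -
      p.transposed.ξ j = -(-p.ξ j + p.gaugeT - ((N : ℂ) - 1 - (j : ℕ)) * p.η) +
        Real.pi * Complex.I := by
    simp only [transposed]; ring
  simp only [gaugeRow, e, Complex.exp_add_pi_mul_I, neg_neg]
  generalize s j = b
  fin_cases b
  · simp
  · simp only [Complex.exp_neg]
    simp

end Params

/-! ### From the SOS operators to the separate-variable states. -/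

section Conjugation

variable {M : Type} [Monoid M]

theorem conj_pow_of_mul_eq_one {a b : M} (h : a * b = 1) (h' : b * a = 1) (x : M) (k : ℕ) :
    (b * x * a) ^ k = b * x ^ k * a := by
  induction k with
  | zero => simp [h']
  | succ k ih =>
    rw [pow_succ, ih, pow_succ]
    calc b * x ^ k * a * (b * x * a) = b * x ^ k * (a * b) * x * a := by simp only [mul_assoc]
      _ = b * (x ^ k * x) * a := by rw [h, mul_one]; simp only [mul_assoc]

theorem list_prod_conj {ι : Type} {a b : M} (h : a * b = 1) (h' : b * a = 1) (x : ι → M)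
    (L : List ι) : (L.map fun j => b * x j * a).prod = b * (L.map x).prod * a := by
  induction L with
  | nil => simp [h']
  | cons n L ih =>
    rw [List.map_cons, List.prod_cons, ih, List.map_cons, List.prod_cons]
    calc b * x n * a * (b * (L.map x).prod * a) = b * x n * (a * b) * (L.map x).prod * a := by
          simp only [mul_assoc]
      _ = b * (x n * (L.map x).prod) * a := by rw [h, mul_one]; simp only [mul_assoc]

end Conjugation

namespace Params

variable {N : ℕ} (p : Params N)

/-- The diagonal gauged operator of index `0` acts on rows annihilated by the off-diagonal one. -/
theorem vecMul_gaugedU_zero {l b : ℂ} (hb : Complex.sinh (p.η * b) ≠ 0) {ψ : Spins N → ℂ}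
    (h : offDiag p.bdryX l (p.η * (b - p.α)) ψ = 0) :
    ψ ᵥ* p.gaugedU (l + p.η / 2) b 0 0 =
      Complex.exp (2 * l) • covec p.bdryX l (p.η * (b - p.α)) ψ 0 := by
  have h1 := covec_one_of_offDiag_eq_zero h
  have hd := p.det_gaugeS_ne_zero (l := -l) hb
  have e0 : -(l + p.η / 2) + p.η / 2 = -l := by ring
  have e1 : l + p.η / 2 - p.η / 2 = l := by ring
  have key : ψ ᵥ* p.gaugedU (l + p.η / 2) b 0 0 = (p.gaugeS (-l) b).det⁻¹ •
      (Complex.exp (l - p.η * (b + p.α)) • covec p.bdryX l (p.η * (b - p.α)) ψ 0 +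
        covec p.bdryX l (p.η * (b - p.α)) ψ 1) := by
    rw [gaugedU, boundaryU_eq_bdryX, e0, e1, Matrix.inv_def, Ring.inverse_eq_inv']
    simp only [covec, Matrix.mul_apply, Fin.sum_univ_two, auxScalar, Matrix.map_apply,
      Matrix.smul_apply, Matrix.vecMul_add, ← Matrix.vecMul_vecMul, vecMul_algebraMap,
      Matrix.add_vecMul, Matrix.smul_vecMul]
    rw [gaugeS, Matrix.adjugate_fin_two_of, gaugeS]
    simp only [Matrix.of_apply, Matrix.cons_val_zero, Matrix.cons_val_one, Matrix.cons_val',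
      Matrix.cons_val_fin_one, smul_eq_mul]
    rw [show p.η * (b - p.α) - l = -l + p.η * (b - p.α) by ring]
    module
  -- When the off-diagonal row vanishes, both covector components are proportional. The remaining
  -- scalar is the determinant of the gauge matrix up to `exp (2l)`, so the inverse determinant
  -- disappears.
  rw [key, h1, ← neg_smul, ← add_smul, smul_smul]
  congr 1
  rw [inv_mul_eq_iff_eq_mul₀ hd, det_gaugeS]
  simp only [two_mul, Complex.exp_add, Complex.exp_sub, Complex.exp_neg]
  have hx : Complex.exp l ≠ 0 := Complex.exp_ne_zero _
  field_simp
  ring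

/-- The diagonal gauged operator of index `1` acts on columns annihilated by the off-diagonal
operator of the transposed chain. -/
theorem gaugedU_one_mulVec {l b : ℂ} (hb : Complex.sinh (p.η * b) ≠ 0) {k : Spins N → ℂ}
    (h : offDiag p.transposed.bdryX l (Real.pi * Complex.I - p.η * (b - p.α)) k = 0) :
    p.gaugedU (l + p.η / 2) b 1 1 *ᵥ k =
      Complex.exp (2 * l) •
        covec p.transposed.bdryX l (Real.pi * Complex.I - p.η * (b - p.α)) k 0 := by
  have h1 := covec_one_of_offDiag_eq_zero h
  have hd := p.det_gaugeS_ne_zero (l := -l) hb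
  have e0 : -(l + p.η / 2) + p.η / 2 = -l := by ring
  have e1 : l + p.η / 2 - p.η / 2 = l := by ring
  have e2 : Complex.exp (Real.pi * Complex.I - p.η * (b - p.α) - l) =
      -(Complex.exp (l + p.η * (b - p.α)))⁻¹ := by
    rw [sub_sub, sub_eq_neg_add, Complex.exp_add_pi_mul_I, Complex.exp_neg, add_comm l]
  have e3 : Complex.exp (l + (Real.pi * Complex.I - p.η * (b - p.α))) =
      -(Complex.exp l * (Complex.exp (p.η * (b - p.α)))⁻¹) := by
    rw [show l + (Real.pi * Complex.I - p.η * (b - p.α)) =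
      l - p.η * (b - p.α) + Real.pi * Complex.I by ring, Complex.exp_add_pi_mul_I, Complex.exp_sub,
      div_eq_mul_inv]
  have hE : Complex.exp (l + p.η * (b - p.α)) ≠ 0 := Complex.exp_ne_zero _
  have key : p.gaugedU (l + p.η / 2) b 1 1 *ᵥ k = ((p.gaugeS (-l) b).det⁻¹ *
        Complex.exp (l + p.η * (b - p.α))) •
      (-covec p.transposed.bdryX l (Real.pi * Complex.I - p.η * (b - p.α)) k 0 +
        Complex.exp (-l - p.η * (b + p.α)) •
          covec p.transposed.bdryX l (Real.pi * Complex.I - p.η * (b - p.α)) k 1) := by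
    rw [gaugedU, boundaryU_eq_bdryX, e0, e1, Matrix.inv_def, Ring.inverse_eq_inv']
    simp only [covec, vecMul_transposed_bdryX, e2]
    simp only [Matrix.mul_apply, Fin.sum_univ_two, auxScalar, Matrix.map_apply,
      Matrix.smul_apply, Matrix.add_mulVec, Algebra.algebraMap_eq_smul_one, Matrix.smul_mul,
      Matrix.mul_smul, Matrix.one_mul, Matrix.mul_one, Matrix.smul_mulVec]
    generalize (p.gaugeS (-l) b).det⁻¹ = D
    simp only [Matrix.adjugate_fin_two, gaugeS, Matrix.of_apply, Matrix.cons_val_zero, Matrix.cons_val_one, Matrix.cons_val',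
      Matrix.cons_val_fin_one, smul_eq_mul]
    generalize p.bdryX l 0 0 *ᵥ k = v00
    generalize p.bdryX l 0 1 *ᵥ k = v01
    generalize p.bdryX l 1 0 *ᵥ k = v10
    generalize p.bdryX l 1 1 *ᵥ k = v11
    funext s
    simp
    field_simp
    ring
  rw [key, h1, e3, ← neg_smul, smul_smul, ← neg_one_smul ℂ (covec _ _ _ _ _), ← add_smul, smul_smul]
  congr 1
  rw [mul_assoc, inv_mul_eq_iff_eq_mul₀ hd, det_gaugeS]
  simp only [two_mul, Complex.exp_add, Complex.exp_sub, Complex.exp_neg]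
  have hx : Complex.exp l ≠ 0 := Complex.exp_ne_zero _
  have hy : Complex.exp (p.η * (b - p.α)) ≠ 0 := Complex.exp_ne_zero _
  field_simp
  ring

/-- The gauged diagonal operator that increases the left states. -/
def raiseA (j : Fin N) : Op N := p.gaugedU (p.η / 2 - p.ξ j) (p.β - 1) 0 0

/-- The gauged diagonal operator that increases the right states. -/
def raiseD (j : Fin N) : Op N := p.gaugedU (p.ξ j + p.η / 2) (p.β + 1) 1 1

theorem one_le_of_fin (j : Fin N) : (1 : ℤ) ≤ N := by
  have := j.isLt
  omega

theorem braList_vecMul_raiseA (h : p.GaugeNondegenerate) {L : List (Fin N)} (hL : L.Nodup)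
    {j : Fin N} (hj : j ∉ L) : p.braList p.gaugeT L ᵥ* p.raiseA j =
      Complex.exp (-(2 * p.ξ j)) • p.braList p.gaugeT (j :: L) := by
  have h0 := p.offDiag_neg_braList hL hj p.gaugeT
  have e : p.gaugeT - p.η = p.η * (p.β - 1 - p.α) := by rw [gaugeT]; ring
  have hb : Complex.sinh (p.η * (p.β - 1)) ≠ 0 := by
    have := h.sinh_beta_ne (-1) (by simpa using one_le_of_fin j)
    rwa [Int.cast_neg, Int.cast_one, ← sub_eq_add_neg] at this
  rw [e] at h0
  rw [raiseA, show p.η / 2 - p.ξ j = -p.ξ j + p.η / 2 by ring, p.vecMul_gaugedU_zero hb h0, braList,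
    e, mul_neg]

theorem raiseD_mulVec_braList (h : p.GaugeNondegenerate) {L : List (Fin N)} (hL : L.Nodup)
    {j : Fin N} (hj : j ∉ L) :
    p.raiseD j *ᵥ p.transposed.braList (Real.pi * Complex.I - p.gaugeT) L =
      Complex.exp (2 * p.ξ j) •
        p.transposed.braList (Real.pi * Complex.I - p.gaugeT) (j :: L) := by
  have h0 := p.transposed.offDiag_neg_braList hL hj (Real.pi * Complex.I - p.gaugeT)
  have e : Real.pi * Complex.I - p.gaugeT - p.transposed.η =
      Real.pi * Complex.I - p.η * (p.β + 1 - p.α) := by rw [gaugeT, transposed]; ring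
  have e' : -p.transposed.ξ j = p.ξ j := by simp [transposed]
  have hb : Complex.sinh (p.η * (p.β + 1)) ≠ 0 := by
    have := h.sinh_beta_ne 1 (by simpa using one_le_of_fin j)
    rwa [Int.cast_one] at this
  rw [e, e'] at h0
  rw [raiseD, p.gaugedU_one_mulVec hb h0, braList, e, e']

theorem braList_vecMul_prod (hp : p.SepInhom) (h : p.GaugeNondegenerate) (c : Fin N → ℂ)
    (e : Fin N → ℕ) (he : ∀ j, e j = 0 ∨ e j = 1) {L A B : List (Fin N)} (hL : L.Nodup)
    (hA : A.Nodup) (hd : ∀ j ∈ L, j ∉ A) (hB : B.Nodup)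
    (hm : ∀ j, j ∈ B ↔ j ∈ A ∨ j ∈ L ∧ e j = 1) :
    p.braList p.gaugeT A ᵥ* (L.map fun j => (c j • p.raiseA j) ^ e j).prod =
      (L.map fun j => (c j * Complex.exp (-(2 * p.ξ j))) ^ e j).prod • p.braList p.gaugeT B := by
  induction L generalizing A with
  | nil =>
    have : A.Perm B := (List.perm_ext_iff_of_nodup hA hB).mpr fun j => by simp [hm]
    simp [p.braList_perm hp this hA]
  | cons n L ih =>
    rw [List.nodup_cons] at hL
    simp only [List.map_cons, List.prod_cons]
    rcases he n with h0 | h1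
    · rw [h0, pow_zero, pow_zero, one_mul, one_mul]
      refine ih hL.2 hA (fun j hj => hd j (by simp [hj])) fun j => ?_
      rw [hm, List.mem_cons]
      refine or_congr_right (and_congr_left fun h2 => ?_)
      refine or_iff_right ?_
      rintro rfl
      omega
    · have hn : n ∉ A := hd n (by simp)
      rw [h1, pow_one, pow_one, ← Matrix.vecMul_vecMul, Matrix.vecMul_smul,
        p.braList_vecMul_raiseA h hA hn, smul_smul, Matrix.smul_vecMul, ih hL.2, smul_smul]
      · exact List.nodup_cons.mpr ⟨hn, hA⟩
      · intro j hj
        rw [List.mem_cons, not_or]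
        exact ⟨fun h2 => hL.1 (h2 ▸ hj), hd j (by simp [hj])⟩
      · intro j
        rw [hm, List.mem_cons, List.mem_cons]
        by_cases hj : j = n
        · simp [hj, h1]
        · simp [hj]

theorem prod_mulVec_braList (h : p.GaugeNondegenerate) (c : Fin N → ℂ)
    (e : Fin N → ℕ) (he : ∀ j, e j = 0 ∨ e j = 1) {L : List (Fin N)} (hL : L.Nodup) :
    (L.map fun j => (c j • p.raiseD j) ^ e j).prod *ᵥ
        p.transposed.refBraRow (Real.pi * Complex.I - p.gaugeT) =
      (L.map fun j => (c j * Complex.exp (2 * p.ξ j)) ^ e j).prod •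
        p.transposed.braList (Real.pi * Complex.I - p.gaugeT) (L.filter fun j => e j = 1) := by
  induction L with
  | nil => simp [braList]
  | cons n L ih =>
    rw [List.nodup_cons] at hL
    simp only [List.map_cons, List.prod_cons]
    rw [← Matrix.mulVec_mulVec, ih hL.2]
    rcases he n with h0 | h1
    · rw [h0, pow_zero, pow_zero, one_mul, Matrix.one_mulVec, List.filter_cons_of_neg (by simp [h0])]
    · have hn : n ∉ L.filter fun j => e j = 1 := fun h2 => hL.1 (List.mem_of_mem_filter h2)
      rw [h1, pow_one, pow_one, List.filter_cons_of_pos (by simp [h1]), Matrix.mulVec_smul,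
        Matrix.smul_mulVec, p.raiseD_mulVec_braList h (hL.2.filter _) hn]
      simp only [smul_smul]
      congr 1
      ring

/-- The shift of `β` compensates the spin of the auxiliary index, here and in `sosD_eq`. All
operators used are thus conjugated by the single matrix `gaugeSq β`, and products telescope. -/
theorem sosA_eq (j : Fin N) : p.sosA (p.η / 2 - p.ξ j) (p.β - 1) =
    (p.gaugeSq p.β)⁻¹ * p.raiseA j * p.gaugeSq p.β := by
  rw [sosA, sosU, Matrix.of_apply, raiseA, show p.β - 1 + spinSign 0 = p.β by simp [spinSign]]

theorem sosD_eq (j : Fin N) : p.sosD (p.ξ j + p.η / 2) (p.β + 1) =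
    (p.gaugeSq p.β)⁻¹ * p.raiseD j * p.gaugeSq p.β := by
  rw [sosD, sosU, Matrix.of_apply, raiseD, show p.β + 1 + spinSign 1 = p.β by simp [spinSign]]

theorem prodUp_conj (h : p.GaugeNondegenerate) (c : Fin N → ℂ) (x : Fin N → Op N) (e : Fin N → ℕ) :
    (prodUp fun j => (c j • ((p.gaugeSq p.β)⁻¹ * x j * p.gaugeSq p.β)) ^ e j) =
      (p.gaugeSq p.β)⁻¹ * ((List.finRange N).map fun j => (c j • x j) ^ e j).prod *
        p.gaugeSq p.β := by
  have hdet := (Matrix.isUnit_iff_isUnit_det _).mp (p.isUnit_gaugeSq h)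
  have h1 := Matrix.mul_nonsing_inv _ hdet
  have h2 := Matrix.nonsing_inv_mul _ hdet
  rw [prodUp, List.ofFn_eq_map, ← list_prod_conj h1 h2]
  congr 2
  funext j
  rw [← conj_pow_of_mul_eq_one h1 h2, Matrix.mul_smul, Matrix.smul_mul]

/-- The set of sites where the configuration equals `1`. -/
def onSet (h : Fin N → Fin 2) : Finset (Fin N) := Finset.univ.filter fun j => h j = 1

theorem mem_onSet {h : Fin N → Fin 2} {j : Fin N} : j ∈ onSet h ↔ h j = 1 := by
  simp [onSet]

theorem fin_two_val (b : Fin 2) : (b : ℕ) = 0 ∨ (b : ℕ) = 1 := by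
  omega

/-- The left and right separate-variable states are proportional to the rows `braList` of the chain
and of the transposed chain. -/
theorem exists_sovStates (hp : p.SepInhom) (hg : p.GaugeNondegenerate) : ∃ c c' : ℂ,
    c ≠ 0 ∧ c' ≠ 0 ∧
    (∀ (ep : ℤˣ) (e : Signs) (h : Fin N → Fin 2), p.sovBra ep e h ᵥ* (p.gaugeSq p.β)⁻¹ =
      (c * ∏ j, ((p.aMinus ep e (p.η / 2 - p.ξ j))⁻¹ * Complex.exp (-(2 * p.ξ j))) ^ (1 - (h j : ℕ))) •
        p.braList p.gaugeT ((onSet h)ᶜ).toList) ∧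
    (∀ (ep : ℤˣ) (e : Signs) (h : Fin N → Fin 2), p.gaugeSq p.β *ᵥ p.sovKet ep e h =
      (c' * ∏ j, ((p.kCoef j * p.aMinus ep e (p.η / 2 - p.ξ j))⁻¹ *
        Complex.exp (2 * p.ξ j)) ^ (h j : ℕ)) •
        p.transposed.braList (Real.pi * Complex.I - p.gaugeT) (onSet h).toList) ∧
    (∀ (ep : ℤˣ) (e : Signs), p.normConst ep e = vdm (fun n => p.xiS n 0) *
      (c * c' * (∏ j, ((p.aMinus ep e (p.η / 2 - p.ξ j))⁻¹ * Complex.exp (-(2 * p.ξ j)))) *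
        p.pairing p.gaugeT Finset.univ.toList [])) := by
  obtain ⟨c, hc, hbra⟩ := p.refBra_vecMul_inv hg
  obtain ⟨c', hc', hket⟩ := p.gaugeSq_mulVec_refKet
  have hdet := (Matrix.isUnit_iff_isUnit_det _).mp (p.isUnit_gaugeSq hg)
  have h1 := Matrix.mul_nonsing_inv _ hdet
  have hb : ∀ (ep : ℤˣ) (e : Signs) (k : Fin N → ℕ) (s : Finset (Fin N)),
      (∀ j, k j = 0 ∨ k j = 1) → (∀ j, j ∈ s ↔ k j = 1) →
      (refBra N ᵥ* (p.gaugeSq p.β)⁻¹) ᵥ* ((List.finRange N).map fun j =>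
        ((p.aMinus ep e (p.η / 2 - p.ξ j))⁻¹ • p.raiseA j) ^ k j).prod =
      (c * ∏ j, ((p.aMinus ep e (p.η / 2 - p.ξ j))⁻¹ * Complex.exp (-(2 * p.ξ j))) ^ k j) •
        p.braList p.gaugeT s.toList := by
    intro ep e k s hk hs
    have := p.braList_vecMul_prod hp hg (fun j => (p.aMinus ep e (p.η / 2 - p.ξ j))⁻¹) k hk
      (L := List.finRange N) (A := []) (B := s.toList) (List.nodup_finRange N) List.nodup_nil
      (by simp) s.nodup_toList (by simp [hs])
    rw [braList] at this
    rw [hbra, Matrix.smul_vecMul, this, smul_smul, ← List.ofFn_eq_map, List.prod_ofFn]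
  refine ⟨c, c', hc, hc', ?_, ?_, ?_⟩
  · intro ep e h
    rw [sovBra]
    simp only [sosA_eq]
    rw [p.prodUp_conj hg, Matrix.vecMul_vecMul, Matrix.mul_assoc, h1, Matrix.mul_one,
      ← Matrix.vecMul_vecMul, hb ep e (fun j => 1 - (h j : ℕ)) (onSet h)ᶜ]
    · intro j; omega
    · intro j
      rw [Finset.mem_compl, mem_onSet]
      have : h j = 1 ↔ (h j : ℕ) = 1 := by rw [Fin.ext_iff]; rfl
      omega
  · intro ep e h
    rw [sovKet]
    simp only [sosD_eq]
    rw [p.prodUp_conj hg, Matrix.mulVec_mulVec, Matrix.mul_assoc, ← Matrix.mul_assoc, h1,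
      Matrix.one_mul, ← Matrix.mulVec_mulVec, hket, Matrix.mulVec_smul,
      p.prod_mulVec_braList hg _ _ (fun j => fin_two_val _) (List.nodup_finRange N),
      smul_smul, ← List.ofFn_eq_map, List.prod_ofFn]
    congr 1
    refine p.transposed.braList_perm hp.transposed ?_ ((List.nodup_finRange N).filter _) _
    refine (List.perm_ext_iff_of_nodup ((List.nodup_finRange N).filter _)
      (onSet h).nodup_toList).mpr fun j => ?_
    have : h j = 1 ↔ (h j : ℕ) = 1 := by rw [Fin.ext_iff]; rfl
    simp [mem_onSet, this]
  · intro ep e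
    have := p.prodUp_conj hg (fun j => (p.aMinus ep e (p.η / 2 - p.ξ j))⁻¹) p.raiseA fun _ => 1
    simp only [pow_one] at this
    rw [normConst]
    simp only [sosA_eq]
    have h3 := hb ep e (fun _ => 1) Finset.univ (by simp) (by simp)
    simp only [pow_one] at h3
    rw [this, ← Matrix.mulVec_mulVec, hket, Matrix.dotProduct_mulVec, ← Matrix.vecMul_vecMul, h3,
      smul_dotProduct, dotProduct_smul, pairing, braList]
    simp only [smul_eq_mul]
    ring

end Params

/-! ### Hyperbolic identities and the dependence on signs and boundary parameters. -/

theorem sinh_ne_zero_of_forall_ne {z : ℂ} (h : ∀ m : ℤ, z ≠ Complex.I * Real.pi * m) :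
    Complex.sinh z ≠ 0 := by
  intro h0
  have h1 : Complex.exp z = Complex.exp (-z) := by
    have : (Complex.exp z - Complex.exp (-z)) / 2 = 0 := h0
    linear_combination 2 * this
  obtain ⟨n, hn⟩ := Complex.exp_eq_exp_iff_exists_int.mp h1
  exact h n (by linear_combination (1 / 2) * hn)

theorem sinh_sub_mul_sinh_add (x y : ℂ) :
    Complex.sinh (x - y) * Complex.sinh (x + y) = Complex.sinh x ^ 2 - Complex.sinh y ^ 2 := by
  rw [Complex.sinh_sub, Complex.sinh_add]
  linear_combination Complex.sinh x ^ 2 * Complex.cosh_sq y - Complex.sinh y ^ 2 * Complex.cosh_sq x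

theorem cosh_sub_mul_cosh_add (x y : ℂ) :
    Complex.cosh (x - y) * Complex.cosh (x + y) = Complex.sinh x ^ 2 + Complex.cosh y ^ 2 := by
  rw [Complex.cosh_sub, Complex.cosh_add]
  linear_combination Complex.cosh y ^ 2 * Complex.cosh_sq x + Complex.sinh x ^ 2 * Complex.cosh_sq y

section Signs

theorem sgn_mul_self (u : ℤˣ) : sgn u * sgn u = 1 := by
  rcases Int.units_eq_one_or u with rfl | rfl <;> simp [sgn]

theorem sgn_ne_zero (u : ℤˣ) : sgn u ≠ 0 := left_ne_zero_of_mul_eq_one (sgn_mul_self u)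

theorem sgn_inv (u : ℤˣ) : (sgn u)⁻¹ = sgn u := inv_eq_of_mul_eq_one_left (sgn_mul_self u)

theorem sinh_sgn_mul (u : ℤˣ) (x : ℂ) : Complex.sinh (sgn u * x) = sgn u * Complex.sinh x := by
  rcases Int.units_eq_one_or u with rfl | rfl <;> simp [sgn]

theorem cosh_sgn_mul (u : ℤˣ) (x : ℂ) : Complex.cosh (sgn u * x) = Complex.cosh x := by
  rcases Int.units_eq_one_or u with rfl | rfl <;> simp [sgn]

theorem sinh_add_sgn_ne_zero {x y : ℂ} (h : Complex.sinh (x + y) ≠ 0 ∧ Complex.sinh (x - y) ≠ 0)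
    (u : ℤˣ) : Complex.sinh (x + sgn u * y) ≠ 0 ∧ Complex.sinh (-x + sgn u * y) ≠ 0 := by
  have e1 : Complex.sinh (-x + y) = -Complex.sinh (x - y) := by rw [← Complex.sinh_neg, neg_sub']; simp
  have e2 : Complex.sinh (-x + -y) = -Complex.sinh (x + y) := by rw [← Complex.sinh_neg, neg_add]
  rcases Int.units_eq_one_or u with rfl | rfl
  · simp [sgn, e1, h]
  · rw [show sgn (-1) = -1 by simp [sgn], neg_one_mul, e2, ← sub_eq_add_neg]
    exact ⟨h.2, neg_ne_zero.mpr h.1⟩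

theorem cosh_add_sgn_ne_zero {x y : ℂ} (h : Complex.cosh (x + y) ≠ 0 ∧ Complex.cosh (x - y) ≠ 0)
    (u : ℤˣ) : Complex.cosh (x + sgn u * y) ≠ 0 ∧ Complex.cosh (-x + sgn u * y) ≠ 0 ∧
      Complex.cosh (x - sgn u * y) ≠ 0 ∧ Complex.cosh (-x - sgn u * y) ≠ 0 := by
  have e1 : Complex.cosh (-x + y) = Complex.cosh (x - y) := by rw [← Complex.cosh_neg, neg_add, neg_neg,
    sub_eq_add_neg]
  have e2 : Complex.cosh (-x - y) = Complex.cosh (x + y) := by rw [← Complex.cosh_neg, neg_sub, sub_neg_eq_add,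
    add_comm]
  rcases Int.units_eq_one_or u with rfl | rfl
  · simp [sgn, e1, e2, h]
  · simp [sgn, ← sub_eq_add_neg, e1, e2, h]

theorem sinh_sgn_pair (u : ℤˣ) (x y : ℂ) :
    Complex.sinh (x + sgn u * y) * Complex.sinh (-x + sgn u * y) =
      Complex.sinh (x + y) * Complex.sinh (-x + y) := by
  have h := sinh_sub_mul_sinh_add (sgn u * y) x
  have h' := sinh_sub_mul_sinh_add y x
  rw [sinh_sgn_mul] at h
  rw [add_comm x, add_comm x, neg_add_eq_sub, neg_add_eq_sub]
  linear_combination h - h' + Complex.sinh y ^ 2 * sgn_mul_self u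

theorem cosh_sgn_pair (u : ℤˣ) (x y : ℂ) :
    Complex.cosh (x + sgn u * y) * Complex.cosh (-x + sgn u * y) =
      Complex.cosh (x + y) * Complex.cosh (-x + y) := by
  have h := cosh_sub_mul_cosh_add (sgn u * y) x
  have h' := cosh_sub_mul_cosh_add y x
  rw [sinh_sgn_mul] at h
  rw [add_comm x, add_comm x, neg_add_eq_sub, neg_add_eq_sub]
  linear_combination h - h' + Complex.sinh y ^ 2 * sgn_mul_self u

theorem cosh_sub_sgn_pair (u : ℤˣ) (x y : ℂ) :
    Complex.cosh (x - sgn u * y) * Complex.cosh (-x - sgn u * y) =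
      Complex.cosh (x - y) * Complex.cosh (-x - y) := by
  simpa only [mul_neg, ← sub_eq_add_neg] using cosh_sgn_pair u x (-y)

end Signs

namespace Params

variable {N : ℕ} {p : Params N}

theorem sepInhom_of_generic (hg : p.GenericInhom) (hη : Complex.sinh p.η ≠ 0) : p.SepInhom where
  sub_ne j k h := by
    have := sinh_ne_zero_of_forall_ne (hg.sub_ne j k h 0 0)
    rwa [show p.xiS j 0 - p.xiS k 0 = p.ξ j - p.ξ k by simp [xiS]] at this
  add_ne j k h := by
    have := sinh_ne_zero_of_forall_ne (hg.add_ne j k h 0 1)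
    rwa [show p.xiS j 0 + p.xiS k 1 = p.ξ j + p.ξ k by simp [xiS]; ring] at this
  sub_eta_ne j k h := by
    have := sinh_ne_zero_of_forall_ne (hg.sub_ne j k h 0 1)
    rwa [show p.xiS j 0 - p.xiS k 1 = p.ξ j - p.ξ k + p.η by simp [xiS]; ring] at this
  add_eta_ne j k h := by
    have := sinh_ne_zero_of_forall_ne (hg.add_ne j k h 0 0)
    rwa [show p.xiS j 0 + p.xiS k 0 = p.ξ j + p.ξ k + p.η by simp [xiS]; ring] at this
  neg_eta_ne j k h := by
    have := sinh_ne_zero_of_forall_ne (hg.add_ne j k h 1 1)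
    rwa [show p.xiS j 1 + p.xiS k 1 = -(-p.ξ j - p.ξ k + p.η) by simp [xiS]; ring,
      Complex.sinh_neg, neg_ne_zero] at this
  two_ne := hg.sinh_ne
  two_add_ne := hg.sinh_add_eta_ne
  two_sub_ne n := by
    have := hg.sinh_sub_eta_ne n
    rwa [show 2 * p.ξ n - p.η = -(-(2 * p.ξ n) + p.η) by ring, Complex.sinh_neg, neg_ne_zero] at this
  eta_ne := hη

theorem BoundaryReparam.sinh_ςm_eq (h : p.BoundaryReparam) :
    Complex.sinh p.ςm = 2 * p.κm * (Complex.sinh p.αm * Complex.cosh p.βm) := by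
  have := h.κm_ne
  rw [h.sinh_cosh_m]
  field_simp

theorem BoundaryReparam.cosh_ςm_eq (h : p.BoundaryReparam) :
    Complex.cosh p.ςm = 2 * p.κm * (Complex.cosh p.αm * Complex.sinh p.βm) := by
  have := h.κm_ne
  rw [h.cosh_sinh_m]
  field_simp

theorem BoundaryReparam.sinh_cosh_m_ne (h : p.BoundaryReparam) :
    Complex.sinh p.αm ≠ 0 ∧ Complex.cosh p.βm ≠ 0 := by
  rw [← mul_ne_zero_iff, h.sinh_cosh_m]
  exact div_ne_zero h.ςm_ne (mul_ne_zero two_ne_zero h.κm_ne)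

theorem BoundaryReparam.sinh_cosh_p_ne (h : p.BoundaryReparam) :
    Complex.sinh p.αp ≠ 0 ∧ Complex.cosh p.βp ≠ 0 := by
  rw [← mul_ne_zero_iff, h.sinh_cosh_p]
  exact div_ne_zero h.ςp_ne (mul_ne_zero two_ne_zero h.κp_ne)

/-- The parameters `α₋, β₋` are designed to factor this determinant; the generic conditions on `ξ_n
± α₋` and `ξ_n ± β₋` then exclude its zeros. -/
theorem BoundaryReparam.kNorm_eq (h : p.BoundaryReparam) (l : ℂ) :
    p.kNorm l = (Complex.sinh p.ςm)⁻¹ ^ 2 * (4 * p.κm ^ 2) *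
      ((Complex.sinh (p.αm - l) * Complex.sinh (p.αm + l)) *
        (Complex.cosh (l - p.βm) * Complex.cosh (l + p.βm))) := by
  have e : Complex.sinh (p.ςm + l) * Complex.sinh (p.ςm - l) - (p.κm * Complex.sinh (2 * l)) ^ 2 =
      4 * p.κm ^ 2 * ((Complex.sinh (p.αm - l) * Complex.sinh (p.αm + l)) *
        (Complex.cosh (l - p.βm) * Complex.cosh (l + p.βm))) := by
    have h1 := Complex.cosh_sq p.ςm
    rw [h.sinh_ςm_eq, h.cosh_ςm_eq] at h1
    have h2 := Complex.cosh_sq p.αm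
    have h3 := Complex.sinh_sq p.βm
    have h4 := Complex.cosh_sq l
    rw [mul_comm (Complex.sinh _), sinh_sub_mul_sinh_add, sinh_sub_mul_sinh_add,
      cosh_sub_mul_cosh_add, Complex.sinh_two_mul, h.sinh_ςm_eq]
    simp only [mul_pow, h2, h3, h4] at h1 ⊢
    linear_combination Complex.sinh l ^ 2 * h1
  rw [kNorm, e]
  ring

theorem kNorm_ne_zero (h : p.BoundaryReparam) (hg : p.GenericInhom) (n : Fin N) :
    p.kNorm (-p.ξ n) ≠ 0 := by
  rw [h.kNorm_eq]
  refine mul_ne_zero (mul_ne_zero (pow_ne_zero _ (inv_ne_zero h.ςm_ne))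
    (mul_ne_zero (by norm_num) (pow_ne_zero _ h.κm_ne))) (mul_ne_zero (mul_ne_zero ?_ ?_)
      (mul_ne_zero ?_ ?_))
  · rw [sub_neg_eq_add, add_comm]; exact (hg.alpha_m_ne n).1
  · rw [← neg_ne_zero, ← Complex.sinh_neg, neg_add, neg_neg, neg_add_eq_sub]
    exact (hg.alpha_m_ne n).2
  · rw [← Complex.cosh_neg, neg_sub, sub_neg_eq_add, add_comm]; exact (hg.beta_m_ne n).1
  · rw [← Complex.cosh_neg, neg_add, neg_neg, ← sub_eq_add_neg]; exact (hg.beta_m_ne n).2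

theorem kFactor_ne_zero {ep : ℤˣ} (h : p.BoundaryReparam) (hgauge : p.GaugeCondition ep)
    (hcond : p.BoundaryCondition ep) (j : Fin N) :
    p.kFactor (p.gaugeT + ((N : ℂ) - 1 - 2 * (j : ℕ)) * p.η) ≠ 0 := by
  obtain ⟨m, hm⟩ := hgauge
  set t := p.gaugeT + ((N : ℂ) - 1 - 2 * (j : ℕ)) * p.η with ht
  -- A quadratic in `exp (t - τ₋)` with roots `exp (α₋ + β₋)` and `-exp (-(α₋ + β₋))`. These are the
  -- two cases `ε = 1` and `ε = -1` of the boundary condition, once the gauge condition is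
  -- substituted.
  have e : p.kFactor t = -((Complex.sinh p.ςm)⁻¹ * p.κm * Complex.exp p.τm) *
      ((Complex.exp (t - p.τm) - Complex.exp (p.αm + p.βm)) *
        (Complex.exp (t - p.τm) + Complex.exp (-(p.αm + p.βm)))) := by
    have h1 : Complex.exp p.ςm = p.κm * (Complex.exp (p.αm + p.βm) - Complex.exp (-(p.αm + p.βm))) := by
      rw [← Complex.cosh_add_sinh, h.sinh_ςm_eq, h.cosh_ςm_eq]
      have := Complex.sinh_add p.αm p.βm
      have h2 : Complex.sinh (p.αm + p.βm) =
        (Complex.exp (p.αm + p.βm) - Complex.exp (-(p.αm + p.βm))) / 2 := rfl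
      linear_combination 2 * p.κm * (h2 - this)
    have h3 : Complex.exp p.τm ≠ 0 := Complex.exp_ne_zero _
    have h4 : Complex.exp (p.αm + p.βm) ≠ 0 := Complex.exp_ne_zero _
    rw [kFactor, Complex.exp_add t, h1, two_mul]
    generalize (Complex.sinh p.ςm)⁻¹ = k
    simp only [Complex.exp_sub, Complex.exp_neg, Complex.exp_add t]
    field_simp
    ring
  rw [e]
  refine mul_ne_zero (neg_ne_zero.mpr (mul_ne_zero (mul_ne_zero (inv_ne_zero h.ςm_ne) h.κm_ne)
    (Complex.exp_ne_zero _))) (mul_ne_zero ?_ ?_)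
  · intro h0
    obtain ⟨k, hk⟩ := Complex.exp_eq_exp_iff_exists_int.mp (sub_eq_zero.mp h0)
    refine hcond j 1 (k - m) ?_
    rw [ht, gaugeT, hm] at hk
    simp only [sgn, Units.val_one, Int.cast_one, Int.cast_sub] at hk ⊢
    linear_combination hk
  · intro h0
    have h1 : Complex.exp (t - p.τm) = Complex.exp (-(p.αm + p.βm) + Real.pi * Complex.I) := by
      rw [Complex.exp_add_pi_mul_I]
      exact eq_neg_of_add_eq_zero_left h0
    obtain ⟨k, hk⟩ := Complex.exp_eq_exp_iff_exists_int.mp h1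
    refine hcond j (-1) (k - m) ?_
    rw [ht, gaugeT, hm] at hk
    simp only [sgn, Units.val_neg, Units.val_one, Int.cast_neg, Int.cast_one, Int.cast_sub] at hk ⊢
    linear_combination hk

/-- The function `𝐚_ε` with a shifted argument. -/
def aShift (p : Params N) (e : Signs) (x : ℂ) : ℂ := p.aEps e (x + p.η / 2)

theorem aShift_eq (e : Signs) (x : ℂ) : p.aShift e x =
    (sgn e.αp * sgn e.αm) / (Complex.sinh p.αp * Complex.cosh p.βp * (Complex.sinh p.αm * Complex.cosh p.βm)) *
      (Complex.sinh (x + sgn e.αp * p.αp) * Complex.cosh (x - sgn e.βp * p.βp) *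
        (Complex.sinh (x + sgn e.αm * p.αm) * Complex.cosh (x + sgn e.βm * p.βm))) := by
  rw [aShift, aEps, add_sub_cancel_right, sinh_sgn_mul, sinh_sgn_mul, cosh_sgn_mul, cosh_sgn_mul]
  simp only [div_eq_mul_inv, mul_inv, sgn_inv]
  ring

theorem aShift_neg_signs (e : Signs) (x : ℂ) : p.aShift (-e) x = p.aShift e (-x) := by
  have h : ∀ u : ℤˣ, sgn (-u) = -sgn u := fun u => by simp [sgn]
  have e1 : ∀ a b : ℂ, Complex.sinh (a + -b) = -Complex.sinh (-a + b) := fun a b => by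
    rw [← Complex.sinh_neg, neg_add, neg_neg]
  have e2 : ∀ a b : ℂ, Complex.cosh (a + -b) = Complex.cosh (-a + b) := fun a b => by
    rw [← Complex.cosh_neg, neg_add, neg_neg]
  have e3 : ∀ a b : ℂ, Complex.cosh (a - -b) = Complex.cosh (-a - b) := fun a b => by
    rw [← Complex.cosh_neg, neg_sub, sub_eq_add_neg, add_comm, sub_eq_add_neg]
  rw [aShift_eq, aShift_eq]
  change sgn (-e.αp) * sgn (-e.αm) / _ * (Complex.sinh (x + sgn (-e.αp) * p.αp) *
    Complex.cosh (x - sgn (-e.βp) * p.βp) * (Complex.sinh (x + sgn (-e.αm) * p.αm) *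
    Complex.cosh (x + sgn (-e.βm) * p.βm))) = _
  simp only [h, neg_mul, e1, e2, e3]
  ring

/-- Pairing the values at `x` and `-x` leaves products such as `sinh (x + α) sinh (-x + α)`, which
are even in `α`, so the signs drop out. -/
theorem aShift_mul_neg (e e' : Signs) (x : ℂ) :
    p.aShift e x * p.aShift e (-x) = p.aShift e' x * p.aShift e' (-x) := by
  have key : ∀ e : Signs, p.aShift e x * p.aShift e (-x) =
      (1 / (Complex.sinh p.αp * Complex.cosh p.βp * (Complex.sinh p.αm * Complex.cosh p.βm))) ^ 2 *
      ((Complex.sinh (x + p.αp) * Complex.sinh (-x + p.αp)) *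
        (Complex.cosh (x - p.βp) * Complex.cosh (-x - p.βp)) *
        (Complex.sinh (x + p.αm) * Complex.sinh (-x + p.αm)) *
        (Complex.cosh (x + p.βm) * Complex.cosh (-x + p.βm))) := by
    intro e
    rw [← sinh_sgn_pair e.αp x p.αp, ← sinh_sgn_pair e.αm x p.αm, ← cosh_sgn_pair e.βm x p.βm,
      ← cosh_sub_sgn_pair e.βp x p.βp,
      aShift_eq, aShift_eq, div_eq_mul_one_div]
    set k := 1 / (Complex.sinh p.αp * Complex.cosh p.βp * (Complex.sinh p.αm * Complex.cosh p.βm))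
    have h1 := sgn_mul_self e.αp
    have h2 := sgn_mul_self e.αm
    have h3 : (sgn e.αp * sgn e.αm) * (sgn e.αp * sgn e.αm) = 1 := by
      rw [mul_mul_mul_comm, h1, h2, one_mul]
    linear_combination (k ^ 2 * ((Complex.sinh (x + sgn e.αp * p.αp) * Complex.sinh (-x + sgn e.αp * p.αp)) *
        (Complex.cosh (x - sgn e.βp * p.βp) * Complex.cosh (-x - sgn e.βp * p.βp)) *
        (Complex.sinh (x + sgn e.αm * p.αm) * Complex.sinh (-x + sgn e.αm * p.αm)) *
        (Complex.cosh (x + sgn e.βm * p.βm) * Complex.cosh (-x + sgn e.βm * p.βm)))) * h3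
  rw [key, key]

theorem aShift_ne_zero (h : p.BoundaryReparam) (hg : p.GenericInhom) (e : Signs) (n : Fin N) :
    p.aShift e (p.ξ n) ≠ 0 ∧ p.aShift e (-p.ξ n) ≠ 0 := by
  have h0 : (sgn e.αp * sgn e.αm) /
      (Complex.sinh p.αp * Complex.cosh p.βp * (Complex.sinh p.αm * Complex.cosh p.βm)) ≠ 0 :=
    div_ne_zero (mul_ne_zero (sgn_ne_zero _) (sgn_ne_zero _))
      (mul_ne_zero (mul_ne_zero h.sinh_cosh_p_ne.1 h.sinh_cosh_p_ne.2)
        (mul_ne_zero h.sinh_cosh_m_ne.1 h.sinh_cosh_m_ne.2))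
  have h1 := sinh_add_sgn_ne_zero (hg.alpha_p_ne n) e.αp
  have h2 := sinh_add_sgn_ne_zero (hg.alpha_m_ne n) e.αm
  have h3 := cosh_add_sgn_ne_zero (hg.beta_p_ne n) e.βp
  have h4 := cosh_add_sgn_ne_zero (hg.beta_m_ne n) e.βm
  rw [aShift_eq, aShift_eq]
  exact ⟨mul_ne_zero h0 (mul_ne_zero (mul_ne_zero h1.1 h3.2.2.1) (mul_ne_zero h2.1 h4.1)),
    mul_ne_zero h0 (mul_ne_zero (mul_ne_zero h1.2 h3.2.2.2) (mul_ne_zero h2.2 h4.2.1))⟩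

theorem a_ne_zero (hp : p.SepInhom) (n : Fin N) : p.a (p.η / 2 - p.ξ n) ≠ 0 := by
  refine Finset.prod_ne_zero_iff.mpr fun k _ => ?_
  by_cases h : n = k
  · subst h
    rw [show p.η / 2 - p.ξ n - p.ξ n + p.η / 2 = -(2 * p.ξ n) + p.η by ring]
    exact hp.two_sub_ne n
  · rw [show p.η / 2 - p.ξ n - p.ξ k + p.η / 2 = -p.ξ n - p.ξ k + p.η by ring]
    exact hp.neg_eta_ne n k h

theorem d_ne_zero (hp : p.SepInhom) (n : Fin N) : p.d (-(p.η / 2 - p.ξ n)) ≠ 0 := by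
  refine Finset.prod_ne_zero_iff.mpr fun k _ => ?_
  rw [show -(p.η / 2 - p.ξ n) - p.ξ k - p.η / 2 = -(p.ξ k - p.ξ n + p.η) by ring, Complex.sinh_neg,
    neg_ne_zero]
  by_cases h : k = n
  · subst h
    rw [sub_self, zero_add]
    exact hp.eta_ne
  · exact hp.sub_eta_ne k n h

/-- The normalization depends on the sign quadruple only through `𝐚_ε`; the common constant cancels
in ratios of two normalizations. -/
theorem exists_aMinus_eq (h : p.BoundaryReparam) (hg : p.GenericInhom) (hp : p.SepInhom) (ep : ℤˣ)
    (n : Fin N) : ∃ c : ℂ, c ≠ 0 ∧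
      ∀ e : Signs, p.aMinus ep e (p.η / 2 - p.ξ n) = c * p.aShift e (-p.ξ n) := by
  have h1 := sinh_add_sgn_ne_zero (hg.alpha_p_ne n) ep
  have h3 := cosh_add_sgn_ne_zero (hg.beta_p_ne n) ep
  have hpp := h.sinh_cosh_p_ne
  refine ⟨(sgn ep * (-1) ^ N * (Complex.sinh p.αp * Complex.cosh p.βp) /
    (Complex.sinh (-p.ξ n + sgn ep * p.αp) * Complex.cosh (-p.ξ n - sgn ep * p.βp))) *
    p.a (p.η / 2 - p.ξ n) * p.d (-(p.η / 2 - p.ξ n)), ?_, ?_⟩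
  · exact mul_ne_zero (mul_ne_zero (div_ne_zero (mul_ne_zero (mul_ne_zero (sgn_ne_zero _)
      (pow_ne_zero _ (neg_ne_zero.mpr one_ne_zero))) (mul_ne_zero hpp.1 hpp.2))
      (mul_ne_zero h1.2 h3.2.2.2)) (a_ne_zero hp n)) (d_ne_zero hp n)
  · intro e
    rw [aMinus, gEps, gEpsShifted, aShift_eq, show p.η / 2 - p.ξ n - p.η / 2 = -p.ξ n by ring,
      sinh_sgn_mul, cosh_sgn_mul]
    have e1 : (Complex.sinh p.αp * Complex.cosh p.βp) *
        (Complex.sinh p.αp * Complex.cosh p.βp)⁻¹ = 1 := mul_inv_cancel₀ (mul_ne_zero hpp.1 hpp.2)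
    simp only [div_eq_mul_inv, mul_inv, sgn_inv] at e1 ⊢
    generalize (Complex.sinh p.αp)⁻¹ = x at *
    generalize (Complex.cosh p.βp)⁻¹ = y at *
    linear_combination (-(sgn ep * sgn e.αp * (-1) ^ N *
      (Complex.sinh (-p.ξ n + sgn e.αm * p.αm) * Complex.cosh (-p.ξ n + sgn e.βm * p.βm) *
        (sgn e.αm * (Complex.sinh p.αm)⁻¹ * (Complex.cosh p.βm)⁻¹)) *
      (Complex.sinh (-p.ξ n + sgn e.αp * p.αp) * Complex.cosh (-p.ξ n - sgn e.βp * p.βp) *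
        ((Complex.sinh (-p.ξ n + sgn ep * p.αp))⁻¹ * (Complex.cosh (-p.ξ n - sgn ep * p.βp))⁻¹)) *
      p.a (p.η * 2⁻¹ - p.ξ n) * p.d (-(p.η * 2⁻¹ - p.ξ n)))) * e1

theorem aMinus_ne_zero (h : p.BoundaryReparam) (hg : p.GenericInhom) (hp : p.SepInhom) (ep : ℤˣ)
    (e : Signs) (n : Fin N) : p.aMinus ep e (p.η / 2 - p.ξ n) ≠ 0 := by
  obtain ⟨c, hc, hA⟩ := exists_aMinus_eq h hg hp ep n
  rw [hA]
  exact mul_ne_zero hc (aShift_ne_zero h hg e n).2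

/-- The left side is `𝐚_ε(x) / 𝐚_ε'(-x)` in shifted arguments. By `aShift_mul_neg` it equals
`𝐚_ε'(x) / 𝐚_ε(-x)`, and reversing the argument amounts to reversing all signs. -/
theorem vCoef_mul_aMinus_div (h : p.BoundaryReparam) (hg : p.GenericInhom) (hp : p.SepInhom)
    (ep : ℤˣ) (e e' : Signs) (n : Fin N) :
    p.vCoef e n * (p.aMinus ep e (p.η / 2 - p.ξ n) / p.aMinus ep e' (p.η / 2 - p.ξ n)) =
      p.aEps e' (p.ξ n + p.η / 2) / p.aEps (-e) (p.ξ n + p.η / 2) := by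
  obtain ⟨c, hc, hA⟩ := exists_aMinus_eq h hg hp ep n
  rw [hA, hA, vCoef]
  change p.aShift e (p.ξ n) / p.aShift e (-p.ξ n) * _ = p.aShift e' (p.ξ n) / p.aShift (-e) (p.ξ n)
  rw [aShift_neg_signs]
  have h1 := (aShift_ne_zero h hg e n).2
  have h2 := (aShift_ne_zero h hg e' n).2
  have h3 := aShift_mul_neg (p := p) e e' (p.ξ n)
  field_simp
  linear_combination h3

end Params

/-! ### Vandermonde determinants. -/

section Vandermonde

variable {N : ℕ}

theorem exists_det_vandermonde_update (v : Fin N → ℂ) (n : Fin N) : ∃ r : ℂ, ∀ a : ℂ,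
    (Matrix.vandermonde (Function.update v n a)).det =
      r * ∏ k ∈ Finset.univ.erase n, (a - v k) := by
  refine ⟨∏ i ∈ Finset.univ.erase n, ((if n < i then -1 else 1) *
    ∏ j ∈ (Finset.Ioi i).erase n, (v j - v i)), fun a => ?_⟩
  have h1 : ∏ j ∈ Finset.Ioi n, (Function.update v n a j - Function.update v n a n) =
      ∏ i ∈ Finset.univ.erase n, if n < i then v i - a else 1 := by
    rw [← Finset.prod_filter]
    refine Finset.prod_congr ?_ fun j hj => ?_
    · ext j
      simp only [Finset.mem_Ioi, Finset.mem_filter, Finset.mem_erase, Finset.mem_univ, and_true]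
      exact ⟨fun h => ⟨h.ne', h⟩, fun h => h.2⟩
    · simp only [Finset.mem_filter, Finset.mem_erase] at hj
      rw [Function.update_of_ne hj.1.1, Function.update_self]
  have h2 : ∀ i ∈ Finset.univ.erase n,
      ∏ j ∈ Finset.Ioi i, (Function.update v n a j - Function.update v n a i) =
      (if i < n then a - v i else 1) * ∏ j ∈ (Finset.Ioi i).erase n, (v j - v i) := by
    intro i hi
    have hin := Finset.ne_of_mem_erase hi
    have e : ∏ j ∈ (Finset.Ioi i).erase n, (Function.update v n a j - Function.update v n a i) =
        ∏ j ∈ (Finset.Ioi i).erase n, (v j - v i) := by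
      refine Finset.prod_congr rfl fun j hj => ?_
      rw [Function.update_of_ne (Finset.ne_of_mem_erase hj), Function.update_of_ne hin]
    split_ifs with h
    · rw [← Finset.mul_prod_erase _ _ (Finset.mem_Ioi.mpr h), e, Function.update_self,
        Function.update_of_ne hin]
    · rw [← e, one_mul, Finset.erase_eq_of_notMem (by simpa using h)]
  rw [Matrix.det_vandermonde, ← Finset.mul_prod_erase _ _ (Finset.mem_univ n), h1,
    Finset.prod_congr rfl h2, ← Finset.prod_mul_distrib, ← Finset.prod_mul_distrib]
  refine Finset.prod_congr rfl fun i hi => ?_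
  rcases lt_or_gt_of_ne (Finset.ne_of_mem_erase hi) with h | h
  · rw [if_neg h.asymm, if_pos h, if_neg h.asymm]
    ring
  · rw [if_pos h, if_neg h.asymm, if_pos h]
    ring

theorem vdm_eq (x : Fin N → ℂ) :
    vdm x = (Matrix.vandermonde fun i => Complex.sinh (x i) ^ 2).det := by
  rw [vdm]
  congr 1
  ext i j
  rw [Matrix.of_apply, Matrix.vandermonde_apply, pow_mul]

/-- `cosh(2x)/2` and `sinh² x` differ by the constant `1/2`, and a Vandermonde determinant is
invariant under translation. -/
theorem vdm_eq_cosh (x : Fin N → ℂ) :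
    vdm x = (Matrix.of fun i j : Fin N => (Complex.cosh (2 * x i) / 2) ^ (j : ℕ)).det := by
  have e : (Matrix.of fun i j : Fin N => (Complex.cosh (2 * x i) / 2) ^ (j : ℕ)) =
      Matrix.vandermonde fun i => Complex.sinh (x i) ^ 2 + 1 / 2 := by
    ext i j
    rw [Matrix.of_apply, Matrix.vandermonde_apply, Complex.cosh_two_mul, Complex.cosh_sq]
    congr 1
    ring
  rw [e, Matrix.det_vandermonde_add, vdm_eq]

/-- The change of `vdm` when one of its arguments changes. -/
theorem vdm_update (x : Fin N → ℂ) (n : Fin N) (a b : ℂ) :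
    vdm (Function.update x n a) *
        ∏ k ∈ Finset.univ.erase n, (Complex.sinh b ^ 2 - Complex.sinh (x k) ^ 2) =
      vdm (Function.update x n b) *
        ∏ k ∈ Finset.univ.erase n, (Complex.sinh a ^ 2 - Complex.sinh (x k) ^ 2) := by
  obtain ⟨r, hr⟩ := exists_det_vandermonde_update (fun i => Complex.sinh (x i) ^ 2) n
  have e : ∀ c, vdm (Function.update x n c) =
      r * ∏ k ∈ Finset.univ.erase n, (Complex.sinh c ^ 2 - Complex.sinh (x k) ^ 2) := by
    intro c
    rw [vdm_eq, ← hr]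
    congr 2
    funext i
    by_cases h : i = n
    · subst h; simp
    · simp [h]
  rw [e, e]
  ring

/-- Expansion of a determinant whose rows are linear combinations. -/
theorem det_sum_rows {κ : Type} [Fintype κ] (w : Fin N → κ → ℂ) (g : Fin N → κ → Fin N → ℂ) :
    (Matrix.of fun i j => ∑ h, w i h * g i h j).det =
      ∑ h : Fin N → κ, (∏ i, w i (h i)) * (Matrix.of fun i j => g i (h i) j).det := by
  have h1 := (Matrix.detRowAlternating (R := ℂ) (n := Fin N)).toMultilinearMap.map_sum
    (fun i h => w i h • g i h)
  have e : (Matrix.of fun i j => ∑ h, w i h * g i h j) = fun i => ∑ h, w i h • g i h := by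
    funext i j
    simp
  have h2 : ∀ h : Fin N → κ, (Matrix.detRowAlternating (R := ℂ) (n := Fin N)).toMultilinearMap
      (fun i => w i (h i) • g i (h i)) =
      (∏ i, w i (h i)) * (Matrix.of fun i j => g i (h i) j).det := by
    intro h
    rw [MultilinearMap.map_smul_univ]
    rfl
  rw [e]
  simp only [h2] at h1
  exact h1

end Vandermonde

/-! ### The coefficients `u_n` and the norms in terms of Vandermonde determinants. -/

namespace Params

variable {N : ℕ} {p : Params N}

variable (p) in
/-- The quantity `V̂` of the points `ξ^{(1)}` at the sites of `s` and `ξ^{(0)}` elsewhere. -/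
def vdmOn (s : Finset (Fin N)) : ℂ := vdm fun n => p.xiS n (if n ∈ s then 1 else 0)

variable (p) in
/-- The differences `sinh² x - sinh² y` of the shifted inhomogeneities. -/
def sqDiff (n : Fin N) (h : Fin 2) (k : Fin N) (h' : Fin 2) : ℂ :=
  Complex.sinh (p.xiS n h) ^ 2 - Complex.sinh (p.xiS k h') ^ 2

theorem sqDiff_ne_zero (hg : p.GenericInhom) {n k : Fin N} (hnk : n ≠ k) (h h' : Fin 2) :
    p.sqDiff n h k h' ≠ 0 := by
  rw [sqDiff, ← sinh_sub_mul_sinh_add]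
  exact mul_ne_zero (sinh_ne_zero_of_forall_ne (hg.sub_ne n k hnk h h'))
    (sinh_ne_zero_of_forall_ne (hg.add_ne n k hnk h h'))

theorem vdm_xiS_ne_zero (hg : p.GenericInhom) (h : Fin N → Fin 2) :
    vdm (fun n => p.xiS n (h n)) ≠ 0 := by
  rw [vdm_eq, Matrix.det_vandermonde_ne_zero_iff]
  intro i j hij
  by_contra hne
  exact sqDiff_ne_zero hg hne (h i) (h j) (sub_eq_zero.mpr hij)

theorem vdmOn_insert {n : Fin N} {s : Finset (Fin N)} (hn : n ∉ s) :
    p.vdmOn (insert n s) *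
        ∏ k ∈ Finset.univ.erase n, p.sqDiff n 0 k (if k ∈ s then 1 else 0) =
      p.vdmOn s * ∏ k ∈ Finset.univ.erase n, p.sqDiff n 1 k (if k ∈ s then 1 else 0) := by
  have h := vdm_update (fun k => p.xiS k (if k ∈ s then 1 else 0)) n (p.xiS n 1) (p.xiS n 0)
  have e0 : Function.update (fun k => p.xiS k (if k ∈ s then 1 else 0)) n (p.xiS n 0) =
      fun k => p.xiS k (if k ∈ s then 1 else 0) := by
    funext k
    by_cases hk : k = n
    · subst hk; simp [hn]
    · simp [hk]
  have e1 : Function.update (fun k => p.xiS k (if k ∈ s then 1 else 0)) n (p.xiS n 1) =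
      fun k => p.xiS k (if k ∈ insert n s then 1 else 0) := by
    funext k
    by_cases hk : k = n
    · subst hk; simp
    · simp [hk]
  rw [e0, e1] at h
  exact h

/-- The factors `k ≠ n` of `a` and `d` regroup into differences of `sinh²` after inserting `sinh
(ξ_n - ξ_k) sinh (ξ_n + ξ_k)` on both sides. The factor `k = n` combines with the prefactor of `u_n`
to give the sign `-1`. -/
theorem uCoef_eq (hg : p.GenericInhom) (hp : p.SepInhom) (n : Fin N) :
    p.uCoef n * ∏ k ∈ Finset.univ.erase n, (p.sqDiff n 1 k 0 * p.sqDiff n 1 k 1) =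
      -∏ k ∈ Finset.univ.erase n, (p.sqDiff n 0 k 0 * p.sqDiff n 0 k 1) := by
  have e : ∀ k, p.sqDiff n 1 k 0 * p.sqDiff n 1 k 1 =
      (Complex.sinh (p.ξ n - p.ξ k) * Complex.sinh (p.ξ n + p.ξ k)) *
        -(Complex.sinh (-p.ξ n + p.η / 2 - p.ξ k + p.η / 2) *
          Complex.sinh (p.ξ n - p.η / 2 - p.ξ k - p.η / 2)) := by
    intro k
    rw [sqDiff, sqDiff, ← sinh_sub_mul_sinh_add, ← sinh_sub_mul_sinh_add, neg_mul_eq_neg_mul,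
      ← Complex.sinh_neg]
    rw [show p.xiS n 1 - p.xiS k 0 = p.ξ n - p.η / 2 - p.ξ k - p.η / 2 by simp [xiS]; ring,
      show p.xiS n 1 + p.xiS k 0 = p.ξ n + p.ξ k by simp [xiS]; ring,
      show p.xiS n 1 - p.xiS k 1 = p.ξ n - p.ξ k by simp [xiS],
      show p.xiS n 1 + p.xiS k 1 = -(-p.ξ n + p.η / 2 - p.ξ k + p.η / 2) by simp [xiS]; ring]
    ring
  have e' : ∀ k, p.sqDiff n 0 k 0 * p.sqDiff n 0 k 1 =
      (Complex.sinh (p.ξ n - p.ξ k) * Complex.sinh (p.ξ n + p.ξ k)) *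
        -(Complex.sinh (p.ξ n + p.η / 2 - p.ξ k + p.η / 2) *
          Complex.sinh (-p.ξ n - p.η / 2 - p.ξ k - p.η / 2)) := by
    intro k
    rw [sqDiff, sqDiff, ← sinh_sub_mul_sinh_add, ← sinh_sub_mul_sinh_add, ← mul_neg,
      ← Complex.sinh_neg]
    rw [show p.xiS n 0 - p.xiS k 0 = p.ξ n - p.ξ k by simp [xiS],
      show p.xiS n 0 + p.xiS k 0 = -(-p.ξ n - p.η / 2 - p.ξ k - p.η / 2) by simp [xiS]; ring,
      show p.xiS n 0 - p.xiS k 1 = p.ξ n + p.η / 2 - p.ξ k + p.η / 2 by simp [xiS]; ring,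
      show p.xiS n 0 + p.xiS k 1 = p.ξ n + p.ξ k by simp [xiS]; ring]
    ring
  have h1 : p.a (-p.ξ n + p.η / 2) ≠ 0 := by
    have := a_ne_zero hp n
    rwa [show p.η / 2 - p.ξ n = -p.ξ n + p.η / 2 by ring] at this
  have h2 : p.d (p.ξ n - p.η / 2) ≠ 0 := by
    have := d_ne_zero hp n
    rwa [neg_sub] at this
  have h3 := hg.sinh_sub_eta_ne n
  have h4 := hg.sinh_add_eta_ne n
  have key : p.uCoef n * (p.a (-p.ξ n + p.η / 2) * p.d (p.ξ n - p.η / 2)) *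
        (Complex.sinh (2 * p.ξ n + p.η)) = Complex.sinh (2 * p.ξ n - p.η) *
        (p.a (p.ξ n + p.η / 2) * p.d (-p.ξ n - p.η / 2)) := by
    rw [uCoef]
    generalize p.a (-p.ξ n + p.η / 2) = x at *
    generalize p.d (p.ξ n - p.η / 2) = y at *
    generalize p.a (p.ξ n + p.η / 2) * p.d (-p.ξ n - p.η / 2) = z at *
    field_simp
  simp only [a, d, ← Finset.prod_mul_distrib] at key
  rw [← Finset.mul_prod_erase _ _ (Finset.mem_univ n),
    ← Finset.mul_prod_erase Finset.univ (fun k => Complex.sinh (p.ξ n + p.η / 2 - p.ξ k + p.η / 2) *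
      Complex.sinh (-p.ξ n - p.η / 2 - p.ξ k - p.η / 2)) (Finset.mem_univ n)] at key
  have f1 : Complex.sinh (-p.ξ n + p.η / 2 - p.ξ n + p.η / 2) = -Complex.sinh (2 * p.ξ n - p.η) := by
    rw [← Complex.sinh_neg]; congr 1; ring
  have f2 : Complex.sinh (p.ξ n - p.η / 2 - p.ξ n - p.η / 2) = -Complex.sinh p.η := by
    rw [← Complex.sinh_neg]; congr 1; ring
  have f3 : Complex.sinh (p.ξ n + p.η / 2 - p.ξ n + p.η / 2) = Complex.sinh p.η := by
    congr 1; ring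
  have f4 : Complex.sinh (-p.ξ n - p.η / 2 - p.ξ n - p.η / 2) = -Complex.sinh (2 * p.ξ n + p.η) := by
    rw [← Complex.sinh_neg]; congr 1; ring
  rw [f1, f2, f3, f4] at key
  simp only [Finset.prod_mul_distrib] at key
  simp only [e, e', Finset.prod_mul_distrib, Finset.prod_neg]
  have h5 := hp.eta_ne
  have h6 : Complex.sinh (2 * p.ξ n - p.η) * Complex.sinh p.η * Complex.sinh (2 * p.ξ n + p.η) ≠ 0 :=
    mul_ne_zero (mul_ne_zero h3 h5) h4
  refine mul_left_cancel₀ h6 ?_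
  generalize (∏ k ∈ Finset.univ.erase n, Complex.sinh (p.ξ n - p.ξ k)) = A
  generalize (∏ k ∈ Finset.univ.erase n, Complex.sinh (p.ξ n + p.ξ k)) = A'
  generalize (-1 : ℂ) ^ _ = B
  linear_combination A * A' * B * key

/-- The identity between the two forms of the coefficients of the left separate states. -/
theorem prod_uCoef_mul_vdmOn (hg : p.GenericInhom) (hp : p.SepInhom) (s : Finset (Fin N)) :
    (∏ n ∈ s, p.uCoef n) * p.vdmOn s * p.vdmOn Finset.univ =
      (∏ _n ∈ s, (-1)) * p.vdmOn sᶜ * p.vdmOn ∅ := by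
  induction s using Finset.induction_on with
  | empty => simp; ring
  | insert n s hn ih =>
    have hU := uCoef_eq hg hp n
    have h1 := vdmOn_insert (p := p) hn
    have hn' : n ∉ (insert n s)ᶜ := by simp
    have hc : insert n (insert n s)ᶜ = sᶜ := by
      ext k
      by_cases hk : k = n
      · subst hk; simp [hn]
      · simp [hk]
    have h2 := vdmOn_insert (p := p) hn'
    rw [hc] at h2
    have hne : ∀ (h : Fin 2) (f : Fin N → Fin 2),
        ∏ k ∈ Finset.univ.erase n, p.sqDiff n h k (f k) ≠ 0 := fun h f =>
      Finset.prod_ne_zero_iff.mpr fun k hk =>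
        sqDiff_ne_zero hg (Finset.ne_of_mem_erase hk).symm _ _
    -- For each other site, exactly one of `s` and the complement of `insert n s` contains it. The
    -- two Vandermonde ratios, for `s` and for its complement, therefore multiply to the full
    -- product in `uCoef_eq`.
    have hsplit : ∀ h : Fin 2, ∏ k ∈ Finset.univ.erase n, (p.sqDiff n h k 0 * p.sqDiff n h k 1) =
        (∏ k ∈ Finset.univ.erase n, p.sqDiff n h k (if k ∈ s then 1 else 0)) *
          ∏ k ∈ Finset.univ.erase n, p.sqDiff n h k (if k ∈ (insert n s)ᶜ then 1 else 0) := by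
      intro h
      rw [← Finset.prod_mul_distrib]
      refine Finset.prod_congr rfl fun k hk => ?_
      have := Finset.ne_of_mem_erase hk
      by_cases hks : k ∈ s
      · simp [this, hks, mul_comm]
      · simp [this, hks]
    rw [hsplit, hsplit] at hU
    have a0 := hne 0 fun k => if k ∈ s then 1 else 0
    have a1 := hne 1 fun k => if k ∈ s then 1 else 0
    have b0 := hne 0 fun k => if k ∈ (insert n s)ᶜ then 1 else 0
    have b1 := hne 1 fun k => if k ∈ (insert n s)ᶜ then 1 else 0
    rw [Finset.prod_insert hn, Finset.prod_insert hn]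
    generalize (∏ k ∈ Finset.univ.erase n, p.sqDiff n 0 k (if k ∈ s then 1 else 0)) = A0 at *
    generalize (∏ k ∈ Finset.univ.erase n, p.sqDiff n 1 k (if k ∈ s then 1 else 0)) = A1 at *
    generalize (∏ k ∈ Finset.univ.erase n, p.sqDiff n 0 k (if k ∈ (insert n s)ᶜ then 1 else 0)) = B0
      at *
    generalize (∏ k ∈ Finset.univ.erase n, p.sqDiff n 1 k (if k ∈ (insert n s)ᶜ then 1 else 0)) = B1
      at *
    refine mul_left_cancel₀ (mul_ne_zero (mul_ne_zero a0 a1) b1) ?_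
    generalize p.vdmOn (insert n s) = W1 at *
    generalize p.vdmOn (insert n s)ᶜ = W0 at *
    generalize p.vdmOn s = V0 at *
    generalize p.vdmOn sᶜ = V1 at *
    generalize p.uCoef n = u at *
    generalize (∏ n ∈ s, p.uCoef n) = Us at *
    generalize (∏ _n ∈ s, (-1 : ℂ)) = S at *
    generalize p.vdmOn Finset.univ = Y at *
    generalize p.vdmOn ∅ = Z at *
    linear_combination A1 * u * B1 * Us * Y * h1 + A1 * Us * V0 * Y * hU - A1 * A0 * B0 * ih
      - A1 * A0 * S * Z * h2

/-- The norms of the left and right separate-variable states. -/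
theorem pairing_onSet (hp : p.SepInhom) (hg : p.GenericInhom) (hκ : p.κm ≠ 0)
    (hς : Complex.sinh p.ςm ≠ 0) (T : ℂ) (s : Finset (Fin N)) :
    p.pairing T (sᶜ).toList s.toList * p.vdmOn s *
        ∏ j ∈ s, (Complex.exp (2 * p.ξ j) * (p.kCoef j)⁻¹) =
      p.pairing T Finset.univ.toList [] * p.vdmOn ∅ := by
  induction s using Finset.induction_on with
  | empty => simp
  | insert n s hn ih =>
    have hn' : n ∉ (insert n s)ᶜ := by simp
    have hc : insert n (insert n s)ᶜ = sᶜ := by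
      ext k
      by_cases hk : k = n
      · subst hk; simp [hn]
      · simp [hk]
    have hr := p.normRatio hp hκ hς (Finset.nodup_toList (insert n s)ᶜ) s.nodup_toList
      (by rwa [Finset.mem_toList]) (by rwa [Finset.mem_toList]) T
    have e1 : p.pairing T (insert n s)ᶜ.toList (n :: s.toList) =
        p.pairing T (insert n s)ᶜ.toList (insert n s).toList := by
      rw [pairing, pairing, p.transposed.braList_perm hp.transposed (Finset.toList_insert hn).symm
        (by simp [hn, Finset.nodup_toList])]
    have e2 : p.pairing T (n :: (insert n s)ᶜ.toList) s.toList =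
        p.pairing T sᶜ.toList s.toList := by
      have : (n :: (insert n s)ᶜ.toList).Perm sᶜ.toList := by
        rw [← hc]
        exact (Finset.toList_insert hn').symm
      rw [pairing, pairing, p.braList_perm hp this (by simp [Finset.nodup_toList])]
    -- The multipliers at `ξ_n` and `-ξ_n` are the products of differences attached to `ξ_n^(0)` and
    -- `ξ_n^(1)`, so the norm ratio is the inverse of the Vandermonde ratio up to `exp (2ξ_n)` and
    -- `k_n`.
    have f : ∀ l h, (l = p.ξ n ∧ h = 0) ∨ (l = -p.ξ n ∧ h = 1) → p.restEv n (insert n s)ᶜ.toList l =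
        ∏ k ∈ Finset.univ.erase n, p.sqDiff n h k (if k ∈ s then 1 else 0) := by
      intro l h hl
      refine Finset.prod_congr rfl fun k hk => ?_
      have hkn := Finset.ne_of_mem_erase hk
      rw [siteEv, sqDiff, ← sinh_sub_mul_sinh_add]
      have es : ∀ x y : ℂ, Complex.sinh x * Complex.sinh y = Complex.sinh (-x) * Complex.sinh (-y) := by
        intro x y; simp
      by_cases hks : k ∈ s
      · rw [if_neg (by simp [hks, hkn]), if_pos hks]
        rcases hl with ⟨rfl, rfl⟩ | ⟨rfl, rfl⟩
        · congr 2 <;> simp [xiS] <;> ring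
        · rw [es, mul_comm]
          congr 2 <;> simp [xiS] <;> ring
      · rw [if_pos (by simp [hks, hkn]), if_neg hks]
        rcases hl with ⟨rfl, rfl⟩ | ⟨rfl, rfl⟩
        · congr 2 <;> simp [xiS] <;> ring
        · rw [es, mul_comm]
          congr 2 <;> simp [xiS] <;> ring
    have h1 := vdmOn_insert (p := p) hn
    have a1 : ∏ k ∈ Finset.univ.erase n, p.sqDiff n 1 k (if k ∈ s then 1 else 0) ≠ 0 :=
      Finset.prod_ne_zero_iff.mpr fun k hk =>
        sqDiff_ne_zero hg (Finset.ne_of_mem_erase hk).symm _ _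
    rw [NormRatio, e1, e2, f (p.ξ n) 0 (Or.inl ⟨rfl, rfl⟩), f (-p.ξ n) 1 (Or.inr ⟨rfl, rfl⟩)] at hr
    rw [Finset.prod_insert hn, ← ih, kCoef, two_mul (p.ξ n), Complex.exp_add, ← two_mul]
    rw [Complex.exp_neg] at hr
    have h3 := hg.sinh_sub_eta_ne n
    have h4 := hg.sinh_add_eta_ne n
    have h5 := Complex.exp_ne_zero (p.ξ n)
    generalize (∏ k ∈ Finset.univ.erase n, p.sqDiff n 0 k (if k ∈ s then 1 else 0)) = A0 at *
    generalize (∏ k ∈ Finset.univ.erase n, p.sqDiff n 1 k (if k ∈ s then 1 else 0)) = A1 at *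
    generalize (∏ j ∈ s, (Complex.exp (2 * p.ξ j) * (p.kCoef j)⁻¹)) = Z
    generalize p.pairing T (insert n s)ᶜ.toList (insert n s).toList = F1 at *
    generalize p.pairing T sᶜ.toList s.toList = F0 at *
    generalize p.vdmOn (insert n s) = W at *
    generalize p.vdmOn s = V at *
    generalize Complex.exp (p.ξ n) = x at *
    generalize Complex.sinh (2 * p.ξ n - p.η) = y at *
    generalize Complex.sinh (2 * p.ξ n + p.η) = w at *
    field_simp at hr ⊢
    refine mul_left_cancel₀ a1 ?_
    linear_combination Z * W * hr + Z * w * F0 * h1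

end Params

/-! ### Biorthogonality and the scalar product. -/

theorem prod_onSet {N : ℕ} (h : Fin N → Fin 2) (f : Fin N → ℂ) :
    ∏ j ∈ Params.onSet h, f j = ∏ j, f j ^ (h j : ℕ) := by
  rw [Params.onSet, Finset.prod_filter]
  refine Finset.prod_congr rfl fun j _ => ?_
  generalize h j = b
  fin_cases b <;> simp

namespace Params

variable {N : ℕ} {p : Params N}

theorem vdmOn_onSet (h : Fin N → Fin 2) : p.vdmOn (onSet h) = vdm fun n => p.xiS n (h n) := by
  rw [vdmOn]
  congr 1
  funext n
  simp only [mem_onSet]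
  generalize h n = b
  fin_cases b <;> simp

theorem vdmOn_compl_onSet (h : Fin N → Fin 2) :
    p.vdmOn (onSet h)ᶜ = vdm fun n => p.xiS n (1 - h n) := by
  have e : (onSet h)ᶜ = onSet fun n => 1 - h n := by
    ext n
    rw [Finset.mem_compl, mem_onSet, mem_onSet]
    generalize h n = b
    fin_cases b <;> simp
  rw [e, vdmOn_onSet]

theorem vdmOn_empty : p.vdmOn ∅ = vdm fun n => p.xiS n 0 := by simp [vdmOn]

theorem vdmOn_univ : p.vdmOn Finset.univ = vdm fun n => p.xiS n 1 := by simp [vdmOn]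

/-- The two forms of the left separate states agree. -/
theorem separateBra_eq_bis (hg : p.GenericInhom) (hp : p.SepInhom) (ep : ℤˣ) (e : Signs)
    (Q : ℂ → ℂ) : p.separateBra ep e Q = p.separateBraBis ep e Q := by
  rw [separateBra, separateBraBis, mul_smul]
  congr 1
  rw [Finset.smul_sum]
  refine Finset.sum_congr rfl fun h _ => ?_
  rw [smul_smul]
  congr 1
  have key := prod_uCoef_mul_vdmOn hg hp (onSet h)
  rw [prod_onSet, prod_onSet, vdmOn_onSet, vdmOn_compl_onSet, vdmOn_empty, vdmOn_univ] at key
  have h1 : vdm (fun n => p.xiS n 1) ≠ 0 := vdm_xiS_ne_zero hg fun _ => 1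
  have e1 : ∏ n, (p.uCoef n * p.vCoef e n) ^ (h n : ℕ) * Q (p.xiS n (h n)) =
      (∏ n, p.uCoef n ^ (h n : ℕ)) * ∏ n, p.vCoef e n ^ (h n : ℕ) * Q (p.xiS n (h n)) := by
    rw [← Finset.prod_mul_distrib]
    exact Finset.prod_congr rfl fun n _ => by rw [mul_pow, mul_assoc]
  have e2 : ∏ n, (-p.vCoef e n) ^ (h n : ℕ) * Q (p.xiS n (h n)) =
      (∏ n, (-1) ^ (h n : ℕ)) * ∏ n, p.vCoef e n ^ (h n : ℕ) * Q (p.xiS n (h n)) := by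
    rw [← Finset.prod_mul_distrib]
    exact Finset.prod_congr rfl fun n _ => by rw [neg_pow, mul_assoc]
  rw [e1, e2]
  generalize (∏ n, p.uCoef n ^ (h n : ℕ)) = U at *
  generalize (∏ n, p.vCoef e n ^ (h n : ℕ) * Q (p.xiS n (h n))) = W at *
  generalize (∏ n : Fin N, (-1 : ℂ) ^ (h n : ℕ)) = S at *
  generalize Complex.exp _ = x
  field_simp
  linear_combination W * x * key

/-- Orthogonality and norms of the separate-variable states, and the non-vanishing of the
normalization. -/
theorem sovStates_orthogonality {ep : ℤˣ} (hr : p.BoundaryReparam) (hgauge : p.GaugeCondition ep)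
    (hn : p.GaugeNondegenerate) (hg : p.GenericInhom) (hcond : p.BoundaryCondition ep) :
    (∀ e : Signs, p.normConst ep e ≠ 0) ∧
    (∀ (e e' : Signs) (h h' : Fin N → Fin 2), h ≠ h' →
      (p.sovBra ep e h ᵥ* (p.gaugeSq p.β)⁻¹) ⬝ᵥ (p.gaugeSq p.β *ᵥ p.sovKet ep e' h') = 0) ∧
    (∀ (e e' : Signs) (h : Fin N → Fin 2),
      (p.sovBra ep e h ᵥ* (p.gaugeSq p.β)⁻¹) ⬝ᵥ (p.gaugeSq p.β *ᵥ p.sovKet ep e' h) *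
        vdm (fun n => p.xiS n (h n)) = p.normConst ep e *
          ∏ j, (p.aMinus ep e (p.η / 2 - p.ξ j) / p.aMinus ep e' (p.η / 2 - p.ξ j) *
            Complex.exp (2 * p.ξ j)) ^ (h j : ℕ)) := by
  have hp := sepInhom_of_generic hg hn.sinh_eta_ne
  have hA := fun e => aMinus_ne_zero hr hg hp ep e
  obtain ⟨c, c', hc, hc', hbra, hket, hnorm⟩ := p.exists_sovStates hp hn
  refine ⟨fun e => ?_, fun e e' h h' hne => ?_, fun e e' h => ?_⟩
  · rw [hnorm]
    refine mul_ne_zero (vdm_xiS_ne_zero hg fun _ => 0) (mul_ne_zero (mul_ne_zero (mul_ne_zero hc hc')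
      (Finset.prod_ne_zero_iff.mpr fun j _ =>
        mul_ne_zero (inv_ne_zero (hA e j)) (Complex.exp_ne_zero _))) ?_)
    exact p.pairing_univ_ne_zero hp hr.κm_ne hr.ςm_ne (kNorm_ne_zero hr hg)
      (kFactor_ne_zero hr hgauge hcond)
  · rw [hbra, hket, smul_dotProduct, dotProduct_smul]
    -- The row carries the sites with `h = 0` and the column those with `h' = 1`. A site where `h`
    -- and `h'` differ thus lies in both or in neither, as `pairing_eq_zero` requires.
    obtain ⟨n, hn'⟩ := Function.ne_iff.mp hne
    have h0 := p.pairing_eq_zero hp hr.κm_ne hr.ςm_ne (Finset.nodup_toList (onSet h)ᶜ)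
      (Finset.nodup_toList (onSet h')) (n := n) (by
        rw [Finset.mem_toList, Finset.mem_toList, Finset.mem_compl, mem_onSet, mem_onSet]
        omega) p.gaugeT
    rw [pairing] at h0
    rw [h0, smul_zero, smul_zero]
  · have key := pairing_onSet hp hg hr.κm_ne hr.ςm_ne p.gaugeT (onSet h)
    rw [prod_onSet, vdmOn_onSet, vdmOn_empty] at key
    rw [hbra, hket, smul_dotProduct, dotProduct_smul, hnorm, ← pairing]
    simp only [smul_eq_mul]
    have e1 : (∏ j, ((p.aMinus ep e (p.η / 2 - p.ξ j))⁻¹ *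
          Complex.exp (-(2 * p.ξ j))) ^ (1 - (h j : ℕ))) *
        (∏ j, ((p.kCoef j * p.aMinus ep e' (p.η / 2 - p.ξ j))⁻¹ *
          Complex.exp (2 * p.ξ j)) ^ (h j : ℕ)) =
        (∏ j, ((p.aMinus ep e (p.η / 2 - p.ξ j))⁻¹ * Complex.exp (-(2 * p.ξ j)))) *
        (∏ j, (p.aMinus ep e (p.η / 2 - p.ξ j) / p.aMinus ep e' (p.η / 2 - p.ξ j) *
            Complex.exp (2 * p.ξ j)) ^ (h j : ℕ)) *
        ∏ j, (Complex.exp (2 * p.ξ j) * (p.kCoef j)⁻¹) ^ (h j : ℕ) := by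
      rw [← Finset.prod_mul_distrib, ← Finset.prod_mul_distrib, ← Finset.prod_mul_distrib]
      refine Finset.prod_congr rfl fun j _ => ?_
      have h1 := hA e j
      have h2 := hA e' j
      have h3 := Complex.exp_ne_zero (2 * p.ξ j)
      rw [Complex.exp_neg, mul_inv]
      generalize (p.kCoef j)⁻¹ = k
      rcases fin_two_val (h j) with h0 | h0
      · simp [h0]
      · simp only [h0, pow_one, Nat.sub_self, pow_zero, one_mul]
        generalize p.aMinus ep e (p.η / 2 - p.ξ j) = x at *
        generalize p.aMinus ep e' (p.η / 2 - p.ξ j) = y at *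
        field_simp
    linear_combination c * c' * p.pairing p.gaugeT (onSet h)ᶜ.toList (onSet h).toList *
      vdm (fun n => p.xiS n (h n)) * e1 + c * c' *
      (∏ j, ((p.aMinus ep e (p.η / 2 - p.ξ j))⁻¹ * Complex.exp (-(2 * p.ξ j)))) *
        (∏ j, (p.aMinus ep e (p.η / 2 - p.ξ j) / p.aMinus ep e' (p.η / 2 - p.ξ j) *
            Complex.exp (2 * p.ξ j)) ^ (h j : ℕ)) * key

/-- The scalar product of separate states. -/
theorem separateBra_dotProduct_separateKet {ep : ℤˣ} (hr : p.BoundaryReparam)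
    (hgauge : p.GaugeCondition ep) (hn : p.GaugeNondegenerate) (hg : p.GenericInhom)
    (hcond : p.BoundaryCondition ep) (e e' : Signs) (P Q : ℂ → ℂ) :
    p.separateBra ep e Q ⬝ᵥ p.separateKet ep e' P =
      1 / p.normConst ep e' * (vdm (fun n => p.xiS n 0) / vdm (fun n => p.xiS n 1)) *
        (Matrix.of fun i j : Fin N => ∑ h : Fin 2,
          (-(p.aEps e' (p.ξ i + p.η / 2) / p.aEps (-e) (p.ξ i + p.η / 2))) ^ (h : ℕ) *
            P (p.xiS i h) * Q (p.xiS i h) *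
            (Complex.cosh (2 * p.xiS i (1 - h)) / 2) ^ (j : ℕ)).det := by
  have hp := sepInhom_of_generic hg hn.sinh_eta_ne
  obtain ⟨hN, horth, hnorm⟩ := sovStates_orthogonality hr hgauge hn hg hcond
  rw [separateBra_eq_bis hg hp, separateBraBis, separateKet,
    det_sum_rows (fun i (h : Fin 2) => (-(p.aEps e' (p.ξ i + p.η / 2) /
      p.aEps (-e) (p.ξ i + p.η / 2))) ^ (h : ℕ) * P (p.xiS i h) * Q (p.xiS i h))
      fun i (h : Fin 2) j => (Complex.cosh (2 * p.xiS i (1 - h)) / 2) ^ (j : ℕ)]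
  rw [smul_dotProduct, dotProduct_smul, sum_dotProduct]
  simp only [smul_dotProduct, smul_eq_mul]
  simp only [dotProduct_sum, dotProduct_smul, smul_eq_mul]
  have hs : ∀ h : Fin N → Fin 2, ∑ h' : Fin N → Fin 2,
      (∏ n, P (p.xiS n (h' n))) * Complex.exp (-∑ j, ((h' j : ℕ) : ℂ) * p.ξ j) *
        vdm (fun n => p.xiS n (h' n)) *
        ((p.sovBra ep e h ᵥ* (p.gaugeSq p.β)⁻¹) ⬝ᵥ (p.gaugeSq p.β *ᵥ p.sovKet ep e' h')) =
      (∏ n, P (p.xiS n (h n))) * Complex.exp (-∑ j, ((h j : ℕ) : ℂ) * p.ξ j) *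
        (p.normConst ep e *
          ∏ j, (p.aMinus ep e (p.η / 2 - p.ξ j) / p.aMinus ep e' (p.η / 2 - p.ξ j) *
            Complex.exp (2 * p.ξ j)) ^ (h j : ℕ)) := by
    intro h
    rw [Finset.sum_eq_single h, ← hnorm]
    · ring
    · intro h' _ hne
      rw [horth e e' h h' hne.symm, mul_zero]
    · simp
  simp only [hs]
  rw [Finset.mul_sum, Finset.mul_sum, Finset.mul_sum]
  refine Finset.sum_congr rfl fun h _ => ?_
  rw [vdm_eq_cosh fun n => p.xiS n (1 - h n)]
  have hexp : Complex.exp (-∑ j, ((h j : ℕ) : ℂ) * p.ξ j) =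
      ∏ j, Complex.exp (-p.ξ j) ^ (h j : ℕ) := by
    rw [← Finset.sum_neg_distrib, Complex.exp_sum]
    refine Finset.prod_congr rfl fun j _ => ?_
    rw [← Complex.exp_nat_mul, mul_neg]
  -- The factors `exp (-ξ_j)` of the left and right states together cancel the `exp (2ξ_j)` of the
  -- norm, and `v_n` combines with the ratio of normalizations into the quotient of `𝐚` functions.
  have e1 : (∏ i, (-(p.aEps e' (p.ξ i + p.η / 2) / p.aEps (-e) (p.ξ i + p.η / 2))) ^ (h i : ℕ) *
        P (p.xiS i (h i)) * Q (p.xiS i (h i))) =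
      (∏ n, (-p.vCoef e n) ^ (h n : ℕ) * Q (p.xiS n (h n))) * (∏ n, P (p.xiS n (h n))) *
        (∏ j, Complex.exp (-p.ξ j) ^ (h j : ℕ)) * (∏ j, Complex.exp (-p.ξ j) ^ (h j : ℕ)) *
        ∏ j, (p.aMinus ep e (p.η / 2 - p.ξ j) / p.aMinus ep e' (p.η / 2 - p.ξ j) *
            Complex.exp (2 * p.ξ j)) ^ (h j : ℕ) := by
    simp only [← Finset.prod_mul_distrib]
    refine Finset.prod_congr rfl fun n _ => ?_
    rw [← vCoef_mul_aMinus_div hr hg hp ep e e' n]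
    have h1 : Complex.exp (-p.ξ n) * Complex.exp (-p.ξ n) * Complex.exp (2 * p.ξ n) = 1 := by
      rw [← Complex.exp_add, ← Complex.exp_add, ← Complex.exp_zero]
      congr 1
      ring
    have h2 : (-(p.vCoef e n * (p.aMinus ep e (p.η / 2 - p.ξ n) /
        p.aMinus ep e' (p.η / 2 - p.ξ n)))) ^ (h n : ℕ) =
        (-p.vCoef e n) ^ (h n : ℕ) * Complex.exp (-p.ξ n) ^ (h n : ℕ) *
          Complex.exp (-p.ξ n) ^ (h n : ℕ) * (p.aMinus ep e (p.η / 2 - p.ξ n) /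
          p.aMinus ep e' (p.η / 2 - p.ξ n) * Complex.exp (2 * p.ξ n)) ^ (h n : ℕ) := by
      rw [← mul_pow, ← mul_pow, ← mul_pow]
      congr 1
      linear_combination (p.vCoef e n * (p.aMinus ep e (p.η / 2 - p.ξ n) /
        p.aMinus ep e' (p.η / 2 - p.ξ n))) * h1
    rw [h2]
    ring
  rw [e1, hexp]
  have h3 := hN e
  have h4 := hN e'
  generalize (Matrix.of fun i j : Fin N => (Complex.cosh (2 * p.xiS i (1 - h i)) / 2) ^ (j : ℕ)).det = D
  generalize p.normConst ep e = x at *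
  generalize p.normConst ep e' = y at *
  field_simp

end Params

end OpenXXZ
end

theorem proposition5p1 {N : ℕ} (p : OpenXXZ.Params N) (ep : ℤˣ)
    (hreparam : p.BoundaryReparam)
    (hgauge : p.GaugeCondition ep)
    (hnondeg : p.GaugeNondegenerate)
    (hgeneric : p.GenericInhom)
    (hcond : p.BoundaryCondition ep)
    (ε ε' : OpenXXZ.Signs) (hε : ε.IsAdmissible) (hε' : ε'.IsAdmissible)
    {np nq : ℕ} (pr : Fin np → ℂ) (qr : Fin nq → ℂ) :
    p.normConst ep ε ≠ 0 ∧ p.normConst ep ε' ≠ 0 ∧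
    p.separateBra ep ε (OpenXXZ.trigPoly qr) = p.separateBraBis ep ε (OpenXXZ.trigPoly qr) ∧
    p.separateBra ep ε (OpenXXZ.trigPoly qr) ⬝ᵥ p.separateKet ep ε' (OpenXXZ.trigPoly pr) =
      1 / p.normConst ep ε' *
        (OpenXXZ.vdm (fun n => p.xiS n 0) / OpenXXZ.vdm (fun n => p.xiS n 1)) *
        (Matrix.of fun i j : Fin N => ∑ h : Fin 2,
          (-(p.aEps ε' (p.ξ i + p.η / 2) / p.aEps (-ε) (p.ξ i + p.η / 2))) ^ (h : ℕ) *
            OpenXXZ.trigPoly pr (p.xiS i h) * OpenXXZ.trigPoly qr (p.xiS i h) *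
            (Complex.cosh (2 * p.xiS i (1 - h)) / 2) ^ (j : ℕ)).det := by
  obtain ⟨hN, -, -⟩ :=
    OpenXXZ.Params.sovStates_orthogonality hreparam hgauge hnondeg hgeneric hcond
  exact ⟨hN ε, hN ε', OpenXXZ.Params.separateBra_eq_bis hgeneric
    (OpenXXZ.Params.sepInhom_of_generic hgeneric hnondeg.sinh_eta_ne) ep ε _,
    OpenXXZ.Params.separateBra_dotProduct_separateKet hreparam hgauge hnondeg hgeneric hcond ε ε' _ _⟩
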